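/- Let $k$ be an algebraically closed field. **Minimal algebras.** Let $\mathcal T$ be a finite set of vertices, each declared trivial or non-trivial, with a non-zero polynomial $\phi_X\in k[x]$ attached to each non-trivial vertex $X$. Put $R_X=k$ if $X$ is trivial and $R_X=k[x,\phi_X(x)^{-1}]$ otherwise. The algebra $R=\prod_{X\in\mathcal T}R_X$ is called a minimal algebra; $1_X$ is the identity of $R_X$. Tensor powers $R^{\otimes p}$ are over $k$. We multiply matrices over $\Delta=\bigoplus_{p\ge1}R^{\otimes p}$ by the usual matrix product, where $(r_1\otimes\cdots\otimes r_p)(s_1\otimes\cdots\otimes s_q)=r_1\otimes\cdots\otimes r_ps_1\otimes\cdots\otimes s_q$. The algebra $R\otimes R$ acts on $R^{\otimes p}$, $p\ge 2$, through the two outer factors. For an $R\otimes R$-bimodule of matrices $\mathcal S_1\subseteq M_t(R\otimes R)$ put $\mathcal S_p=R^{\otimes(p+1)}\otimes_{R^{\otimes2}}\mathcal S_1\subseteq M_t(R^{\otimes (p+1)})$. An $R$-$R$-bimodule is quasi-free on $U_1,\dots,U_m$ if it is $\bigoplus_i (R_{X_i}\otimes R_{Y_i})U_i$ with each summand free of rank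 one over $R_{X_i}\otimes R_{Y_i}$. **Matrix bimodule problems.** A matrix bimodule problem $\mathfrak A=(R,\mathcal K,\mathcal M,H)$ consists of the following. * A minimal algebra $R$, an integer $t\ge0$ and a partition of $\{1,\dots,t\}$ into non-empty classes indexed by $\mathcal T$; we identify $X\in\mathcal T$ with its class and let $E_X$ be the diagonal matrix with $1_X$ at the positions $(i,i)$, $i\in X$, and $0$ elsewhere. * $\mathcal K=\mathcal K_0\oplus\mathcal K_1\oplus\mathcal K_2\oplus\cdots$, where $\mathcal K_0=\bigoplus_X R_XE_X\cong R$, and $\mathcal K_1$ is quasi-free on strictly upper triangular matrices $V_1,\dots,V_m$ over $R\otimes R$. Each $V_j$ has entries in $R_{X}\otimes R_{Y}$ at the positions in $X\times Y$ and zeros elsewhere, for some $X=s(v_j)$, $Y=t(v_j)$. It is required that $\mathcal K$ is closed under the matrix product, so that $V_iV_j=\sum_l\gamma_{ijl}\otimes_{R^{\otimes2}}V_l$ with $\gamma_{ijl}\in R^{\otimes3}$. * $\mathcal M=\mathcal M_1\oplus\mathcal M_2\oplus\cdots$, where $\mathcal M_1$ is quasi-free on matrices $A_1,\dots,A_n$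 over $k$, each $A_l$ being supported at the positions in $X\times Y$ for some $X=s(a_l)$, $Y=t(a_l)$ and regarded as a matrix over $k\,1_X\otimes 1_Y$. The $A_l$ form a normalized basis of their $k$-span: order the positions by $(i,j)\preccurlyeq(i',j')$ iff $i>i'$, or $i=i'$ and $j\le j'$, and let the leading position of a non-zero matrix be the first position of a non-zero entry; then each leading entry is $1$, each $A_l$ vanishes at the leading positions of the others, and the $A_l$ are listed in the order of their leading positions. It is required that $\mathcal M$ is a $\mathcal K$-$\mathcal K$-bimodule under the matrix product, so that $V_iA_j=\sum_l\eta_{ijl}\otimes_{R^{\otimes2}}A_l$ and $A_iV_j=\sum_l\sigma_{ijl}\otimes_{R^{\otimes2}}A_l$ with $\eta_{ijl},\sigma_{ijl}\in R^{\otimes3}$. * A matrix $H=\sum_{X}H_X\in M_t(R)$, where $H_X=(h_{ij})$ has entries in $R_X$ at the positions in $X\times X$ and zeros elsewhere, such that the derivation $U\mapsto UH-HU$ maps $\mathcal K_1$ into $\mathcal M_1$: $V_iH-HV_i=\sum_l\zeta_{il}\otimes_{R^{\otimes2}}A_l$ with $\zeta_{il}\in R\otimes R$. (It maps $\mathcal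 K_0$ to $0$.) All the coefficients are normalized so as to lie in the summands determined by the supports; they are then unique, because of the quasi-freeness. **The associated bocs.** Let $\mathcal C=\mathcal C_0\oplus\mathcal C_1$, where $\mathcal C_0=\bigoplus_X R_Xe_X\cong R$ and $\mathcal C_1$ is the quasi-free $R$-$R$-bimodule on $v_1,\dots,v_m$, with $1_{s(v_j)}v_j1_{t(v_j)}=v_j$; let $\mathcal N$ be the quasi-free $R$-$R$-bimodule on $a_1,\dots,a_n$, with $1_{s(a_l)}a_l1_{t(a_l)}=a_l$. Then $\mathcal C$ is a coalgebra over $R$ with counit $e_X\mapsto1_X$, $v_j\mapsto0$ and comultiplication $e_X\mapsto e_X\otimes e_X$, $v_l\mapsto e_{s(v_l)}\otimes v_l+v_l\otimes e_{t(v_l)}+\sum_{i,j}\gamma_{ijl}\otimes_{R^{\otimes3}}(v_i\otimes_Rv_j)$, where $(r\otimes s\otimes w)\otimes_{R^{\otimes3}}(u\otimes_R u')=ru\otimes_R su'w$. There are bimodule maps $$\iota:\mathcal N\to\mathcal C\otimes_R\mathcal N,\quad a_l\mapsto e_{s(a_l)}\otimes a_l+\sum_{i,j}\eta_{ijl}\otimes_{R^{\otimes3}}(v_i\otimes_Ra_j),$$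 $$\tau:\mathcal N\to\mathcal N\otimes_R\mathcal C,\quad a_l\mapsto a_l\otimes e_{t(a_l)}+\sum_{i,j}\sigma_{ijl}\otimes_{R^{\otimes3}}(a_i\otimes_Rv_j),$$ $$\partial:\mathcal N\to\mathcal C,\quad a_l\mapsto\sum_i\zeta_{il}\otimes_{R^{\otimes2}}v_i.$$ Let $\Gamma=\bigoplus_{p\ge0}\mathcal N^{\otimes_R p}$ be the tensor algebra of $\mathcal N$ over $R$, let $\Xi=\Gamma\otimes_R\mathcal C\otimes_R\Gamma$ with the induced coalgebra structure over $\Gamma$, and let $\kappa_1,\kappa_2,\kappa_3:\mathcal N\to\Xi$ be $\iota,\tau,\partial$ followed by the canonical maps of $\mathcal C\otimes_R\mathcal N$, $\mathcal N\otimes_R\mathcal C$ and $\mathcal C$ into $\Xi$. The sub-bimodule of $\Xi$ generated by the image of $\kappa_1-\kappa_2+\kappa_3$ is a coideal, and the bocs associated to $\mathfrak A$ is $\mathfrak B=(\Gamma,\Omega)$, where the coalgebra $\Omega$ is the quotient of $\Xi$ by this coideal. **The category $R(\mathfrak B)$.** Maps are composed as if they were written on the right. Its objects are the finite-dimensional $\Gamma$-modules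 $P$ in this convention, i.e. right $\Gamma$-modules in the usual notation, so that $a_l$ acts as a map $P1_{s(a_l)}\to P1_{t(a_l)}$. A morphism $P\to Q$ is a $\Gamma$-linear map $P\otimes_\Gamma\Omega\to Q$. Identities and composites are induced by the counit and by the comultiplication of $\Omega$. **The category $R(\mathfrak A)$.** A Weyr matrix of eigenvalue $\lambda$ is a block matrix with diagonal blocks $\lambda I_{m_1},\dots,\lambda I_{m_d}$, $m_1\ge\cdots\ge m_d$, with the blocks $\binom{I_{m_{j+1}}}{0}$ of size $m_j\times m_{j+1}$ next to the diagonal (above it), and with zeros elsewhere; a Weyr matrix is a direct sum of such matrices with distinct eigenvalues. A matrix is $R_X$-regular if it is an identity matrix in case $X$ is trivial, and a Weyr matrix at whose eigenvalues $\phi_X$ does not vanish in case $X$ is non-trivial. An object $\bar P$ of $R(\mathfrak A)$ consists of integers $m_X\ge0$, of $R_X$-regular matrices $W_X\in M_{m_X}(k)$ $(X\in\mathcal T)$, and of matrices $\bar P(a_l)\in M_{m_{s(a_l)}\times m_{t(a_l)}}(k)$ $(1\le l\le n)$; it is written as the partitioned matrix, with $m_X$ rows and columns for each $i\in X$, $$\bar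 P=\sum_XH_X(W_X)+\sum_l\bar P(a_l)*A_l .$$ Here $H_X(W_X)$ has the blocks $h_{ij}(W_X)$, and, for a matrix $U=(\alpha_{ij})$ over $R\otimes R$, the block of $C*U$ at $(i,j)$ is $\sum r(W)\,C\,s(W')$ if $\alpha_{ij}=\sum r\otimes s$, where $W$ and $W'$ are the regular matrices belonging to the rows and to the columns. A morphism $\bar f:\bar P\to\bar Q$, where $\bar Q$ has the integers $n_X$ and the regular matrices $W'_X$, consists of matrices $\bar f_X\in M_{m_X\times n_X}(k)$ with $W_X\bar f_X=\bar f_XW'_X$ and of matrices $\bar f(v_j)\in M_{m_{s(v_j)}\times n_{t(v_j)}}(k)$, such that $\bar P\bar f=\bar f\bar Q$ for the partitioned matrix $$\bar f=\sum_X\bar f_X*E_X+\sum_j\bar f(v_j)*V_j ,$$ where $\bar f_X*E_X$ is the block diagonal matrix with the block $\bar f_X$ at $(i,i)$ for $i\in X$. The composite of $\bar f:\bar P\to\bar Q$ and $\bar g:\bar Q\to\bar U$ is given by $$(\bar f\bar g)_X=\bar f_X\bar g_X,\qquad (\bar f\bar g)(v_l)=\bar f_{s(v_l)}\,\bar g(v_l)+\bar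 f(v_l)\,\bar g_{t(v_l)}+\sum_{i,j}\gamma_{ijl}\otimes_{R^{\otimes3}}\big(\bar f(v_i)\otimes_R\bar g(v_j)\big),$$ where $(r\otimes s\otimes w)\otimes_{R^{\otimes3}}(C\otimes_R D)=r(W)\,C\,s(W')\,D\,w(W'')$; its partitioned matrix is the product of those of $\bar f$ and $\bar g$. **Theorem.** For every matrix bimodule problem $\mathfrak A$ with associated bocs $\mathfrak B$, the categories $R(\mathfrak A)$ and $R(\mathfrak B)$ are equivalent. -/

import Mathlib

open scoped TensorProduct Polynomial
open CategoryTheory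

universe u

noncomputable section

/-- An `A`-`B`-bimodule over the field `k` (the two actions of `k` coincide):
`l a m` is `a m` and `r b m` is `m b`. -/
structure BiMod (k : Type u) [Field k] (A B : Type u) [Ring A] [Ring B]
    [Algebra k A] [Algebra k B] where
  carrier : Type u
  [grp : AddCommGroup carrier]
  [mod : Module k carrier]
  l : A →ₗ[k] carrier →ₗ[k] carrier
  r : B →ₗ[k] carrier →ₗ[k] carrier
  l_one : ∀ m, l 1 m = m
  l_mul : ∀ a b m, l (a * b) m = l a (l b m)
  r_one : ∀ m, r 1 m = m
  r_mul : ∀ a b m, r (a * b) m = r b (r a m)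
  comm : ∀ a b m, l a (r b m) = r b (l a m)

namespace BiMod

attribute [instance] BiMod.grp BiMod.mod

variable {k : Type u} [Field k] {A B C D : Type u} [Ring A] [Ring B] [Ring C] [Ring D]
  [Algebra k A] [Algebra k B] [Algebra k C] [Algebra k D]

instance : CoeSort (BiMod k A B) (Type u) := ⟨BiMod.carrier⟩

/-- Homomorphisms of bimodules. -/
@[ext]
structure Hom (M N : BiMod k A B) where
  toLin : M →ₗ[k] N
  map_l : ∀ a m, toLin (M.l a m) = N.l a (toLin m)
  map_r : ∀ b m, toLin (M.r b m) = N.r b (toLin m)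

instance (M N : BiMod k A B) : CoeFun (Hom M N) (fun _ => M → N) := ⟨fun f => f.toLin⟩

def Hom.id (M : BiMod k A B) : Hom M M := ⟨LinearMap.id, fun _ _ => rfl, fun _ _ => rfl⟩

/-- `g.comp f` is `f` followed by `g`. -/
def Hom.comp {M N P : BiMod k A B} (g : Hom N P) (f : Hom M N) : Hom M P :=
  ⟨g.toLin ∘ₗ f.toLin, fun a m => by simp [f.map_l, g.map_l], fun a m => by simp [f.map_r, g.map_r]⟩

/-- The regular bimodule. -/
def reg (k : Type u) [Field k] (A : Type u) [Ring A] [Algebra k A] : BiMod k A A where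
  carrier := A
  l := LinearMap.mul k A
  r := (LinearMap.mul k A).flip
  l_one := by simp
  l_mul := by simp [mul_assoc]
  r_one := by simp
  r_mul := by simp [mul_assoc]
  comm := by simp [mul_assoc]

/-- Restriction of the actions along algebra homomorphisms. -/
abbrev res (f : A →ₐ[k] B) (g : C →ₐ[k] D) (M : BiMod k B D) : BiMod k A C where
  carrier := M.carrier
  l := M.l ∘ₗ f.toLinearMap
  r := M.r ∘ₗ g.toLinearMap
  l_one := by simp [M.l_one]
  l_mul := by simp [M.l_mul]
  r_one := by simp [M.r_one]
  r_mul := by simp [M.r_mul]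
  comm := by simp [M.comm]

/-- Direct sum of two bimodules. -/
def prod (M N : BiMod k A B) : BiMod k A B where
  carrier := M × N
  l := LinearMap.mk₂ k (fun a x => (M.l a x.1, N.l a x.2)) (by simp) (by simp) (by simp) (by simp)
  r := LinearMap.mk₂ k (fun a x => (M.r a x.1, N.r a x.2)) (by simp) (by simp) (by simp) (by simp)
  l_one := by simp [M.l_one, N.l_one]
  l_mul := by simp [M.l_mul, N.l_mul]
  r_one := by simp [M.r_one, N.r_one]
  r_mul := by simp [M.r_mul, N.r_mul]
  comm := by simp [M.comm, N.comm]

/-! #### Tensor products over a possibly non-commutative algebra -/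

/-- The relations `m b ⊗ n = m ⊗ b n`. -/
def balRel (M : BiMod k A B) (N : BiMod k B C) : Submodule k (M ⊗[k] N) :=
  Submodule.span k {z | ∃ m b n, z = M.r b m ⊗ₜ[k] n - m ⊗ₜ[k] N.l b n}

/-- The underlying vector space of `M ⊗_B N`. -/
def Bal (M : BiMod k A B) (N : BiMod k B C) : Type u := (M ⊗[k] N) ⧸ balRel M N

instance (M : BiMod k A B) (N : BiMod k B C) : AddCommGroup (Bal M N) :=
  inferInstanceAs (AddCommGroup ((M ⊗[k] N) ⧸ balRel M N))

instance (M : BiMod k A B) (N : BiMod k B C) : Module k (Bal M N) :=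
  inferInstanceAs (Module k ((M ⊗[k] N) ⧸ balRel M N))

/-- The quotient map onto `M ⊗_B N`. -/
def Bal.proj (M : BiMod k A B) (N : BiMod k B C) : (M ⊗[k] N) →ₗ[k] Bal M N := (balRel M N).mkQ

/-- The pure tensors `m ⊗ n` in `M ⊗_B N`. -/
def Bal.mk (M : BiMod k A B) (N : BiMod k B C) : M →ₗ[k] N →ₗ[k] Bal M N :=
  (TensorProduct.mk k M N).compr₂ (Bal.proj M N)

theorem Bal.mk_bal {M : BiMod k A B} {N : BiMod k B C} (m : M) (b : B) (n : N) :
    Bal.mk M N (M.r b m) n = Bal.mk M N m (N.l b n) := by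
  simp only [Bal.mk, LinearMap.compr₂_apply, TensorProduct.mk_apply]
  rw [← sub_eq_zero, ← map_sub]
  exact (Submodule.Quotient.mk_eq_zero _).2 (Submodule.subset_span ⟨m, b, n, rfl⟩)

/-- A balanced bilinear map induces a linear map on `M ⊗_B N`. -/
def Bal.lift {M : BiMod k A B} {N : BiMod k B C} {Z : Type u} [AddCommGroup Z] [Module k Z]
    (f : M →ₗ[k] N →ₗ[k] Z) (h : ∀ m b n, f (M.r b m) n = f m (N.l b n)) : Bal M N →ₗ[k] Z :=
  (balRel M N).liftQ (TensorProduct.lift f) (by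
    rw [balRel, Submodule.span_le]
    rintro _ ⟨m, b, n, rfl⟩
    simp [h])

theorem Bal.lift_mk {M : BiMod k A B} {N : BiMod k B C} {Z : Type u} [AddCommGroup Z]
    [Module k Z] (f : M →ₗ[k] N →ₗ[k] Z) (h) (m : M) (n : N) :
    Bal.lift f h (Bal.mk M N m n) = f m n := by
  change TensorProduct.lift f (m ⊗ₜ n) = f m n
  simp

theorem Bal.ext {M : BiMod k A B} {N : BiMod k B C} {Z : Type u} [AddCommGroup Z]
    [Module k Z] {f g : Bal M N →ₗ[k] Z}
    (h : ∀ m n, f (Bal.mk M N m n) = g (Bal.mk M N m n)) : f = g :=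
  Submodule.linearMap_qext _ (TensorProduct.ext' h)

theorem Bal.ext_apply {M : BiMod k A B} {N : BiMod k B C} {Z : Type u} [AddCommGroup Z]
    [Module k Z] {f g : Bal M N →ₗ[k] Z}
    (h : ∀ m n, f (Bal.mk M N m n) = g (Bal.mk M N m n)) (z : Bal M N) : f z = g z := by
  rw [Bal.ext h]

/-- `a (m ⊗ n) = a m ⊗ n`. -/
def Bal.left (M : BiMod k A B) (N : BiMod k B C) (a : A) : Bal M N →ₗ[k] Bal M N :=
  Bal.lift ((Bal.mk M N) ∘ₗ M.l a) (fun m b n => by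
    simp only [LinearMap.comp_apply, M.comm, Bal.mk_bal])

/-- `(m ⊗ n) c = m ⊗ n c`. -/
def Bal.right (M : BiMod k A B) (N : BiMod k B C) (c : C) : Bal M N →ₗ[k] Bal M N :=
  Bal.lift ((Bal.mk M N).flip ∘ₗ N.r c).flip (fun m b n => by
    simp only [LinearMap.flip_apply, LinearMap.comp_apply, ← N.comm, Bal.mk_bal])

theorem Bal.left_mk {M : BiMod k A B} {N : BiMod k B C} (a : A) (m : M) (n : N) :
    Bal.left M N a (Bal.mk M N m n) = Bal.mk M N (M.l a m) n := by
  rw [Bal.left, Bal.lift_mk]; rfl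

theorem Bal.right_mk {M : BiMod k A B} {N : BiMod k B C} (c : C) (m : M) (n : N) :
    Bal.right M N c (Bal.mk M N m n) = Bal.mk M N m (N.r c n) := by
  rw [Bal.right, Bal.lift_mk]; rfl

/-- The tensor product `M ⊗_B N`, an `A`-`C`-bimodule. -/
def tens (M : BiMod k A B) (N : BiMod k B C) : BiMod k A C where
  carrier := Bal M N
  l :=
    { toFun := Bal.left M N
      map_add' := fun a b => Bal.ext (by simp [Bal.left_mk])
      map_smul' := fun a b => Bal.ext (by simp [Bal.left_mk]) }
  r :=
    { toFun := Bal.right M N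
      map_add' := fun a b => Bal.ext (by simp [Bal.right_mk])
      map_smul' := fun a b => Bal.ext (by simp [Bal.right_mk]) }
  l_one := fun z => Bal.ext_apply (f := Bal.left M N 1) (g := LinearMap.id)
    (by simp [Bal.left_mk, M.l_one]) z
  l_mul := fun a b z => Bal.ext_apply (f := Bal.left M N (a * b))
    (g := Bal.left M N a ∘ₗ Bal.left M N b) (by simp [Bal.left_mk, M.l_mul]) z
  r_one := fun z => Bal.ext_apply (f := Bal.right M N 1) (g := LinearMap.id)
    (by simp [Bal.right_mk, N.r_one]) z
  r_mul := fun a b z => Bal.ext_apply (f := Bal.right M N (a * b))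
    (g := Bal.right M N b ∘ₗ Bal.right M N a) (by simp [Bal.right_mk, N.r_mul]) z
  comm := fun a b z =>
    Bal.ext_apply (f := Bal.left M N a ∘ₗ Bal.right M N b)
      (g := Bal.right M N b ∘ₗ Bal.left M N a) (by simp [Bal.left_mk, Bal.right_mk]) z

/-- The pure tensor `m ⊗ n`, as a bilinear map into the bimodule `M ⊗_B N`. -/
def tmul (M : BiMod k A B) (N : BiMod k B C) : M →ₗ[k] N →ₗ[k] tens M N := Bal.mk M N

theorem tmul_bal {M : BiMod k A B} {N : BiMod k B C} (m : M) (b : B) (n : N) :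
    tmul M N (M.r b m) n = tmul M N m (N.l b n) := Bal.mk_bal m b n

@[simp] theorem tens_l {M : BiMod k A B} {N : BiMod k B C} (a : A) (m : M) (n : N) :
    (tens M N).l a (tmul M N m n) = tmul M N (M.l a m) n := Bal.left_mk a m n

@[simp] theorem tens_r {M : BiMod k A B} {N : BiMod k B C} (c : C) (m : M) (n : N) :
    (tens M N).r c (tmul M N m n) = tmul M N m (N.r c n) := Bal.right_mk c m n

theorem tens_ext {M : BiMod k A B} {N : BiMod k B C} {Z : Type u} [AddCommGroup Z]
    [Module k Z] {f g : tens M N →ₗ[k] Z}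
    (h : ∀ m n, f (tmul M N m n) = g (tmul M N m n)) : f = g := Bal.ext h

theorem tens_ext_apply {M : BiMod k A B} {N : BiMod k B C} {Z : Type u} [AddCommGroup Z]
    [Module k Z] {f g : tens M N →ₗ[k] Z}
    (h : ∀ m n, f (tmul M N m n) = g (tmul M N m n)) (z : tens M N) : f z = g z := by
  rw [tens_ext h]

/-- Linear maps out of `M ⊗_B N` from balanced bilinear maps. -/
def tensLin {M : BiMod k A B} {N : BiMod k B C} {Z : Type u} [AddCommGroup Z] [Module k Z]
    (f : M →ₗ[k] N →ₗ[k] Z) (h : ∀ m b n, f (M.r b m) n = f m (N.l b n)) :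
    tens M N →ₗ[k] Z := Bal.lift f h

@[simp] theorem tensLin_tmul {M : BiMod k A B} {N : BiMod k B C} {Z : Type u} [AddCommGroup Z]
    [Module k Z] (f : M →ₗ[k] N →ₗ[k] Z) (h : ∀ m b n, f (M.r b m) n = f m (N.l b n))
    (m : M) (n : N) : tensLin f h (tmul M N m n) = f m n := Bal.lift_mk f h m n

/-- Bimodule maps out of `M ⊗_B N` from balanced bilinear maps. -/
def tensLift {M : BiMod k A B} {N : BiMod k B C} {P : BiMod k A C} (f : M →ₗ[k] N →ₗ[k] P)
    (h : ∀ m b n, f (M.r b m) n = f m (N.l b n))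
    (hl : ∀ a m n, f (M.l a m) n = P.l a (f m n))
    (hr : ∀ c m n, f m (N.r c n) = P.r c (f m n)) : Hom (tens M N) P where
  toLin := tensLin f h
  map_l := fun a z => tens_ext_apply (f := tensLin f h ∘ₗ (tens M N).l a)
    (g := P.l a ∘ₗ tensLin f h) (by simp [hl]) z
  map_r := fun c z => tens_ext_apply (f := tensLin f h ∘ₗ (tens M N).r c)
    (g := P.r c ∘ₗ tensLin f h) (by simp [hr]) z

@[simp] theorem tensLift_tmul {M : BiMod k A B} {N : BiMod k B C} {P : BiMod k A C}
    (f : M →ₗ[k] N →ₗ[k] P) (h : ∀ m b n, f (M.r b m) n = f m (N.l b n))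
    (hl : ∀ a m n, f (M.l a m) n = P.l a (f m n))
    (hr : ∀ c m n, f m (N.r c n) = P.r c (f m n)) (m : M) (n : N) :
    (tensLift f h hl hr).toLin (tmul M N m n) = f m n := tensLin_tmul f h m n

/-- `f ⊗ g`. -/
def tensMap {M M' : BiMod k A B} {N N' : BiMod k B C} (f : Hom M M') (g : Hom N N') :
    Hom (tens M N) (tens M' N') :=
  tensLift ((tmul M' N').compl₁₂ f.toLin g.toLin)
    (by simp [f.map_r, g.map_l, tmul_bal]) (by simp [f.map_l]) (by simp [g.map_r])

@[simp] theorem tensMap_tmul {M M' : BiMod k A B} {N N' : BiMod k B C} (f : Hom M M')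
    (g : Hom N N') (m : M) (n : N) :
    (tensMap f g).toLin (tmul M N m n) = tmul M' N' (f m) (g n) := by
  simp [tensMap]

/-- For fixed `m`, the map `n ⊗ p ↦ (m ⊗ n) ⊗ p`. -/
def assocAux (M : BiMod k A B) (N : BiMod k B C) (P : BiMod k C D) :
    M →ₗ[k] (tens N P) →ₗ[k] tens (tens M N) P where
  toFun m := tensLin (tmul (tens M N) P ∘ₗ tmul M N m) (fun n b p => by simp [← tmul_bal])
  map_add' _ _ := tens_ext (by simp)
  map_smul' _ _ := tens_ext (by simp)

@[simp] theorem assocAux_tmul {M : BiMod k A B} {N : BiMod k B C} {P : BiMod k C D}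
    (m : M) (n : N) (p : P) :
    assocAux M N P m (tmul N P n p) = tmul (tens M N) P (tmul M N m n) p :=
  tensLin_tmul _ (fun n b p => by simp [← tmul_bal]) _ _

/-- The canonical map `M ⊗ (N ⊗ P) → (M ⊗ N) ⊗ P`. -/
def tensAssoc (M : BiMod k A B) (N : BiMod k B C) (P : BiMod k C D) :
    Hom (tens M (tens N P)) (tens (tens M N) P) :=
  tensLift (assocAux M N P)
    (fun m b z => tens_ext_apply (f := assocAux M N P (M.r b m))
      (g := assocAux M N P m ∘ₗ (tens N P).l b) (by simp [tmul_bal]) z)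
    (fun a m z => tens_ext_apply (f := assocAux M N P (M.l a m))
      (g := (tens (tens M N) P).l a ∘ₗ assocAux M N P m) (by simp) z)
    (fun c m z => tens_ext_apply (f := assocAux M N P m ∘ₗ (tens N P).r c)
      (g := (tens (tens M N) P).r c ∘ₗ assocAux M N P m) (by simp) z)

@[simp] theorem tensAssoc_tmul {M : BiMod k A B} {N : BiMod k B C} {P : BiMod k C D}
    (m : M) (z : tens N P) :
    (tensAssoc M N P).toLin (tmul M (tens N P) m z) = assocAux M N P m z := by
  simp [tensAssoc]

/-- The canonical map `A ⊗_A M → M`, `a ⊗ m ↦ a m`. -/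
def lUnit (M : BiMod k A B) : Hom (tens (reg k A) M) M :=
  tensLift (M := reg k A) M.l (fun a b m => M.l_mul a b m) (fun a b m => M.l_mul a b m)
    (fun c a m => M.comm a c m)

/-- The canonical map `M ⊗_B B → M`, `m ⊗ b ↦ m b`. -/
def rUnit (M : BiMod k A B) : Hom (tens M (reg k B)) M :=
  tensLift (N := reg k B) M.r.flip (fun m b c => (M.r_mul b c m).symm)
    (fun a m b => (M.comm a b m).symm) (fun c m b => M.r_mul b c m)

@[simp] theorem lUnit_tmul (M : BiMod k A B) (a : (reg k A).carrier) (m : M) :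
    (lUnit M).toLin (tmul (reg k A) M a m) = M.l a m := by
  exact tensLift_tmul (M := reg k A) (N := M) M.l _ _ _ _ _

@[simp] theorem rUnit_tmul (M : BiMod k A B) (m : M) (b : (reg k B).carrier) :
    (rUnit M).toLin (tmul M (reg k B) m b) = M.r b m := by
  exact tensLift_tmul (M := M) (N := reg k B) M.r.flip _ _ _ _ _

/-! #### Sub-bimodules and quotients -/

/-- The sub-bimodule generated by a set. -/
def gen (M : BiMod k A B) (S : Set M) : Submodule k M :=
  Submodule.span k {z | ∃ a b, ∃ s ∈ S, z = M.l a (M.r b s)}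

theorem gen_l (M : BiMod k A B) (S : Set M) (a : A) : gen M S ≤ (gen M S).comap (M.l a) := by
  rw [gen, Submodule.span_le]
  rintro _ ⟨a', b, s, hs, rfl⟩
  exact Submodule.subset_span ⟨a * a', b, s, hs, by rw [M.l_mul]⟩

theorem gen_r (M : BiMod k A B) (S : Set M) (b : B) : gen M S ≤ (gen M S).comap (M.r b) := by
  rw [gen, Submodule.span_le]
  rintro _ ⟨a, b', s, hs, rfl⟩
  exact Submodule.subset_span ⟨a, b' * b, s, hs, by rw [M.r_mul, ← M.comm]⟩

/-- The quotient of a bimodule by the sub-bimodule generated by a set. -/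
def quot (M : BiMod k A B) (S : Set M) : BiMod k A B where
  carrier := M ⧸ gen M S
  l :=
    { toFun := fun a => (gen M S).mapQ _ (M.l a) (gen_l M S a)
      map_add' := fun a b => Submodule.linearMap_qext _ (by ext; simp)
      map_smul' := fun a b => Submodule.linearMap_qext _ (by ext; simp) }
  r :=
    { toFun := fun a => (gen M S).mapQ _ (M.r a) (gen_r M S a)
      map_add' := fun a b => Submodule.linearMap_qext _ (by ext; simp)
      map_smul' := fun a b => Submodule.linearMap_qext _ (by ext; simp) }
  l_one := fun z => by
    obtain ⟨x, rfl⟩ := Submodule.Quotient.mk_surjective _ z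
    simp [M.l_one]
  l_mul := fun a b z => by
    obtain ⟨x, rfl⟩ := Submodule.Quotient.mk_surjective _ z
    simp [M.l_mul]
  r_one := fun z => by
    obtain ⟨x, rfl⟩ := Submodule.Quotient.mk_surjective _ z
    simp [M.r_one]
  r_mul := fun a b z => by
    obtain ⟨x, rfl⟩ := Submodule.Quotient.mk_surjective _ z
    simp [M.r_mul]
  comm := fun a b z => by
    obtain ⟨x, rfl⟩ := Submodule.Quotient.mk_surjective _ z
    simp [M.comm]

/-- The projection onto a quotient bimodule. -/
def quotMk (M : BiMod k A B) (S : Set M) : Hom M (quot M S) :=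
  ⟨(gen M S).mkQ, fun _ _ => rfl, fun _ _ => rfl⟩

theorem quotMk_eq_zero (M : BiMod k A B) (S : Set M) {s : M} (hs : s ∈ S) :
    (quotMk M S).toLin s = 0 :=
  (Submodule.Quotient.mk_eq_zero _).2
    (Submodule.subset_span ⟨1, 1, s, hs, by rw [M.l_one, M.r_one]⟩)

theorem quot_ext {M : BiMod k A B} {S : Set M} {N : BiMod k A B} {f g : Hom (quot M S) N}
    (h : ∀ m, f.toLin ((quotMk M S).toLin m) = g.toLin ((quotMk M S).toLin m)) : f = g := by
  ext1
  exact Submodule.linearMap_qext _ (LinearMap.ext h)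

/-- A bimodule map that kills `S` descends to the quotient. -/
def quotLift {M : BiMod k A B} {S : Set M} {N : BiMod k A B} (f : Hom M N)
    (h : ∀ s ∈ S, f.toLin s = 0) : Hom (quot M S) N where
  toLin := (gen M S).liftQ f.toLin (by
    rw [gen, Submodule.span_le]
    rintro _ ⟨a, b, s, hs, rfl⟩
    simp [f.map_l, f.map_r, h s hs])
  map_l := fun a z => by
    obtain ⟨x, rfl⟩ := Submodule.Quotient.mk_surjective _ z
    exact f.map_l a x
  map_r := fun a z => by
    obtain ⟨x, rfl⟩ := Submodule.Quotient.mk_surjective _ z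
    exact f.map_r a x

@[simp] theorem quotLift_mk {M : BiMod k A B} {S : Set M} {N : BiMod k A B} (f : Hom M N)
    (h : ∀ s ∈ S, f.toLin s = 0) (m : M) :
    (quotLift f h).toLin ((quotMk M S).toLin m) = f.toLin m := rfl

end BiMod

/-! ### Bocses and their representations -/

/-- A bocs over `k`: a `k`-algebra `Γ` and a `Γ`-`Γ`-bimodule `Ω` with a coalgebra structure. -/
structure Bocs (k : Type u) [Field k] where
  Γ : Type u
  [ring : Ring Γ]
  [alg : Algebra k Γ]
  Ω : BiMod k Γ Γ
  ε : BiMod.Hom Ω (BiMod.reg k Γ)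
  μ : BiMod.Hom Ω (BiMod.tens Ω Ω)
  counit_left : ∀ w, BiMod.lUnit Ω (BiMod.tensMap ε (BiMod.Hom.id Ω) (μ w)) = w
  counit_right : ∀ w, BiMod.rUnit Ω (BiMod.tensMap (BiMod.Hom.id Ω) ε (μ w)) = w
  coassoc : ∀ w, BiMod.tensAssoc Ω Ω Ω (BiMod.tensMap (BiMod.Hom.id Ω) μ (μ w)) =
    BiMod.tensMap μ (BiMod.Hom.id Ω) (μ w)

namespace Bocs

attribute [instance] Bocs.ring Bocs.alg

variable {k : Type u} [Field k] (𝔅 : Bocs k)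

/-- A representation of a bocs is a finite-dimensional `Γ`-module `P`.  Maps are composed as if
they were written on the right: the product `a b` acts by `a` first and by `b` afterwards, so `P`
is a right `Γ`-module, i.e. a `k`-`Γ`-bimodule. -/
structure Rep where
  P : BiMod k k 𝔅.Γ
  fin : Module.Finite k P

variable {𝔅}

/-- A morphism from `P` to `Q` is a `Γ`-linear map `P ⊗_Γ Ω → Q`. -/
abbrev Rep.Hom (P Q : 𝔅.Rep) : Type u := BiMod.Hom (BiMod.tens P.P 𝔅.Ω) Q.P

/-- The identity is `P ⊗ Ω → P ⊗ Γ → P`, induced by the counit. -/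
def Rep.idHom (P : 𝔅.Rep) : Rep.Hom P P :=
  (BiMod.rUnit P.P).comp (BiMod.tensMap (BiMod.Hom.id P.P) 𝔅.ε)

/-- The composite of `f` and `g` (in this order) is
`P ⊗ Ω → P ⊗ Ω ⊗ Ω → Q ⊗ Ω → U`, induced by the comultiplication, by `f` and by `g`. -/
def Rep.compHom {P Q U : 𝔅.Rep} (f : Rep.Hom P Q) (g : Rep.Hom Q U) : Rep.Hom P U :=
  BiMod.Hom.comp g ((BiMod.tensMap f (BiMod.Hom.id 𝔅.Ω)).comp
    ((BiMod.tensAssoc P.P 𝔅.Ω 𝔅.Ω).comp (BiMod.tensMap (BiMod.Hom.id P.P) 𝔅.μ)))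

theorem Rep.hom_ext {P Q : 𝔅.Rep} {f g : Rep.Hom P Q}
    (h : ∀ p w, f.toLin (BiMod.tmul P.P 𝔅.Ω p w) = g.toLin (BiMod.tmul P.P 𝔅.Ω p w)) : f = g :=
  BiMod.Hom.ext (BiMod.tens_ext h)

theorem Rep.idHom_tmul (P : 𝔅.Rep) (p : P.P) (w : 𝔅.Ω) :
    (Rep.idHom P).toLin (BiMod.tmul P.P 𝔅.Ω p w) = P.P.r (𝔅.ε w) p := by
  simp [Rep.idHom, BiMod.Hom.comp, BiMod.Hom.id]

theorem Rep.compHom_tmul {P Q U : 𝔅.Rep} (f : Rep.Hom P Q) (g : Rep.Hom Q U) (p : P.P) (w : 𝔅.Ω) :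
    (Rep.compHom f g).toLin (BiMod.tmul P.P 𝔅.Ω p w) =
      g.toLin ((BiMod.tensMap f (BiMod.Hom.id 𝔅.Ω)).toLin
        (BiMod.assocAux P.P 𝔅.Ω 𝔅.Ω p (𝔅.μ w))) := by
  simp [Rep.compHom, BiMod.Hom.comp, BiMod.Hom.id]

/-- The representation category `R(𝔅)` of a bocs. -/
instance : Category.{u} 𝔅.Rep where
  Hom := Rep.Hom
  id := Rep.idHom
  comp := Rep.compHom
  id_comp {P Q} f := Rep.hom_ext fun p w => by
    rw [Rep.compHom_tmul]
    conv_rhs => rw [← 𝔅.counit_left w]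
    refine BiMod.tens_ext_apply
      (f := f.toLin ∘ₗ (BiMod.tensMap (Rep.idHom P) (BiMod.Hom.id 𝔅.Ω)).toLin ∘ₗ
        BiMod.assocAux P.P 𝔅.Ω 𝔅.Ω p)
      (g := f.toLin ∘ₗ BiMod.tmul P.P 𝔅.Ω p ∘ₗ (BiMod.lUnit 𝔅.Ω).toLin ∘ₗ
        (BiMod.tensMap 𝔅.ε (BiMod.Hom.id 𝔅.Ω)).toLin) (fun w₁ w₂ => ?_) (𝔅.μ w)
    simp only [LinearMap.comp_apply, BiMod.assocAux_tmul, BiMod.tensMap_tmul, Rep.idHom_tmul,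
      BiMod.lUnit_tmul]
    exact congrArg f.toLin (BiMod.tmul_bal p (B := 𝔅.Γ) (𝔅.ε.toLin w₁) w₂)
  comp_id {P Q} f := Rep.hom_ext fun p w => by
    rw [Rep.compHom_tmul]
    conv_rhs => rw [← 𝔅.counit_right w]
    refine BiMod.tens_ext_apply
      (f := (Rep.idHom Q).toLin ∘ₗ (BiMod.tensMap f (BiMod.Hom.id 𝔅.Ω)).toLin ∘ₗ
        BiMod.assocAux P.P 𝔅.Ω 𝔅.Ω p)
      (g := f.toLin ∘ₗ BiMod.tmul P.P 𝔅.Ω p ∘ₗ (BiMod.rUnit 𝔅.Ω).toLin ∘ₗ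
        (BiMod.tensMap (BiMod.Hom.id 𝔅.Ω) 𝔅.ε).toLin) (fun w₁ w₂ => ?_) (𝔅.μ w)
    simp only [LinearMap.comp_apply, BiMod.assocAux_tmul, BiMod.tensMap_tmul, Rep.idHom_tmul,
      BiMod.rUnit_tmul]
    exact (f.map_r (𝔅.ε.toLin w₂ : 𝔅.Γ) _).symm.trans
      (congrArg f.toLin (BiMod.tens_r (C := 𝔅.Γ) (𝔅.ε.toLin w₂) p w₁))
  assoc {P Q U V} f g h := Rep.hom_ext fun p w => by
    rw [Rep.compHom_tmul, Rep.compHom_tmul]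
    let T : BiMod.tens (BiMod.tens 𝔅.Ω 𝔅.Ω) 𝔅.Ω →ₗ[k] V.P :=
      BiMod.tensLin (((BiMod.tmul U.P 𝔅.Ω).compr₂ h.toLin) ∘ₗ g.toLin ∘ₗ
        (BiMod.tensMap f (BiMod.Hom.id 𝔅.Ω)).toLin ∘ₗ BiMod.assocAux P.P 𝔅.Ω 𝔅.Ω p)
      (fun z b w => by
        have e : BiMod.assocAux P.P 𝔅.Ω 𝔅.Ω p ((BiMod.tens 𝔅.Ω 𝔅.Ω).r b z) =
            (BiMod.tens (BiMod.tens P.P 𝔅.Ω) 𝔅.Ω).r b (BiMod.assocAux P.P 𝔅.Ω 𝔅.Ω p z) :=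
          BiMod.tens_ext_apply (f := BiMod.assocAux P.P 𝔅.Ω 𝔅.Ω p ∘ₗ (BiMod.tens 𝔅.Ω 𝔅.Ω).r b)
            (g := (BiMod.tens (BiMod.tens P.P 𝔅.Ω) 𝔅.Ω).r b ∘ₗ
              BiMod.assocAux P.P 𝔅.Ω 𝔅.Ω p) (by simp) z
        simp only [LinearMap.comp_apply, LinearMap.compr₂_apply, e, BiMod.Hom.map_r]
        rw [BiMod.tmul_bal])
    have hT : ∀ z w, T (BiMod.tmul (BiMod.tens 𝔅.Ω 𝔅.Ω) 𝔅.Ω z w) =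
        h.toLin (BiMod.tmul U.P 𝔅.Ω (g.toLin ((BiMod.tensMap f (BiMod.Hom.id 𝔅.Ω)).toLin
          (BiMod.assocAux P.P 𝔅.Ω 𝔅.Ω p z))) w) := fun z w => by simp [T]
    trans T (BiMod.tensMap 𝔅.μ (BiMod.Hom.id 𝔅.Ω) (𝔅.μ w))
    · refine BiMod.tens_ext_apply
        (f := h.toLin ∘ₗ (BiMod.tensMap (Rep.compHom f g) (BiMod.Hom.id 𝔅.Ω)).toLin ∘ₗ
          BiMod.assocAux P.P 𝔅.Ω 𝔅.Ω p)
        (g := T ∘ₗ (BiMod.tensMap 𝔅.μ (BiMod.Hom.id 𝔅.Ω)).toLin) (fun w₁ w₂ => ?_) (𝔅.μ w)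
      simp [Rep.compHom_tmul, hT]
    · rw [← 𝔅.coassoc]
      symm
      refine BiMod.tens_ext_apply
        (f := (Rep.compHom g h).toLin ∘ₗ (BiMod.tensMap f (BiMod.Hom.id 𝔅.Ω)).toLin ∘ₗ
          BiMod.assocAux P.P 𝔅.Ω 𝔅.Ω p)
        (g := T ∘ₗ (BiMod.tensAssoc 𝔅.Ω 𝔅.Ω 𝔅.Ω).toLin ∘ₗ
          (BiMod.tensMap (BiMod.Hom.id 𝔅.Ω) 𝔅.μ).toLin) (fun w₁ w₂ => ?_) (𝔅.μ w)
      simp only [LinearMap.comp_apply, BiMod.assocAux_tmul, BiMod.tensMap_tmul,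
        BiMod.tensAssoc_tmul]
      erw [Rep.compHom_tmul]
      refine BiMod.tens_ext_apply
        (f := h.toLin ∘ₗ (BiMod.tensMap g (BiMod.Hom.id 𝔅.Ω)).toLin ∘ₗ
          BiMod.assocAux Q.P 𝔅.Ω 𝔅.Ω (f.toLin (BiMod.tmul P.P 𝔅.Ω p w₁)))
        (g := T ∘ₗ BiMod.assocAux 𝔅.Ω 𝔅.Ω 𝔅.Ω w₁) (fun w₃ w₄ => ?_) (𝔅.μ w₂)
      simp [hT, BiMod.Hom.id]

end Bocs

/-! ### Tensor powers of a commutative algebra -/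

namespace Slot

variable (k : Type u) [Field k] (R : Type u) [CommRing R] [Algebra k R]

/-- `R ⊗ R ⊗ R`. -/
abbrev R3 : Type u := R ⊗[k] (R ⊗[k] R)

/-- `R ⊗ R ⊗ R ⊗ R`. -/
abbrev R4 : Type u := R ⊗[k] (R ⊗[k] (R ⊗[k] R))

instance : CommRing (R4 k R) := inferInstance

/-- `a ⊗ b ↦ a ⊗ b ⊗ 1`. -/
def s12 : R ⊗[k] R →ₐ[k] R3 k R :=
  Algebra.TensorProduct.map (AlgHom.id k R) Algebra.TensorProduct.includeLeft

/-- `a ⊗ b ↦ 1 ⊗ a ⊗ b`. -/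
def s23 : R ⊗[k] R →ₐ[k] R3 k R := Algebra.TensorProduct.includeRight

/-- `a ⊗ b ↦ a ⊗ 1 ⊗ b`. -/
def s13 : R ⊗[k] R →ₐ[k] R3 k R :=
  Algebra.TensorProduct.map (AlgHom.id k R) Algebra.TensorProduct.includeRight

/-- `a ⊗ b ⊗ c ↦ a ⊗ b ⊗ c ⊗ 1`. -/
def s123 : R3 k R →ₐ[k] R4 k R := Algebra.TensorProduct.map (AlgHom.id k R) (s12 k R)

/-- `a ⊗ b ⊗ c ↦ 1 ⊗ a ⊗ b ⊗ c`. -/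
def s234 : R3 k R →ₐ[k] R4 k R := Algebra.TensorProduct.includeRight

/-- `a ⊗ b ⊗ c ↦ a ⊗ 1 ⊗ b ⊗ c`. -/
def s134 : R3 k R →ₐ[k] R4 k R :=
  Algebra.TensorProduct.map (AlgHom.id k R) Algebra.TensorProduct.includeRight

/-- `a ⊗ b ⊗ c ↦ a ⊗ b ⊗ 1 ⊗ c`. -/
def s124 : R3 k R →ₐ[k] R4 k R := Algebra.TensorProduct.map (AlgHom.id k R) (s13 k R)

variable {k R}

@[simp] theorem s12_tmul (a b : R) : s12 k R (a ⊗ₜ b) = a ⊗ₜ (b ⊗ₜ 1) := by simp [s12]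
@[simp] theorem s23_tmul (a b : R) : s23 k R (a ⊗ₜ b) = 1 ⊗ₜ (a ⊗ₜ b) := by simp [s23]
@[simp] theorem s13_tmul (a b : R) : s13 k R (a ⊗ₜ b) = a ⊗ₜ (1 ⊗ₜ b) := by simp [s13]
@[simp] theorem s123_tmul (a b c : R) :
    s123 k R (a ⊗ₜ (b ⊗ₜ c)) = a ⊗ₜ (b ⊗ₜ (c ⊗ₜ 1)) := by simp [s123]
@[simp] theorem s234_tmul (a b c : R) :
    s234 k R (a ⊗ₜ (b ⊗ₜ c)) = 1 ⊗ₜ (a ⊗ₜ (b ⊗ₜ c)) := by simp [s234]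
@[simp] theorem s134_tmul (a b c : R) :
    s134 k R (a ⊗ₜ (b ⊗ₜ c)) = a ⊗ₜ (1 ⊗ₜ (b ⊗ₜ c)) := by simp [s134]
@[simp] theorem s124_tmul (a b c : R) :
    s124 k R (a ⊗ₜ (b ⊗ₜ c)) = a ⊗ₜ (b ⊗ₜ (1 ⊗ₜ c)) := by simp [s124]

theorem r3_ext {Z : Type u} [AddCommGroup Z] [Module k Z] {f g : R3 k R →ₗ[k] Z}
    (h : ∀ a b c, f (a ⊗ₜ (b ⊗ₜ c)) = g (a ⊗ₜ (b ⊗ₜ c))) : f = g := by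
  ext a b c
  exact h a b c

/-- Contraction of the second factor by a functional. -/
def contr {S : Type u} [AddCommGroup S] [Module k S] (ξ : R →ₗ[k] k) :
    R ⊗[k] (R ⊗[k] S) →ₗ[k] R ⊗[k] S :=
  LinearMap.lTensor R ((TensorProduct.lid k S).toLinearMap ∘ₗ LinearMap.rTensor S ξ)

@[simp] theorem contr_tmul {S : Type u} [AddCommGroup S] [Module k S] (ξ : R →ₗ[k] k)
    (a b : R) (s : S) : contr ξ (a ⊗ₜ[k] (b ⊗ₜ[k] s)) = ξ b • (a ⊗ₜ s) := by
  simp [contr, TensorProduct.tmul_smul]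

theorem eq_zero_of_contr {S : Type u} [AddCommGroup S] [Module k S] (z : R ⊗[k] (R ⊗[k] S))
    (h : ∀ ξ : R →ₗ[k] k, contr ξ z = 0) : z = 0 := by
  let b := Module.Free.chooseBasis k R
  let e := TensorProduct.leftComm k R R S ≪≫ₗ TensorProduct.equivFinsuppOfBasisLeft b
  apply e.injective
  rw [map_zero]
  ext1 i
  have : (Finsupp.lapply i) ∘ₗ e.toLinearMap = contr (b.coord i) := by
    ext x y s
    simp [e, contr_tmul]
  exact (LinearMap.congr_fun this z).trans (h _)

/-- Contraction is linear over the two outer factors. -/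
theorem contr_mul_s13 (ξ : R →ₗ[k] k) (c : R3 k R) (x : R ⊗[k] R) :
    contr ξ (c * s13 k R x) = contr ξ c * x := by
  induction x using TensorProduct.induction_on with
  | zero => simp
  | add x y hx hy => simp [mul_add, hx, hy]
  | tmul x y =>
    induction c using TensorProduct.induction_on with
    | zero => simp
    | add c d hc hd => simp only [map_add, add_mul, hc, hd]
    | tmul a c =>
      induction c using TensorProduct.induction_on with
      | zero => simp
      | add c d hc hd => simp only [TensorProduct.tmul_add, map_add, add_mul, hc, hd]
      | tmul b c => simp

theorem contr_mul_s134 (ξ : R →ₗ[k] k) (c : R4 k R) (x : R3 k R) :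
    contr ξ (c * s134 k R x) = contr ξ c * x := by
  induction x using TensorProduct.induction_on with
  | zero => simp
  | add x y hx hy => simp [mul_add, hx, hy]
  | tmul x y =>
    induction c using TensorProduct.induction_on with
    | zero => simp
    | add c d hc hd => simp only [map_add, add_mul, hc, hd]
    | tmul a c =>
      induction c using TensorProduct.induction_on with
      | zero => simp
      | add c d hc hd => simp only [TensorProduct.tmul_add, map_add, add_mul, hc, hd]
      | tmul b c =>
        simp only [s134, Algebra.TensorProduct.map_tmul, AlgHom.id_apply,
          Algebra.TensorProduct.includeRight_apply, Algebra.TensorProduct.tmul_mul_tmul,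
          mul_one, contr_tmul, smul_mul_assoc]

theorem s_comp1 (x : R ⊗[k] R) : s123 k R (s13 k R x) = s134 k R (s12 k R x) := by
  induction x using TensorProduct.induction_on with
  | zero => simp
  | add x y hx hy => simp only [map_add, hx, hy]
  | tmul a b => simp

theorem s_comp2 (x : R ⊗[k] R) : s124 k R (s13 k R x) = s134 k R (s13 k R x) := by
  induction x using TensorProduct.induction_on with
  | zero => simp
  | add x y hx hy => simp only [map_add, hx, hy]
  | tmul a b => simp

theorem s_comp3 (x : R ⊗[k] R) : s124 k R (s23 k R x) = s234 k R (s13 k R x) := by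
  induction x using TensorProduct.induction_on with
  | zero => simp
  | add x y hx hy => simp only [map_add, hx, hy]
  | tmul a b => simp

theorem s_comp4 (x : R ⊗[k] R) : s124 k R (s12 k R x) = s123 k R (s12 k R x) := by
  induction x using TensorProduct.induction_on with
  | zero => simp
  | add x y hx hy => simp only [map_add, hx, hy]
  | tmul a b => simp

theorem s_comp5 (x : R ⊗[k] R) : s234 k R (s12 k R x) = s123 k R (s23 k R x) := by
  induction x using TensorProduct.induction_on with
  | zero => simp
  | add x y hx hy => simp only [map_add, hx, hy]
  | tmul a b => simp

theorem s_comp6 (x : R ⊗[k] R) : s234 k R (s23 k R x) = s134 k R (s23 k R x) := by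
  induction x using TensorProduct.induction_on with
  | zero => simp
  | add x y hx hy => simp only [map_add, hx, hy]
  | tmul a b => simp

theorem free3 {ι κ : Type} [Fintype ι] (V : ι → κ → κ → R ⊗[k] R) (E : ι → R ⊗[k] R)
    (hV : ∀ c : ι → R ⊗[k] R, (∀ p q, ∑ j, c j * V j p q = 0) → ∀ j, c j * E j = 0)
    (c : ι → R3 k R) (h : ∀ p q, ∑ j, c j * s13 k R (V j p q) = 0) (j : ι) :
    c j * s13 k R (E j) = 0 := by
  refine eq_zero_of_contr _ fun ξ => ?_
  rw [contr_mul_s13]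
  refine hV (fun j => contr ξ (c j)) (fun p q => ?_) j
  have := congrArg (contr ξ) (h p q)
  simpa only [map_sum, contr_mul_s13, map_zero] using this

theorem free4 {ι κ : Type} [Fintype ι] (V : ι → κ → κ → R ⊗[k] R) (E : ι → R ⊗[k] R)
    (hV : ∀ c : ι → R ⊗[k] R, (∀ p q, ∑ j, c j * V j p q = 0) → ∀ j, c j * E j = 0)
    (c : ι → R4 k R) (h : ∀ p q, ∑ j, c j * s134 k R (s13 k R (V j p q)) = 0) (j : ι) :
    c j * s134 k R (s13 k R (E j)) = 0 := by
  refine eq_zero_of_contr _ fun ξ => ?_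
  rw [contr_mul_s134]
  refine free3 V E hV (fun j => contr ξ (c j)) (fun p q => ?_) j
  have := congrArg (contr ξ) (h p q)
  simpa only [map_sum, contr_mul_s134, map_zero] using this

/-- Structure constants of an associative product are associative. -/
theorem assoc4 {ι κ : Type} [Fintype ι] [Fintype κ] (V : ι → κ → κ → R ⊗[k] R)
    (E : ι → R ⊗[k] R)
    (hV : ∀ c : ι → R ⊗[k] R, (∀ p q, ∑ j, c j * V j p q = 0) → ∀ j, c j * E j = 0)
    (γ : ι → ι → ι → R3 k R)
    (hγ : ∀ i j p q, ∑ r, s12 k R (V i p r) * s23 k R (V j r q) =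
      ∑ l, γ i j l * s13 k R (V l p q))
    (hE : ∀ i j l, γ i j l * s13 k R (E l) = γ i j l) (i j h l : ι) :
    ∑ m, s123 k R (γ i j m) * s134 k R (γ m h l) =
      ∑ m, s234 k R (γ j h m) * s124 k R (γ i m l) := by
  have key := free4 V E hV
    (fun l => ∑ m, s123 k R (γ i j m) * s134 k R (γ m h l) -
      ∑ m, s234 k R (γ j h m) * s124 k R (γ i m l)) (fun p q => ?_) l
  · rw [sub_mul, Finset.sum_mul, Finset.sum_mul, sub_eq_zero] at key
    simp only [mul_assoc, ← map_mul, hE] at key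
    rw [key]
    refine Finset.sum_congr rfl fun m _ => ?_
    rw [← s_comp2, ← map_mul, hE]
  · simp only [sub_mul, Finset.sum_sub_distrib, Finset.sum_mul]
    rw [sub_eq_zero, Finset.sum_comm]
    conv_rhs => rw [Finset.sum_comm]
    have l1 : ∀ m, ∑ l, s123 k R (γ i j m) * s134 k R (γ m h l) * s134 k R (s13 k R (V l p q)) =
        ∑ r, s123 k R (γ i j m * s13 k R (V m p r)) * s134 k R (s23 k R (V h r q)) := fun m => by
      simp only [mul_assoc, ← map_mul]
      rw [← Finset.mul_sum, ← map_sum, ← hγ, map_sum, Finset.mul_sum]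
      refine Finset.sum_congr rfl fun r _ => ?_
      rw [map_mul, map_mul, s_comp1, mul_assoc]
    have l2 : ∀ m, ∑ l, s234 k R (γ j h m) * s124 k R (γ i m l) * s134 k R (s13 k R (V l p q)) =
        ∑ r, s123 k R (s12 k R (V i p r)) * s234 k R (γ j h m * s13 k R (V m r q)) := fun m => by
      simp only [mul_assoc, ← s_comp2, ← map_mul]
      rw [← Finset.mul_sum, ← map_sum, ← hγ, map_sum, Finset.mul_sum]
      refine Finset.sum_congr rfl fun r _ => ?_
      rw [map_mul, map_mul, s_comp3, s_comp4, mul_left_comm]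
    simp only [l1, l2]
    rw [Finset.sum_comm]
    conv_rhs => rw [Finset.sum_comm]
    simp only [← Finset.sum_mul, ← Finset.mul_sum, ← map_sum, ← hγ]
    simp only [map_sum, map_mul, Finset.sum_mul, Finset.mul_sum, s_comp5, s_comp6, mul_assoc]
    rw [Finset.sum_comm]

end Slot

namespace BiMod

open Slot

variable {k : Type u} [Field k] {R : Type u} [CommRing R] [Algebra k R]

/-- An `R`-`R`-bimodule is an `R ⊗ R`-module: `(r ⊗ s) m = r m s`. -/
def act2 (M : BiMod k R R) : R ⊗[k] R →ₗ[k] M →ₗ[k] M :=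
  TensorProduct.lift ((LinearMap.mul k (Module.End k M)).compl₁₂ M.l M.r)

@[simp] theorem act2_tmul (M : BiMod k R R) (a b : R) (m : M) :
    act2 M (a ⊗ₜ b) m = M.l a (M.r b m) := by simp [act2]

theorem act2_one (M : BiMod k R R) (m : M) : act2 M 1 m = m := by
  rw [Algebra.TensorProduct.one_def, act2_tmul, M.l_one, M.r_one]

theorem act2_mul (M : BiMod k R R) (x y : R ⊗[k] R) (m : M) :
    act2 M (x * y) m = act2 M x (act2 M y m) := by
  induction x using TensorProduct.induction_on with
  | zero => simp
  | add x x' hx hx' => simp [add_mul, hx, hx']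
  | tmul a b =>
    induction y using TensorProduct.induction_on with
    | zero => simp
    | add y y' hy hy' => simp only [mul_add, map_add, LinearMap.add_apply, hy, hy']
    | tmul c d =>
      rw [Algebra.TensorProduct.tmul_mul_tmul, act2_tmul, act2_tmul, act2_tmul, mul_comm b d,
        M.r_mul, M.l_mul, M.comm c b]

theorem Hom.map_act2 {M N : BiMod k R R} (f : Hom M N) (x : R ⊗[k] R) (m : M) :
    f.toLin (act2 M x m) = act2 N x (f.toLin m) := by
  induction x using TensorProduct.induction_on with
  | zero => simp
  | add x x' hx hx' => simp [hx, hx']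
  | tmul a b => simp [f.map_l, f.map_r]

/-- `R`-balanced `R`-bilinear products `M × N → Z`. -/
structure Pairing (M N Z : BiMod k R R) where
  β : M →ₗ[k] N →ₗ[k] Z
  bal : ∀ m a n, β (M.r a m) n = β m (N.l a n)
  left : ∀ a m n, β (M.l a m) n = Z.l a (β m n)
  right : ∀ a m n, β m (N.r a n) = Z.r a (β m n)

/-- The universal pairing `M × N → M ⊗_R N`. -/
def tensPairing (M N : BiMod k R R) : Pairing M N (tens M N) :=
  ⟨tmul M N, tmul_bal, by simp, by simp⟩

/-- The action of `R ⊗ R ⊗ R` on a product: `(a ⊗ b ⊗ c) (m n) = a m b n c`. -/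
def Pairing.act3 {M N Z : BiMod k R R} (P : Pairing M N Z) : R3 k R →ₗ[k] M →ₗ[k] N →ₗ[k] Z :=
  TensorProduct.lift (LinearMap.mk₂ k (fun a z => P.β.compl₁₂ (M.l a) (act2 N z))
    (by intros; ext; simp) (by intros; ext; simp) (by intros; ext; simp) (by intros; ext; simp))

@[simp] theorem Pairing.act3_tmul {M N Z : BiMod k R R} (P : Pairing M N Z) (a b c : R) (m : M)
    (n : N) : P.act3 (a ⊗ₜ (b ⊗ₜ c)) m n = P.β (M.l a m) (N.l b (N.r c n)) := by
  simp [Pairing.act3]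

/-- The product of two families `(e, v)` and `(e', v')` in which `e` multiplies as an identity
element and `v i` multiplies with `v j` through the structure constants `γ i j l`. -/
def Pairing.tupMul {M N Z : BiMod k R R} (P : Pairing M N Z) {ι : Type} [Fintype ι]
    (γ : ι → ι → ι → R3 k R) (e : M) (v : ι → M) (e' : N) (v' : ι → N) (l : ι) : Z :=
  P.β e (v' l) + P.β (v l) e' + ∑ i, ∑ j, P.act3 (γ i j l) (v i) (v' j)

theorem Pairing.act3_mul_s13 {M N Z : BiMod k R R} (P : Pairing M N Z) (g : R3 k R)
    (x : R ⊗[k] R) (m : M) (n : N) :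
    P.act3 (g * s13 k R x) m n = act2 Z x (P.act3 g m n) := by
  induction x using TensorProduct.induction_on with
  | zero => simp
  | add x y hx hy => simp [mul_add, hx, hy]
  | tmul x y =>
    induction g using TensorProduct.induction_on with
    | zero => simp
    | add c d hc hd => simp only [map_add, add_mul, hc, hd, LinearMap.add_apply]
    | tmul a c =>
      induction c using TensorProduct.induction_on with
      | zero => simp
      | add c d hc hd =>
        simp only [TensorProduct.tmul_add, map_add, add_mul, hc, hd, LinearMap.add_apply]
      | tmul b c =>
        simp only [s13_tmul, Algebra.TensorProduct.tmul_mul_tmul, act3_tmul, act2_tmul, mul_one]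
        rw [mul_comm a x, M.l_mul, P.left, N.r_mul, N.comm b y, P.right]

theorem Pairing.act3_s12_mul_s23 {M N Z : BiMod k R R} (P : Pairing M N Z) (x y : R ⊗[k] R)
    (m : M) (n : N) :
    P.act3 (s12 k R x * s23 k R y) m n = P.β (act2 M x m) (act2 N y n) := by
  induction x using TensorProduct.induction_on with
  | zero => simp
  | add x x' hx hx' => simp [add_mul, hx, hx']
  | tmul a b =>
    induction y using TensorProduct.induction_on with
    | zero => simp
    | add y y' hy hy' => simp only [mul_add, map_add, LinearMap.add_apply, hy, hy']
    | tmul c d =>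
      simp only [s12_tmul, s23_tmul, Algebra.TensorProduct.tmul_mul_tmul, act3_tmul, act2_tmul,
        mul_one, one_mul]
      rw [M.comm, P.bal, N.l_mul]

section assoc

variable {M₁ M₂ M₃ M₁₂ M₂₃ Z : BiMod k R R} (P : Pairing M₁ M₂ M₁₂) (P' : Pairing M₁₂ M₃ Z)
  (Q : Pairing M₂ M₃ M₂₃) (Q' : Pairing M₁ M₂₃ Z)

/-- `(a ⊗ b ⊗ c ⊗ d) (u v w) = a u b v c w d`. -/
def act4 (u : M₁) (v : M₂) (w : M₃) : R4 k R →ₗ[k] Z :=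
  TensorProduct.lift ((TensorProduct.lift.equiv (RingHom.id k) R (R ⊗[k] R) Z).toLinearMap ∘ₗ
    LinearMap.mk₂ k
      (fun a b => (P'.β (P.β (M₁.l a u) (M₂.l b v))) ∘ₗ (act2 M₃).flip w)
      (by intros; ext; simp) (by intros; ext; simp) (by intros; ext; simp) (by intros; ext; simp))

@[simp] theorem act4_tmul (u : M₁) (v : M₂) (w : M₃) (a b c d : R) :
    act4 P P' u v w (a ⊗ₜ (b ⊗ₜ (c ⊗ₜ d))) =
      P'.β (P.β (M₁.l a u) (M₂.l b v)) (M₃.l c (M₃.r d w)) := by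
  simp [act4]

theorem act3_act3_left (g g' : R3 k R) (u : M₁) (v : M₂) (w : M₃) :
    P'.act3 g (P.act3 g' u v) w = act4 P P' u v w (s123 k R g' * s134 k R g) := by
  induction g using TensorProduct.induction_on with
  | zero => simp
  | add g h hg hh => simp only [map_add, LinearMap.add_apply, mul_add, hg, hh]
  | tmul a z =>
    induction z using TensorProduct.induction_on with
    | zero => simp
    | add g h hg hh =>
      simp only [TensorProduct.tmul_add, map_add, LinearMap.add_apply, mul_add, hg, hh]
    | tmul b c =>
      induction g' using TensorProduct.induction_on with
      | zero => simp
      | add g h hg hh => simp only [map_add, LinearMap.add_apply, add_mul, hg, hh]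
      | tmul x z =>
        induction z using TensorProduct.induction_on with
        | zero => simp
        | add g h hg hh =>
          simp only [TensorProduct.tmul_add, map_add, LinearMap.add_apply, add_mul, hg, hh]
        | tmul y z =>
          simp only [s123_tmul, s134_tmul, Algebra.TensorProduct.tmul_mul_tmul, act4_tmul,
            Pairing.act3_tmul, mul_one, one_mul]
          rw [← P.left, ← M₁.l_mul, mul_comm x a, M₂.comm, P.right, P'.bal, M₃.l_mul]

theorem act3_act3_right (h : ∀ u v w, P'.β (P.β u v) w = Q'.β u (Q.β v w)) (g g' : R3 k R)
    (u : M₁) (v : M₂) (w : M₃) :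
    Q'.act3 g u (Q.act3 g' v w) = act4 P P' u v w (s234 k R g' * s124 k R g) := by
  induction g using TensorProduct.induction_on with
  | zero => simp
  | add g h hg hh => simp only [map_add, LinearMap.add_apply, mul_add, hg, hh]
  | tmul a z =>
    induction z using TensorProduct.induction_on with
    | zero => simp
    | add g h hg hh =>
      simp only [TensorProduct.tmul_add, map_add, LinearMap.add_apply, mul_add, hg, hh]
    | tmul b c =>
      induction g' using TensorProduct.induction_on with
      | zero => simp
      | add g h hg hh => simp only [map_add, LinearMap.add_apply, add_mul, hg, hh]
      | tmul x z =>
        induction z using TensorProduct.induction_on with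
        | zero => simp
        | add g h hg hh =>
          simp only [TensorProduct.tmul_add, map_add, LinearMap.add_apply, add_mul, hg, hh]
        | tmul y z =>
          simp only [s234_tmul, s124_tmul, Algebra.TensorProduct.tmul_mul_tmul, act4_tmul,
            Pairing.act3_tmul, mul_one, one_mul]
          rw [h, ← Q.right, ← Q.left, ← M₂.l_mul, mul_comm b x, ← M₃.comm, ← M₃.r_mul,
            mul_comm z c, mul_comm c z]

theorem sum4_rot {ι : Type} [Fintype ι] {Z : Type u} [AddCommGroup Z] (f : ι → ι → ι → ι → Z) :
    ∑ i, ∑ j, ∑ a, ∑ b, f i j a b = ∑ a, ∑ b, ∑ j, ∑ i, f i j a b := by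
  have h1 : ∀ i, ∑ j, ∑ a, ∑ b, f i j a b = ∑ a, ∑ b, ∑ j, f i j a b := fun i => by
    rw [Finset.sum_comm]
    exact Finset.sum_congr rfl fun a _ => Finset.sum_comm
  simp only [h1]
  rw [Finset.sum_comm]
  refine Finset.sum_congr rfl fun a _ => ?_
  rw [Finset.sum_comm]
  exact Finset.sum_congr rfl fun b _ => Finset.sum_comm

/-- Associativity of the products of families. -/
theorem tupMul_assoc {ι : Type} [Fintype ι] (γ : ι → ι → ι → R3 k R)
    (hγ : ∀ i j h l, ∑ m, s123 k R (γ i j m) * s134 k R (γ m h l) =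
      ∑ m, s234 k R (γ j h m) * s124 k R (γ i m l))
    (h : ∀ u v w, P'.β (P.β u v) w = Q'.β u (Q.β v w))
    (e : M₁) (v : ι → M₁) (e' : M₂) (v' : ι → M₂) (e'' : M₃) (v'' : ι → M₃)
    (he : ∀ a, M₁.l a e = M₁.r a e) (he' : ∀ a, M₂.l a e' = M₂.r a e')
    (he'' : ∀ a, M₃.l a e'' = M₃.r a e'') (l : ι) :
    P'.tupMul γ (P.β e e') (P.tupMul γ e v e' v') e'' v'' l =
      Q'.tupMul γ e v (Q.β e' e'') (Q.tupMul γ e' v' e'' v'') l := by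
  have h1 : ∀ (g : R3 k R) u u', P'.act3 g (P.β e u) u' = Q'.β e (Q.act3 g u u') := by
    intro g u u'
    induction g using TensorProduct.induction_on with
    | zero => simp
    | add g h hg hh => simp only [map_add, LinearMap.add_apply, hg, hh]
    | tmul a z =>
      induction z using TensorProduct.induction_on with
      | zero => simp
      | add g h hg hh =>
        simp only [TensorProduct.tmul_add, map_add, LinearMap.add_apply, hg, hh]
      | tmul b c => simp only [Pairing.act3_tmul, ← h, ← P.left, he, P.bal]
  have h2 : ∀ (g : R3 k R) u u', P'.act3 g (P.β u e') u' = Q'.act3 g u (Q.β e' u') := by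
    intro g u u'
    induction g using TensorProduct.induction_on with
    | zero => simp
    | add g h hg hh => simp only [map_add, LinearMap.add_apply, hg, hh]
    | tmul a z =>
      induction z using TensorProduct.induction_on with
      | zero => simp
      | add g h hg hh =>
        simp only [TensorProduct.tmul_add, map_add, LinearMap.add_apply, hg, hh]
      | tmul b c =>
        simp only [Pairing.act3_tmul, ← Q.right, ← Q.left, he', ← h, ← P.left, Q.bal]
  have h3 : ∀ (g : R3 k R) u u', P'.β (P.act3 g u u') e'' = Q'.act3 g u (Q.β u' e'') := by
    intro g u u'
    induction g using TensorProduct.induction_on with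
    | zero => simp
    | add g h hg hh => simp only [map_add, LinearMap.add_apply, hg, hh]
    | tmul a z =>
      induction z using TensorProduct.induction_on with
      | zero => simp
      | add g h hg hh =>
        simp only [TensorProduct.tmul_add, map_add, LinearMap.add_apply, hg, hh]
      | tmul b c =>
        simp only [Pairing.act3_tmul, ← Q.right, ← Q.left, ← he'', h, ← Q.bal, M₂.comm]
  have h4 : ∑ i, ∑ j, P'.act3 (γ i j l) (∑ a, ∑ b, P.act3 (γ a b i) (v a) (v' b)) (v'' j) =
      ∑ i, ∑ j, Q'.act3 (γ i j l) (v i) (∑ a, ∑ b, Q.act3 (γ a b j) (v' a) (v'' b)) := by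
    simp only [map_sum, LinearMap.sum_apply, act3_act3_left, act3_act3_right P P' Q Q' h]
    rw [sum4_rot]
    simp only [← map_sum, hγ]
    simp only [map_sum]
    refine Finset.sum_congr rfl fun i _ => ?_
    conv_rhs => rw [Finset.sum_comm]
    exact Finset.sum_congr rfl fun b _ => Finset.sum_comm
  simp only [Pairing.tupMul, map_add, LinearMap.add_apply, map_sum, LinearMap.sum_apply,
    Finset.sum_add_distrib] at h4 ⊢
  simp only [h1, h2, h3, h] at h4 ⊢
  rw [h4]
  abel

end assoc

/-- Compatibility of products with maps. -/
theorem Pairing.act3_map {M N Z M' N' Z' : BiMod k R R} (P : Pairing M N Z) (P' : Pairing M' N' Z')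
    (f : Hom M M') (g : Hom N N') (h : Hom Z Z') (H : ∀ m n, h.toLin (P.β m n) = P'.β (f m) (g n))
    (x : R3 k R) (m : M) (n : N) : h.toLin (P.act3 x m n) = P'.act3 x (f m) (g n) := by
  induction x using TensorProduct.induction_on with
  | zero => simp
  | add g h hg hh => simp only [map_add, LinearMap.add_apply, hg, hh]
  | tmul a z =>
    induction z using TensorProduct.induction_on with
    | zero => simp
    | add g h hg hh =>
      simp only [TensorProduct.tmul_add, map_add, LinearMap.add_apply, hg, hh]
    | tmul b c => simp only [act3_tmul, H, f.map_l, g.map_l, g.map_r]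

theorem Pairing.tupMul_map {M N Z M' N' Z' : BiMod k R R} (P : Pairing M N Z)
    (P' : Pairing M' N' Z') (f : Hom M M') (g : Hom N N') (h : Hom Z Z')
    (H : ∀ m n, h.toLin (P.β m n) = P'.β (f m) (g n)) {ι : Type} [Fintype ι]
    (γ : ι → ι → ι → R3 k R) (e : M) (v : ι → M) (e' : N) (v' : ι → N) (l : ι) :
    h.toLin (P.tupMul γ e v e' v' l) =
      P'.tupMul γ (f e) (fun i => f (v i)) (g e') (fun i => g (v' i)) l := by
  simp only [Pairing.tupMul, map_add, map_sum, H, P.act3_map P' f g h H]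

end BiMod

namespace BiMod

open Slot

variable {k : Type u} [Field k] {R : Type u} [CommRing R] [Algebra k R]

/-- The families `c` with `c j ∈ (R ⊗ R) (E j)`. -/
def qfSub {ι : Type} (E : ι → R ⊗[k] R) : Submodule k (ι → R ⊗[k] R) where
  carrier := {c | ∀ j, c j * E j = c j}
  add_mem' := fun {a b} ha hb j => by rw [Pi.add_apply, add_mul, ha j, hb j]
  zero_mem' := fun j => by simp
  smul_mem' := fun r a ha j => by rw [Pi.smul_apply, smul_mul_assoc, ha j]

/-- The quasi-free bimodule `⊕_j (R ⊗ R) (E j)` attached to idempotents `E j` of `R ⊗ R`. -/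
def quasiFree {ι : Type} (E : ι → R ⊗[k] R) : BiMod k R R where
  carrier := qfSub E
  l := LinearMap.mk₂ k (fun a c => ⟨fun j => (a ⊗ₜ 1) * c.1 j, fun j => by
      rw [mul_assoc, c.2 j]⟩)
    (by intros; ext; simp [TensorProduct.add_tmul, add_mul])
    (by intros; ext; simp [← TensorProduct.smul_tmul'])
    (by intros; ext; simp [mul_add]) (by intros; ext; simp)
  r := LinearMap.mk₂ k (fun a c => ⟨fun j => (1 ⊗ₜ a) * c.1 j, fun j => by
      rw [mul_assoc, c.2 j]⟩)
    (by intros; ext; simp [TensorProduct.tmul_add, add_mul])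
    (by intros; ext; simp)
    (by intros; ext; simp [mul_add]) (by intros; ext; simp)
  l_one := fun c => by ext j; simp [← Algebra.TensorProduct.one_def]
  l_mul := fun a b c => by ext j; simp [← mul_assoc]
  r_one := fun c => by ext j; simp [← Algebra.TensorProduct.one_def]
  r_mul := fun a b c => by ext j; simp [← mul_assoc, mul_comm a b]
  comm := fun a b c => by ext j; simp [← mul_assoc]

/-- The coefficients of an element of a quasi-free bimodule. -/
def quasiFree.coeff {ι : Type} (E : ι → R ⊗[k] R) (j : ι) : quasiFree E →ₗ[k] R ⊗[k] R :=
  (LinearMap.proj j) ∘ₗ (qfSub E).subtype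

theorem quasiFree.ext {ι : Type} {E : ι → R ⊗[k] R} {c d : quasiFree E}
    (h : ∀ j, quasiFree.coeff E j c = quasiFree.coeff E j d) : c = d :=
  Subtype.ext (funext h)

theorem quasiFree.coeff_mul {ι : Type} (E : ι → R ⊗[k] R) (j : ι) (c : quasiFree E) :
    quasiFree.coeff E j c * E j = quasiFree.coeff E j c :=
  Subtype.property (p := fun c => c ∈ qfSub E) c j

theorem quasiFree.coeff_l {ι : Type} (E : ι → R ⊗[k] R) (j : ι) (a : R) (c : quasiFree E) :
    quasiFree.coeff E j ((quasiFree E).l a c) = (a ⊗ₜ 1) * quasiFree.coeff E j c := rfl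

theorem quasiFree.coeff_r {ι : Type} (E : ι → R ⊗[k] R) (j : ι) (a : R) (c : quasiFree E) :
    quasiFree.coeff E j ((quasiFree E).r a c) = (1 ⊗ₜ a) * quasiFree.coeff E j c := rfl

theorem quasiFree.coeff_act2 {ι : Type} (E : ι → R ⊗[k] R) (j : ι) (x : R ⊗[k] R)
    (c : quasiFree E) :
    quasiFree.coeff E j (act2 (quasiFree E) x c) = x * quasiFree.coeff E j c := by
  induction x using TensorProduct.induction_on with
  | zero => simp
  | add x y hx hy => rw [map_add, LinearMap.add_apply, map_add, add_mul, hx, hy]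
  | tmul a b =>
    rw [act2_tmul, quasiFree.coeff_l, quasiFree.coeff_r, ← mul_assoc,
      Algebra.TensorProduct.tmul_mul_tmul, mul_one, one_mul]

/-- The basis elements of a quasi-free bimodule. -/
def quasiFree.gen {ι : Type} [DecidableEq ι] (E : ι → R ⊗[k] R) (hE : ∀ j, E j * E j = E j)
    (i : ι) : quasiFree E :=
  (⟨fun j => if j = i then E i else 0, fun j => by
    by_cases h : j = i
    · subst h; simp [hE]
    · simp [h]⟩ : qfSub E)

theorem quasiFree.coeff_gen {ι : Type} [DecidableEq ι] (E : ι → R ⊗[k] R)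
    (hE : ∀ j, E j * E j = E j) (i j : ι) :
    quasiFree.coeff E j (quasiFree.gen E hE i) = if j = i then E i else 0 := rfl

/-- The bimodule map that sends the basis elements `x_j` of a quasi-free bimodule to given
elements (multiplied by the idempotents). -/
def quasiFree.lift {ι : Type} [Fintype ι] (E : ι → R ⊗[k] R) {M : BiMod k R R} (x : ι → M) :
    Hom (quasiFree E) M where
  toLin := ∑ j, (act2 M).flip (x j) ∘ₗ quasiFree.coeff E j
  map_l := fun a c => by
    simp [quasiFree.coeff_l, act2_mul, M.r_one]
  map_r := fun a c => by
    simp [quasiFree.coeff_r, act2_mul, M.l_one]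

theorem quasiFree.lift_apply {ι : Type} [Fintype ι] {E : ι → R ⊗[k] R} {M : BiMod k R R}
    (x : ι → M) (c : quasiFree E) :
    (quasiFree.lift E x).toLin c = ∑ j, act2 M (quasiFree.coeff E j c) (x j) := by
  simp [quasiFree.lift]

theorem quasiFree.lift_gen {ι : Type} [Fintype ι] [DecidableEq ι] {E : ι → R ⊗[k] R}
    (hE : ∀ j, E j * E j = E j) {M : BiMod k R R} (x : ι → M) (i : ι) :
    (quasiFree.lift E x).toLin (quasiFree.gen E hE i) = act2 M (E i) (x i) := by
  rw [quasiFree.lift_apply, Finset.sum_eq_single i]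
  · rw [quasiFree.coeff_gen, if_pos rfl]
  · intro j _ h
    rw [quasiFree.coeff_gen, if_neg h, map_zero, LinearMap.zero_apply]
  · simp

theorem quasiFree.sum_gen {ι : Type} [Fintype ι] [DecidableEq ι] {E : ι → R ⊗[k] R}
    (hE : ∀ j, E j * E j = E j) (c : quasiFree E) :
    ∑ j, act2 (quasiFree E) (quasiFree.coeff E j c) (quasiFree.gen E hE j) = c := by
  refine quasiFree.ext fun i => ?_
  rw [map_sum]
  simp only [quasiFree.coeff_act2, quasiFree.coeff_gen]
  rw [Finset.sum_eq_single i]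
  · rw [if_pos rfl, quasiFree.coeff_mul]
  · intro j _ h
    rw [if_neg (Ne.symm h), mul_zero]
  · simp

/-! #### Tensor algebras of bimodules -/

/-- The relations of the tensor algebra of an `R`-`R`-bimodule `N`: `R` is a subalgebra, `N` is
embedded additively, and the products of elements of `R` and of `N` are those of the bimodule. -/
inductive TensRel (N : BiMod k R R) :
    FreeAlgebra k (R ⊕ N) → FreeAlgebra k (R ⊕ N) → Prop
  | algebraMap (c : k) : TensRel N (FreeAlgebra.ι k (Sum.inl (algebraMap k R c)))
      (algebraMap k _ c)
  | add (a b : R) : TensRel N (FreeAlgebra.ι k (Sum.inl (a + b)))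
      (FreeAlgebra.ι k (Sum.inl a) + FreeAlgebra.ι k (Sum.inl b))
  | mul (a b : R) : TensRel N (FreeAlgebra.ι k (Sum.inl (a * b)))
      (FreeAlgebra.ι k (Sum.inl a) * FreeAlgebra.ι k (Sum.inl b))
  | addN (x y : N) : TensRel N (FreeAlgebra.ι k (Sum.inr (x + y)))
      (FreeAlgebra.ι k (Sum.inr x) + FreeAlgebra.ι k (Sum.inr y))
  | smulN (c : k) (x : N) : TensRel N (FreeAlgebra.ι k (Sum.inr (c • x)))
      (c • FreeAlgebra.ι k (Sum.inr x))
  | lN (a : R) (x : N) : TensRel N (FreeAlgebra.ι k (Sum.inr (N.l a x)))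
      (FreeAlgebra.ι k (Sum.inl a) * FreeAlgebra.ι k (Sum.inr x))
  | rN (a : R) (x : N) : TensRel N (FreeAlgebra.ι k (Sum.inr (N.r a x)))
      (FreeAlgebra.ι k (Sum.inr x) * FreeAlgebra.ι k (Sum.inl a))

/-- The tensor algebra `R ⊕ N ⊕ N ⊗_R N ⊕ ⋯` of a bimodule `N`. -/
def TensAlg (N : BiMod k R R) : Type u := RingQuot (TensRel N)

instance (N : BiMod k R R) : Ring (TensAlg N) := inferInstanceAs (Ring (RingQuot (TensRel N)))

instance (N : BiMod k R R) : Algebra k (TensAlg N) :=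
  inferInstanceAs (Algebra k (RingQuot (TensRel N)))

/-- The inclusion `R → T_R(N)`. -/
def TensAlg.incl (N : BiMod k R R) : R →ₐ[k] TensAlg N where
  toFun a := RingQuot.mkAlgHom k (TensRel N) (FreeAlgebra.ι k (Sum.inl a))
  map_one' := by
    have h := RingQuot.mkAlgHom_rel k (TensRel.algebraMap (N := N) 1)
    rw [map_one, map_one, map_one] at h
    exact h
  map_zero' := by
    have h := RingQuot.mkAlgHom_rel k (TensRel.algebraMap (N := N) 0)
    rw [map_zero, map_zero, map_zero] at h
    exact h
  map_mul' a b := by rw [RingQuot.mkAlgHom_rel k (TensRel.mul (N := N) a b), map_mul]; rfl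
  map_add' a b := by rw [RingQuot.mkAlgHom_rel k (TensRel.add (N := N) a b), map_add]; rfl
  commutes' c := by
    rw [RingQuot.mkAlgHom_rel k (TensRel.algebraMap (N := N) c), AlgHom.commutes]; rfl

/-- The inclusion `N → T_R(N)`. -/
def TensAlg.inclN (N : BiMod k R R) : N →ₗ[k] TensAlg N where
  toFun x := RingQuot.mkAlgHom k (TensRel N) (FreeAlgebra.ι k (Sum.inr x))
  map_add' a b := by rw [RingQuot.mkAlgHom_rel k (TensRel.addN (N := N) a b), map_add]; rfl
  map_smul' a b := by rw [RingQuot.mkAlgHom_rel k (TensRel.smulN (N := N) a b), map_smul]; rfl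

theorem TensAlg.inclN_l (N : BiMod k R R) (a : R) (x : N) :
    TensAlg.inclN N (N.l a x) = TensAlg.incl N a * TensAlg.inclN N x :=
  (RingQuot.mkAlgHom_rel k (TensRel.lN (N := N) a x)).trans (map_mul _ _ _)

theorem TensAlg.inclN_r (N : BiMod k R R) (a : R) (x : N) :
    TensAlg.inclN N (N.r a x) = TensAlg.inclN N x * TensAlg.incl N a :=
  (RingQuot.mkAlgHom_rel k (TensRel.rN (N := N) a x)).trans (map_mul _ _ _)

end BiMod

/-! ### Minimal algebras -/

/-- A vertex is trivial, or non-trivial with a non-zero polynomial attached to it. -/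
inductive VertexKind (k : Type u) [Field k] : Type u
  | trivial : VertexKind k
  | nontrivial (φ : k[X]) (hφ : φ ≠ 0) : VertexKind k

namespace VertexKind

variable {k : Type u} [Field k]

/-- `R_X`: the field `k` if `X` is trivial, the localization `k[x, φ(x)⁻¹]` otherwise. -/
def Coeff : VertexKind k → Type u
  | trivial => k
  | nontrivial φ _ => Localization.Away φ

instance : (v : VertexKind k) → CommRing v.Coeff
  | trivial => inferInstanceAs (CommRing k)
  | nontrivial φ _ => inferInstanceAs (CommRing (Localization.Away φ))

instance : (v : VertexKind k) → Algebra k v.Coeff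
  | trivial => inferInstanceAs (Algebra k k)
  | nontrivial φ _ => inferInstanceAs (Algebra k (Localization.Away φ))

end VertexKind

/-- The minimal algebra `R = ∏ R_X`. -/
def MinAlg {k : Type u} [Field k] {T : Type} (kind : T → VertexKind k) : Type u :=
  ∀ X, (kind X).Coeff

instance {k : Type u} [Field k] {T : Type} (kind : T → VertexKind k) : CommRing (MinAlg kind) :=
  inferInstanceAs (CommRing (∀ X, (kind X).Coeff))

instance {k : Type u} [Field k] {T : Type} (kind : T → VertexKind k) : Algebra k (MinAlg kind) :=
  inferInstanceAs (Algebra k (∀ X, (kind X).Coeff))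

/-- The idempotent `1_X` of a minimal algebra. -/
def MinAlg.idem {k : Type u} [Field k] {T : Type} [DecidableEq T] (kind : T → VertexKind k)
    (X : T) : MinAlg kind := fun Y => if Y = X then 1 else 0

/-- The idempotent `1_X ⊗ 1_Y` of `R ⊗ R`. -/
def MinAlg.idem2 {k : Type u} [Field k] {T : Type} [DecidableEq T] (kind : T → VertexKind k)
    (X Y : T) : MinAlg kind ⊗[k] MinAlg kind := MinAlg.idem kind X ⊗ₜ MinAlg.idem kind Y

/-! ### Matrix bimodule problems -/

/-- The order on positions of a matrix: from the bottom row to the top row, and from left to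
right in each row. -/
def PosLE {t : ℕ} (a b : Fin t × Fin t) : Prop := b.1 < a.1 ∨ (a.1 = b.1 ∧ a.2 ≤ b.2)

/-- `a` is the leading position of the matrix `M`. -/
def IsLeadingPos {k : Type u} [Field k] {t : ℕ} (M : Matrix (Fin t) (Fin t) k)
    (a : Fin t × Fin t) : Prop :=
  M a.1 a.2 ≠ 0 ∧ ∀ i j, M i j ≠ 0 → PosLE a (i, j)

/-- An ordered family of matrices is a normalized basis of its span. -/
def IsNormalizedBasis {k : Type u} [Field k] {t n : ℕ} (A : Fin n → Matrix (Fin t) (Fin t) k) :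
    Prop :=
  ∃ a : Fin n → Fin t × Fin t, (∀ i, IsLeadingPos (A i) (a i)) ∧
    (∀ i, A i (a i).1 (a i).2 = 1) ∧
    (∀ i j, j ≠ i → A j (a i).1 (a i).2 = 0) ∧
    (∀ i j, i ≤ j ↔ PosLE (a i) (a j))

/-- The product `M_t(R ⊗ R) × M_t(R ⊗ R) → M_t(R ⊗ R ⊗ R)` of matrices over
`R ⊕ R ⊗ R ⊕ R ⊗ R ⊗ R ⊕ ⋯`: entries are multiplied by `(a ⊗ b) (c ⊗ d) = a ⊗ b c ⊗ d`. -/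
def matProd {k : Type u} [Field k] {R : Type u} [CommRing R] [Algebra k R] {t : ℕ}
    (U V : Matrix (Fin t) (Fin t) (R ⊗[k] R)) : Matrix (Fin t) (Fin t) (Slot.R3 k R) :=
  U.map (Slot.s12 k R) * V.map (Slot.s23 k R)

/-- The matrix `M` over `k`, viewed as a matrix over `k (1_X ⊗ 1_Y) ⊆ R ⊗ R`. -/
def scalarMat {k : Type u} [Field k] {T : Type} [DecidableEq T] (kind : T → VertexKind k)
    (X Y : T) {t : ℕ} (M : Matrix (Fin t) (Fin t) k) :
    Matrix (Fin t) (Fin t) (MinAlg kind ⊗[k] MinAlg kind) :=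
  M.map fun c => c • MinAlg.idem2 kind X Y

/-- A matrix bimodule problem `(R, K, M, H)` over `k`.

* `R` is the minimal algebra with vertex set `Vert`; the index set `Fin t` of the matrices is
  partitioned into the classes `{p | cls p = X}`, `X ∈ Vert`.
* `K = K₀ ⊕ K₁ ⊕ K₂ ⊕ ⋯`, where `K₀ ≅ R` consists of the diagonal matrices that are constant
  on each class, `K₁` is quasi-free on the strictly upper triangular matrices `V j` over `R ⊗ R`,
  with `1_X (V j) 1_Y = V j` for `X = vsrc j`, `Y = vtgt j`, and `K_p` is the `R ⊗ R`-span
  of the `V j` with coefficients in `R^{⊗(p+1)}`; this is closed under multiplication because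
  `(V i) (V j) ∈ K₂` (condition `mul_V_V`).
* `M = M₁ ⊕ M₂ ⊕ ⋯`, in the same way, with the normalized basis `A l`; it is a `K`-`K`-bimodule
  because of the conditions `mul_V_A` and `mul_A_V`.
* `U ↦ U H - H U` is a derivation `K → M` with values in `M₁` on `K₁` (condition `der`). -/
structure MatrixBimoduleProblem (k : Type u) [Field k] where
  t : ℕ
  Vert : Type
  [fin : Fintype Vert]
  [dec : DecidableEq Vert]
  kind : Vert → VertexKind k
  cls : Fin t → Vert
  cls_surj : Function.Surjective cls
  m : ℕ
  vsrc : Fin m → Vert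
  vtgt : Fin m → Vert
  V : Fin m → Matrix (Fin t) (Fin t) (MinAlg kind ⊗[k] MinAlg kind)
  V_upper : ∀ j p q, q ≤ p → V j p q = 0
  V_supp : ∀ j p q, ¬ (cls p = vsrc j ∧ cls q = vtgt j) → V j p q = 0
  V_idem : ∀ j p q, MinAlg.idem2 kind (vsrc j) (vtgt j) * V j p q = V j p q
  V_free : ∀ c : Fin m → MinAlg kind ⊗[k] MinAlg kind, ∑ j, c j • V j = 0 →
    ∀ j, c j * MinAlg.idem2 kind (vsrc j) (vtgt j) = 0
  mul_V_V : ∀ i j, ∃ γ : Fin m → Slot.R3 k (MinAlg kind),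
    matProd (V i) (V j) = ∑ l, γ l • (V l).map (Slot.s13 k (MinAlg kind))
  n : ℕ
  asrc : Fin n → Vert
  atgt : Fin n → Vert
  A : Fin n → Matrix (Fin t) (Fin t) k
  A_supp : ∀ l p q, ¬ (cls p = asrc l ∧ cls q = atgt l) → A l p q = 0
  A_normalized : IsNormalizedBasis A
  mul_V_A : ∀ i j, ∃ η : Fin n → Slot.R3 k (MinAlg kind),
    matProd (V i) (scalarMat kind (asrc j) (atgt j) (A j)) =
      ∑ l, η l • (scalarMat kind (asrc l) (atgt l) (A l)).map (Slot.s13 k (MinAlg kind))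
  mul_A_V : ∀ i j, ∃ σ : Fin n → Slot.R3 k (MinAlg kind),
    matProd (scalarMat kind (asrc i) (atgt i) (A i)) (V j) =
      ∑ l, σ l • (scalarMat kind (asrc l) (atgt l) (A l)).map (Slot.s13 k (MinAlg kind))
  H : Matrix (Fin t) (Fin t) (MinAlg kind)
  H_supp : ∀ p q, cls p ≠ cls q → H p q = 0
  H_idem : ∀ p q, MinAlg.idem kind (cls p) * H p q = H p q
  der : ∀ j, ∃ ζ : Fin n → MinAlg kind ⊗[k] MinAlg kind,
    V j * H.map (fun h => (1 : MinAlg kind) ⊗ₜ[k] h) -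
        H.map (fun h => h ⊗ₜ[k] (1 : MinAlg kind)) * V j =
      ∑ l, ζ l • scalarMat kind (asrc l) (atgt l) (A l)

namespace MatrixBimoduleProblem

open BiMod Slot

attribute [instance] MatrixBimoduleProblem.fin MatrixBimoduleProblem.dec

variable {k : Type u} [Field k] (𝔄 : MatrixBimoduleProblem k)

/-- The minimal algebra of the problem. -/
abbrev R : Type u := MinAlg 𝔄.kind

/-- The idempotent `1_X`. -/
def idem (X : 𝔄.Vert) : 𝔄.R := MinAlg.idem 𝔄.kind X

/-- The matrix `A l` over `k (1_X ⊗ 1_Y)`. -/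
def A2 (l : Fin 𝔄.n) : Matrix (Fin 𝔄.t) (Fin 𝔄.t) (𝔄.R ⊗[k] 𝔄.R) :=
  scalarMat 𝔄.kind (𝔄.asrc l) (𝔄.atgt l) (𝔄.A l)

/-- `1_X ⊗ 1_Y`, with `v : X → Y`. -/
def vIdem (j : Fin 𝔄.m) : 𝔄.R ⊗[k] 𝔄.R := 𝔄.idem (𝔄.vsrc j) ⊗ₜ 𝔄.idem (𝔄.vtgt j)

/-- `1_X ⊗ 1_Y`, with `a : X → Y`. -/
def aIdem (l : Fin 𝔄.n) : 𝔄.R ⊗[k] 𝔄.R := 𝔄.idem (𝔄.asrc l) ⊗ₜ 𝔄.idem (𝔄.atgt l)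

/-- Structure constants of `K`: `(V i) (V j) = ∑ l, γ i j l (V l)`. -/
def γ (i j l : Fin 𝔄.m) : R3 k 𝔄.R :=
  Classical.choose (𝔄.mul_V_V i j) l * s13 k 𝔄.R (𝔄.vIdem l)

/-- Structure constants of `M`: `(V i) (A j) = ∑ l, η i j l (A l)`. -/
def η (i : Fin 𝔄.m) (j l : Fin 𝔄.n) : R3 k 𝔄.R :=
  Classical.choose (𝔄.mul_V_A i j) l * s13 k 𝔄.R (𝔄.aIdem l)

/-- Structure constants of `M`: `(A i) (V j) = ∑ l, σ i j l (A l)`. -/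
def σ (i : Fin 𝔄.n) (j : Fin 𝔄.m) (l : Fin 𝔄.n) : R3 k 𝔄.R :=
  Classical.choose (𝔄.mul_A_V i j) l * s13 k 𝔄.R (𝔄.aIdem l)

/-- Structure constants of the derivation: `(V i) H - H (V i) = ∑ l, ζ i l (A l)`. -/
def ζ (i : Fin 𝔄.m) (l : Fin 𝔄.n) : 𝔄.R ⊗[k] 𝔄.R :=
  Classical.choose (𝔄.der i) l * 𝔄.aIdem l

theorem idem_mul_self (X : 𝔄.Vert) : 𝔄.idem X * 𝔄.idem X = 𝔄.idem X := by
  funext Y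
  change (if Y = X then (1 : (𝔄.kind Y).Coeff) else 0) * (if Y = X then 1 else 0) = _
  rw [ite_mul_ite]
  simp [idem, MinAlg.idem]

theorem idem_mul_ne {X Y : 𝔄.Vert} (h : X ≠ Y) : 𝔄.idem X * 𝔄.idem Y = 0 := by
  funext Z
  change (if Z = X then (1 : (𝔄.kind Z).Coeff) else 0) * (if Z = Y then 1 else 0) = 0
  by_cases hX : Z = X
  · rw [if_neg (fun e => h (hX.symm.trans e)), mul_zero]
  · rw [if_neg hX, zero_mul]

theorem vIdem_mul_self (j : Fin 𝔄.m) : 𝔄.vIdem j * 𝔄.vIdem j = 𝔄.vIdem j := by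
  simp [vIdem, idem_mul_self]

theorem aIdem_mul_self (j : Fin 𝔄.n) : 𝔄.aIdem j * 𝔄.aIdem j = 𝔄.aIdem j := by
  simp [aIdem, idem_mul_self]

theorem vIdem_V (j : Fin 𝔄.m) (p q) : 𝔄.vIdem j * 𝔄.V j p q = 𝔄.V j p q := 𝔄.V_idem j p q

theorem A2_apply (l : Fin 𝔄.n) (p q) : 𝔄.A2 l p q = 𝔄.A l p q • 𝔄.aIdem l := rfl

theorem aIdem_A2 (l : Fin 𝔄.n) (p q) : 𝔄.aIdem l * 𝔄.A2 l p q = 𝔄.A2 l p q := by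
  rw [A2_apply, mul_smul_comm, aIdem_mul_self]

theorem V_mul (i j : Fin 𝔄.m) (p q) :
    ∑ r, s12 k 𝔄.R (𝔄.V i p r) * s23 k 𝔄.R (𝔄.V j r q) =
      ∑ l, 𝔄.γ i j l * s13 k 𝔄.R (𝔄.V l p q) := by
  have h := congrFun (congrFun (Classical.choose_spec (𝔄.mul_V_V i j)) p) q
  simp only [matProd, Matrix.mul_apply, Matrix.map_apply, Matrix.sum_apply, Matrix.smul_apply,
    smul_eq_mul] at h
  simp only [γ, mul_assoc, ← map_mul, vIdem_V]
  exact h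

theorem V_mul_A (i : Fin 𝔄.m) (j : Fin 𝔄.n) (p q) :
    ∑ r, s12 k 𝔄.R (𝔄.V i p r) * s23 k 𝔄.R (𝔄.A2 j r q) =
      ∑ l, 𝔄.η i j l * s13 k 𝔄.R (𝔄.A2 l p q) := by
  have h := congrFun (congrFun (Classical.choose_spec (𝔄.mul_V_A i j)) p) q
  simp only [matProd, Matrix.mul_apply, Matrix.map_apply, Matrix.sum_apply, Matrix.smul_apply,
    smul_eq_mul] at h
  simp only [η, mul_assoc, ← map_mul, aIdem_A2]
  exact h

theorem A_mul_V (i : Fin 𝔄.n) (j : Fin 𝔄.m) (p q) :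
    ∑ r, s12 k 𝔄.R (𝔄.A2 i p r) * s23 k 𝔄.R (𝔄.V j r q) =
      ∑ l, 𝔄.σ i j l * s13 k 𝔄.R (𝔄.A2 l p q) := by
  have h := congrFun (congrFun (Classical.choose_spec (𝔄.mul_A_V i j)) p) q
  simp only [matProd, Matrix.mul_apply, Matrix.map_apply, Matrix.sum_apply, Matrix.smul_apply,
    smul_eq_mul] at h
  simp only [σ, mul_assoc, ← map_mul, aIdem_A2]
  exact h

theorem V_der (j : Fin 𝔄.m) (p q) :
    ∑ r, 𝔄.V j p r * ((1 : 𝔄.R) ⊗ₜ[k] 𝔄.H r q) - ∑ r, (𝔄.H p r ⊗ₜ[k] (1 : 𝔄.R)) * 𝔄.V j r q =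
      ∑ l, 𝔄.ζ j l * 𝔄.A2 l p q := by
  have h := congrFun (congrFun (Classical.choose_spec (𝔄.der j)) p) q
  simp only [Matrix.sub_apply, Matrix.mul_apply, Matrix.map_apply, Matrix.sum_apply,
    Matrix.smul_apply, smul_eq_mul] at h
  simp only [ζ, mul_assoc, aIdem_A2]
  exact h

theorem gamma_idem (i j l : Fin 𝔄.m) : 𝔄.γ i j l * s13 k 𝔄.R (𝔄.vIdem l) = 𝔄.γ i j l := by
  rw [γ, mul_assoc, ← map_mul, vIdem_mul_self]

/-- Associativity of the structure constants of `K`. -/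
theorem gamma_assoc (i j h l : Fin 𝔄.m) :
    ∑ m, s123 k 𝔄.R (𝔄.γ i j m) * s134 k 𝔄.R (𝔄.γ m h l) =
      ∑ m, s234 k 𝔄.R (𝔄.γ j h m) * s124 k 𝔄.R (𝔄.γ i m l) :=
  assoc4 𝔄.V 𝔄.vIdem (fun c h => 𝔄.V_free c (by
    ext p q
    rw [Matrix.sum_apply]
    exact h p q)) 𝔄.γ 𝔄.V_mul 𝔄.gamma_idem i j h l

end MatrixBimoduleProblem

/-! ### The bocs of a matrix bimodule problem -/

namespace BiMod

open Slot

variable {k : Type u} [Field k] {R : Type u} [CommRing R] [Algebra k R]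

theorem quasiFree.hom_ext {ι : Type} [Fintype ι] [DecidableEq ι] {E : ι → R ⊗[k] R}
    (hE : ∀ j, E j * E j = E j) {M : BiMod k R R} {f g : Hom (quasiFree E) M}
    (h : ∀ j, f.toLin (quasiFree.gen E hE j) = g.toLin (quasiFree.gen E hE j)) : f = g := by
  ext c
  rw [← quasiFree.sum_gen hE c]
  simp only [map_sum, Hom.map_act2, h]

theorem quasiFree.act2_gen {ι : Type} [DecidableEq ι] {E : ι → R ⊗[k] R}
    (hE : ∀ j, E j * E j = E j) (j : ι) :
    act2 (quasiFree E) (E j) (quasiFree.gen E hE j) = quasiFree.gen E hE j := by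
  refine quasiFree.ext fun i => ?_
  rw [quasiFree.coeff_act2, quasiFree.coeff_gen]
  split_ifs
  · rw [hE]
  · rw [mul_zero]

/-- The bimodule `C = C₀ ⊕ C₁`, where `C₀ ≅ R` and `C₁` is quasi-free. -/
def coMod {ι : Type} (E : ι → R ⊗[k] R) : BiMod k R R := prod (reg k R) (quasiFree E)

/-- The generator `e = ∑ e_X` of `C₀`. -/
def coMod.one {ι : Type} (E : ι → R ⊗[k] R) : coMod E := ((1 : R), (0 : quasiFree E))

/-- The generators `v_i` of `C₁`. -/
def coMod.gen {ι : Type} [DecidableEq ι] (E : ι → R ⊗[k] R) (hE : ∀ j, E j * E j = E j)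
    (i : ι) : coMod E := ((0 : R), quasiFree.gen E hE i)

theorem coMod.one_central {ι : Type} (E : ι → R ⊗[k] R) (a : R) :
    (coMod E).l a (coMod.one E) = (coMod E).r a (coMod.one E) := by
  have h1 : (reg k R).l a (1 : R) = (reg k R).r a (1 : R) := mul_comm a (1 : R)
  exact Prod.ext h1 (((quasiFree E).l a).map_zero.trans ((quasiFree E).r a).map_zero.symm)

/-- The projection `C → C₀ ≅ R`. -/
def coMod.fst {ι : Type} (E : ι → R ⊗[k] R) : Hom (coMod E) (reg k R) :=
  ⟨LinearMap.fst k R (quasiFree E), fun _ _ => rfl, fun _ _ => rfl⟩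

/-- The projection `C → C₁`. -/
def coMod.snd {ι : Type} (E : ι → R ⊗[k] R) : Hom (coMod E) (quasiFree E) :=
  ⟨LinearMap.snd k R (quasiFree E), fun _ _ => rfl, fun _ _ => rfl⟩

/-- The bimodule map `C → M` with `e ↦ e` and `v_i ↦ x i` (multiplied by the idempotents). -/
def coMod.lift {ι : Type} [Fintype ι] (E : ι → R ⊗[k] R) {M : BiMod k R R} (e : M)
    (he : ∀ a, M.l a e = M.r a e) (x : ι → M) : Hom (coMod E) M where
  toLin := M.l.flip e ∘ₗ (coMod.fst E).toLin + (quasiFree.lift E x).toLin ∘ₗ (coMod.snd E).toLin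
  map_l a c := by
    simp only [LinearMap.add_apply, LinearMap.comp_apply, Hom.map_l, map_add]
    congr 1
    exact M.l_mul a _ e
  map_r a c := by
    simp only [LinearMap.add_apply, LinearMap.comp_apply, Hom.map_r, map_add]
    congr 1
    exact (M.l_mul _ a e).trans ((congrArg _ (he a)).trans (M.comm _ a e))

theorem coMod.lift_one {ι : Type} [Fintype ι] (E : ι → R ⊗[k] R) {M : BiMod k R R} (e : M)
    (he : ∀ a, M.l a e = M.r a e) (x : ι → M) :
    (coMod.lift E e he x).toLin (coMod.one E) = e := by
  have h : (coMod.lift E e he x).toLin (coMod.one E) =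
    M.l (1 : R) e + (quasiFree.lift E x).toLin (0 : quasiFree E) := rfl
  rw [h, map_zero, add_zero, M.l_one]

theorem coMod.lift_gen {ι : Type} [Fintype ι] [DecidableEq ι] (E : ι → R ⊗[k] R)
    (hE : ∀ j, E j * E j = E j) {M : BiMod k R R} (e : M)
    (he : ∀ a, M.l a e = M.r a e) (x : ι → M) (i : ι) :
    (coMod.lift E e he x).toLin (coMod.gen E hE i) = act2 M (E i) (x i) := by
  have h : (coMod.lift E e he x).toLin (coMod.gen E hE i) =
    M.l (0 : R) e + (quasiFree.lift E x).toLin (quasiFree.gen E hE i) := rfl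
  rw [h, map_zero, LinearMap.zero_apply, zero_add, quasiFree.lift_gen]

theorem coMod.act2_gen {ι : Type} [DecidableEq ι] {E : ι → R ⊗[k] R}
    (hE : ∀ j, E j * E j = E j) (j : ι) :
    act2 (coMod E) (E j) (coMod.gen E hE j) = coMod.gen E hE j := by
  have h1 := Hom.map_act2 (coMod.fst E) (E j) (coMod.gen E hE j)
  have h2 := Hom.map_act2 (coMod.snd E) (E j) (coMod.gen E hE j)
  refine Prod.ext (h1.trans ?_) (h2.trans (quasiFree.act2_gen hE j))
  exact (act2 (reg k R) (E j)).map_zero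

theorem coMod.hom_ext {ι : Type} [Fintype ι] [DecidableEq ι] {E : ι → R ⊗[k] R}
    (hE : ∀ j, E j * E j = E j) {M : BiMod k R R} {f g : Hom (coMod E) M}
    (h1 : f.toLin (coMod.one E) = g.toLin (coMod.one E))
    (h : ∀ j, f.toLin (coMod.gen E hE j) = g.toLin (coMod.gen E hE j)) : f = g := by
  ext c
  obtain ⟨a, ha⟩ : ∃ a : R, a = c.1 := ⟨_, rfl⟩
  obtain ⟨d, hd⟩ : ∃ d : quasiFree E, d = c.2 := ⟨_, rfl⟩
  have hc : c = (coMod E).l a (coMod.one E) +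
      ∑ j, act2 (coMod E) (quasiFree.coeff E j d) (coMod.gen E hE j) := by
    have e1 : (coMod.fst E).toLin ((coMod E).l a (coMod.one E) +
        ∑ j, act2 (coMod E) (quasiFree.coeff E j d) (coMod.gen E hE j)) = a := by
      have h0 : ∀ j, (coMod.fst E).toLin (coMod.gen E hE j) = 0 := fun _ => rfl
      simp only [map_add, map_sum, Hom.map_act2, Hom.map_l, h0, map_zero,
        Finset.sum_const_zero, add_zero]
      exact mul_one (M := R) _
    have e2 : (coMod.snd E).toLin ((coMod E).l a (coMod.one E) +
        ∑ j, act2 (coMod E) (quasiFree.coeff E j d) (coMod.gen E hE j)) = d := by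
      have h0 : (coMod.snd E).toLin (coMod.one E) = 0 := rfl
      have h1 : ∀ j, (coMod.snd E).toLin (coMod.gen E hE j) = quasiFree.gen E hE j :=
        fun _ => rfl
      simp only [map_add, map_sum, Hom.map_act2, Hom.map_l, h1, h0, map_zero, zero_add]
      exact quasiFree.sum_gen hE d
    exact (Prod.ext (e1.trans ha) (e2.trans hd)).symm
  rw [hc]
  simp only [map_add, map_sum, Hom.map_act2, Hom.map_l, h, h1]

variable {Γ : Type u} [Ring Γ] [Algebra k Γ] (i : R →ₐ[k] Γ)

/-- `Γ` as a `Γ`-`R`-bimodule. -/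
abbrev regR : BiMod k Γ R := res (AlgHom.id k Γ) i (reg k Γ)

/-- `Γ` as an `R`-`Γ`-bimodule. -/
abbrev regL : BiMod k R Γ := res i (AlgHom.id k Γ) (reg k Γ)

/-- The induced bimodule `Γ ⊗_R C ⊗_R Γ`. -/
def ind (C : BiMod k R R) : BiMod k Γ Γ := tens (tens (regR i) C) (regL i)

/-- The element `g ⊗ c ⊗ g'`, linear in `c`. -/
def ind.mk (C : BiMod k R R) (g g' : reg k Γ) : C →ₗ[k] ind i C :=
  (tmul (tens (regR i) C) (regL i)).flip g' ∘ₗ tmul (regR i) C g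

theorem ind.mk_apply (C : BiMod k R R) (g g' : reg k Γ) (c : C) :
    ind.mk i C g g' c = tmul (tens (regR i) C) (regL i) (tmul (regR i) C g c) g' := rfl

theorem ind.l_mk (C : BiMod k R R) (a : Γ) (g g' : reg k Γ) (c : C) :
    (ind i C).l a (ind.mk i C g g' c) = ind.mk i C ((reg k Γ).l a g) g' c :=
  (tens_l (M := tens (regR i) C) (N := regL i) a _ _).trans
    (congrArg (fun z => tmul (tens (regR i) C) (regL i) z g')
      (tens_l (M := regR i) (N := C) a g c))

theorem ind.r_mk (C : BiMod k R R) (a : Γ) (g g' : reg k Γ) (c : C) :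
    (ind i C).r a (ind.mk i C g g' c) = ind.mk i C g ((reg k Γ).r a g') c :=
  tens_r (M := tens (regR i) C) (N := regL i) a _ _

theorem ind.mk_l (C : BiMod k R R) (a : R) (g g' : reg k Γ) (c : C) :
    ind.mk i C g g' (C.l a c) = ind.mk i C ((reg k Γ).r (i a) g) g' c :=
  congrArg (fun z => tmul (tens (regR i) C) (regL i) z g')
      (tmul_bal (M := regR i) (N := C) g a c).symm

theorem ind.mk_r (C : BiMod k R R) (a : R) (g g' : reg k Γ) (c : C) :
    ind.mk i C g g' (C.r a c) = ind.mk i C g ((reg k Γ).l (i a) g') c :=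
  (congrArg (fun z => tmul (tens (regR i) C) (regL i) z g')
      (tens_r (M := regR i) (N := C) a g c).symm).trans
    (tmul_bal (M := tens (regR i) C) (N := regL i) (tmul (regR i) C g c) a g')

/-- The unit of `Γ`, as an element of the regular bimodule. -/
def regOne (k : Type u) [Field k] (Γ : Type u) [Ring Γ] [Algebra k Γ] : reg k Γ := (1 : Γ)

theorem reg_comm (a : Γ) : (reg k Γ).l a (regOne k Γ) = (reg k Γ).r a (regOne k Γ) :=
  (mul_one a).trans (one_mul a).symm

theorem reg_l_one (a : Γ) : (reg k Γ).l a (regOne k Γ) = a := mul_one a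

theorem reg_r_one (a : Γ) : (reg k Γ).r a (regOne k Γ) = a := one_mul a

/-- The map `C → Γ ⊗_R C ⊗_R Γ`, `c ↦ 1 ⊗ c ⊗ 1`. -/
def ind.incl (C : BiMod k R R) : Hom C (res i i (ind i C)) where
  toLin := ind.mk i C (regOne k Γ) (regOne k Γ)
  map_l a c := by
    rw [ind.mk_l, ← reg_comm, ← ind.l_mk]
    rfl
  map_r a c := by
    rw [ind.mk_r, reg_comm, ← ind.r_mk]
    rfl

theorem ind.mk_eq (C : BiMod k R R) (g g' : reg k Γ) (c : C) :
    ind.mk i C g g' c = (ind i C).l g ((ind i C).r g' ((ind.incl i C).toLin c)) := by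
  exact Eq.symm ((congrArg ((ind i C).l g) (ind.r_mk i C g' _ _ c)).trans
    ((ind.l_mk i C g _ _ c).trans
      (congrArg₂ (fun a b => ind.mk i C a b c) (reg_l_one (k := k) (Γ := Γ) g) (reg_r_one (k := k) (Γ := Γ) g'))))

theorem ind.hom_ext {C : BiMod k R R} {M : BiMod k Γ Γ} {f g : Hom (ind i C) M}
    (h : ∀ c, f.toLin ((ind.incl i C).toLin c) = g.toLin ((ind.incl i C).toLin c)) : f = g := by
  have h' : ∀ a c b, f.toLin (ind.mk i C a b c) = g.toLin (ind.mk i C a b c) := fun a c b => by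
    rw [ind.mk_eq]
    refine (f.map_l _ _).trans (Eq.trans ?_ (g.map_l _ _).symm)
    refine congrArg _ ((f.map_r _ _).trans (Eq.trans ?_ (g.map_r _ _).symm))
    exact congrArg _ (h c)
  ext1
  refine tens_ext fun z b => ?_
  exact tens_ext_apply (f := f.toLin ∘ₗ (tmul (tens (regR i) C) (regL i)).flip b)
    (g := g.toLin ∘ₗ (tmul (tens (regR i) C) (regL i)).flip b) (fun a c => h' a c b) z

/-- The map `g ⊗ c ↦ g h(c)`. -/
def ind.liftAux {C : BiMod k R R} (M : BiMod k Γ Γ) (h : Hom C (res i i M)) :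
    Hom (tens (regR i) C) (res (AlgHom.id k Γ) i M) :=
  tensLift (M := regR i) (N := C) (P := res (AlgHom.id k Γ) i M) (M.l.compl₂ h.toLin)
    (fun g a c => (M.l_mul g (i a) (h.toLin c)).trans (congrArg (M.l g) (h.map_l a c).symm))
    (fun a g _ => M.l_mul a g _)
    (fun a g c => (congrArg (M.l g) (h.map_r a c)).trans (M.comm g (i a) _))

theorem ind.liftAux_tmul {C : BiMod k R R} (M : BiMod k Γ Γ) (h : Hom C (res i i M))
    (g : reg k Γ) (c : C) :
    (ind.liftAux i M h).toLin (tmul (regR i) C g c) = M.l g (h.toLin c) :=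
  tensLift_tmul (M := regR i) (N := C) (P := res (AlgHom.id k Γ) i M) _ _ _ _ _ _

/-- The bimodule map `Γ ⊗_R C ⊗_R Γ → M`, `g ⊗ c ⊗ g' ↦ g h(c) g'`. -/
def ind.lift {C : BiMod k R R} (M : BiMod k Γ Γ) (h : Hom C (res i i M)) : Hom (ind i C) M :=
  tensLift (M := tens (regR i) C) (N := regL i) (P := M) (M.r.flip ∘ₗ (ind.liftAux i M h).toLin)
    (fun z a g => (congrArg (M.r g) ((ind.liftAux i M h).map_r a z)).trans
      (M.r_mul (i a) g _).symm)
    (fun a z g => (congrArg (M.r g) ((ind.liftAux i M h).map_l a z)).trans (M.comm a g _).symm)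
    (fun a _ g => M.r_mul g a _)

theorem ind.lift_incl {C : BiMod k R R} (M : BiMod k Γ Γ) (h : Hom C (res i i M)) (c : C) :
    (ind.lift i M h).toLin ((ind.incl i C).toLin c) = h.toLin c := by
  have h1 : (ind.lift i M h).toLin ((ind.incl i C).toLin c) =
      M.r (regOne k Γ) ((ind.liftAux i M h).toLin (tmul (regR i) C (regOne k Γ) c)) :=
    tensLift_tmul (M := tens (regR i) C) (N := regL i) (P := M) _ _ _ _ _ _
  rw [ind.liftAux_tmul] at h1
  exact h1.trans ((M.r_one _).trans (M.l_one _))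

/-- Restriction of a bimodule map. -/
def Hom.res {M N : BiMod k Γ Γ} (f : Hom M N) : Hom (res i i M) (res i i N) :=
  ⟨f.toLin, fun a m => f.map_l (i a) m, fun a m => f.map_r (i a) m⟩

/-- The bimodule map on the tensor product defined by a pairing. -/
def Pairing.toHom {M N Z : BiMod k R R} (P : Pairing M N Z) : Hom (tens M N) Z :=
  tensLift P.β P.bal P.left P.right

theorem Pairing.toHom_tmul {M N Z : BiMod k R R} (P : Pairing M N Z) (m : M) (n : N) :
    P.toHom.toLin (tmul M N m n) = P.β m n := tensLift_tmul _ _ _ _ _ _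

/-- The pairing `M × M' → M ⊗_Γ M'`, over `R`. -/
def resPairing (M M' : BiMod k Γ Γ) : Pairing (res i i M) (res i i M') (res i i (tens M M')) where
  β := tmul M M'
  bal m a n := tmul_bal (M := M) (N := M') m (i a) n
  left a m n := (tens_l (M := M) (N := M') (i a) m n).symm
  right a m n := (tens_r (M := M) (N := M') (i a) m n).symm

variable (N : BiMod k R R)

/-- The pairing `M × N → M`, `(x, n) ↦ x n`, for a bimodule `M` over the tensor algebra of `N`. -/
def rightPairing (M : BiMod k (TensAlg N) (TensAlg N)) :
    Pairing (res (TensAlg.incl N) (TensAlg.incl N) M) N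
      (res (TensAlg.incl N) (TensAlg.incl N) M) where
  β := M.r.flip.compl₂ (TensAlg.inclN N)
  bal m a n := by
    simp only [LinearMap.compl₂_apply, LinearMap.flip_apply, TensAlg.inclN_l, M.r_mul]
    rfl
  left a m n := (M.comm _ _ _).symm
  right a m n := by
    simp only [LinearMap.compl₂_apply, LinearMap.flip_apply, TensAlg.inclN_r, M.r_mul]
    rfl

/-- The pairing `N × M → M`, `(n, x) ↦ n x`, for a bimodule `M` over the tensor algebra of `N`. -/
def leftPairing (M : BiMod k (TensAlg N) (TensAlg N)) :
    Pairing N (res (TensAlg.incl N) (TensAlg.incl N) M)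
      (res (TensAlg.incl N) (TensAlg.incl N) M) where
  β := M.l ∘ₗ TensAlg.inclN N
  bal m a n := by
    simp only [LinearMap.comp_apply, TensAlg.inclN_r, M.l_mul]
    rfl
  left a m n := by
    simp only [LinearMap.comp_apply, TensAlg.inclN_l, M.l_mul]
    rfl
  right a m n := M.comm _ _ _

end BiMod

namespace BiMod

open Slot

variable {k : Type u} [Field k] {R : Type u} [CommRing R] [Algebra k R]

theorem Pairing.act2_right {M N Z : BiMod k R R} (P : Pairing M N Z) (e : M)
    (he : ∀ a, M.l a e = M.r a e) (x : R ⊗[k] R) (n : N) :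
    P.β e (act2 N x n) = act2 Z x (P.β e n) := by
  induction x using TensorProduct.induction_on with
  | zero => simp
  | add x y hx hy => simp only [map_add, LinearMap.add_apply, hx, hy]
  | tmul a b => rw [act2_tmul, act2_tmul, ← P.bal, ← he, P.left, P.right]

theorem Pairing.act2_left {M N Z : BiMod k R R} (P : Pairing M N Z) (e : N)
    (he : ∀ a, N.l a e = N.r a e) (x : R ⊗[k] R) (m : M) :
    P.β (act2 M x m) e = act2 Z x (P.β m e) := by
  induction x using TensorProduct.induction_on with
  | zero => simp
  | add x y hx hy => simp only [map_add, LinearMap.add_apply, hx, hy]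
  | tmul a b => rw [act2_tmul, act2_tmul, P.left, P.bal, he, P.right]

theorem act2_inl (M : BiMod k R R) (a : R) (x : R ⊗[k] R) (m : M) :
    act2 M ((a ⊗ₜ 1) * x) m = M.l a (act2 M x m) := by
  rw [act2_mul, act2_tmul, M.r_one]

theorem act2_inr (M : BiMod k R R) (a : R) (x : R ⊗[k] R) (m : M) :
    act2 M ((1 ⊗ₜ a) * x) m = M.r a (act2 M x m) := by
  rw [act2_mul, act2_tmul, M.l_one]

end BiMod

namespace MatrixBimoduleProblem

open BiMod Slot

variable {k : Type u} [Field k] (𝔄 : MatrixBimoduleProblem k)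

theorem idem_V (j : Fin 𝔄.m) (p q) :
    (𝔄.idem (𝔄.cls p) ⊗ₜ[k] (1 : 𝔄.R)) * 𝔄.V j p q = 𝔄.V j p q := by
  by_cases h : 𝔄.cls p = 𝔄.vsrc j ∧ 𝔄.cls q = 𝔄.vtgt j
  · rw [← 𝔄.vIdem_V, ← mul_assoc, vIdem, Algebra.TensorProduct.tmul_mul_tmul, h.1, idem_mul_self,
      one_mul]
  · rw [𝔄.V_supp j p q h, mul_zero]

theorem V_idem' (j : Fin 𝔄.m) (p q) :
    ((1 : 𝔄.R) ⊗ₜ[k] 𝔄.idem (𝔄.cls q)) * 𝔄.V j p q = 𝔄.V j p q := by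
  by_cases h : 𝔄.cls p = 𝔄.vsrc j ∧ 𝔄.cls q = 𝔄.vtgt j
  · rw [← 𝔄.vIdem_V, ← mul_assoc, vIdem, Algebra.TensorProduct.tmul_mul_tmul, h.2, idem_mul_self,
      one_mul]
  · rw [𝔄.V_supp j p q h, mul_zero]

theorem A2_supp (l : Fin 𝔄.n) (p q) (h : ¬ (𝔄.cls p = 𝔄.asrc l ∧ 𝔄.cls q = 𝔄.atgt l)) :
    𝔄.A2 l p q = 0 := by
  rw [A2_apply, 𝔄.A_supp l p q h, zero_smul]

theorem idem_A2 (j : Fin 𝔄.n) (p q) :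
    (𝔄.idem (𝔄.cls p) ⊗ₜ[k] (1 : 𝔄.R)) * 𝔄.A2 j p q = 𝔄.A2 j p q := by
  by_cases h : 𝔄.cls p = 𝔄.asrc j ∧ 𝔄.cls q = 𝔄.atgt j
  · rw [← 𝔄.aIdem_A2, ← mul_assoc, aIdem, Algebra.TensorProduct.tmul_mul_tmul, h.1, idem_mul_self,
      one_mul]
  · rw [𝔄.A2_supp j p q h, mul_zero]

theorem A2_idem (j : Fin 𝔄.n) (p q) :
    ((1 : 𝔄.R) ⊗ₜ[k] 𝔄.idem (𝔄.cls q)) * 𝔄.A2 j p q = 𝔄.A2 j p q := by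
  by_cases h : 𝔄.cls p = 𝔄.asrc j ∧ 𝔄.cls q = 𝔄.atgt j
  · rw [← 𝔄.aIdem_A2, ← mul_assoc, aIdem, Algebra.TensorProduct.tmul_mul_tmul, h.2, idem_mul_self,
      one_mul]
  · rw [𝔄.A2_supp j p q h, mul_zero]

/-- The matrix `∑ e_X * E_X + ∑ v_j * V_j` with entries in a bimodule. -/
def formal (M : BiMod k 𝔄.R 𝔄.R) (e : M) (v : Fin 𝔄.m → M) (p q : Fin 𝔄.t) : M :=
  (if p = q then M.l (𝔄.idem (𝔄.cls p)) e else 0) + ∑ j, act2 M (𝔄.V j p q) (v j)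

section product

variable {M M' Z : BiMod k 𝔄.R 𝔄.R} (P : Pairing M M' Z)

theorem beta_idem_act2 (e : M) (he : ∀ a, M.l a e = M.r a e) (p : Fin 𝔄.t) (x : 𝔄.R ⊗[k] 𝔄.R)
    (hx : (𝔄.idem (𝔄.cls p) ⊗ₜ[k] (1 : 𝔄.R)) * x = x) (n : M') :
    P.β (M.l (𝔄.idem (𝔄.cls p)) e) (act2 M' x n) = act2 Z x (P.β e n) := by
  rw [he, P.bal, ← act2_inl, hx, P.act2_right e he]

theorem beta_act2_idem (e : M') (he : ∀ a, M'.l a e = M'.r a e) (p : Fin 𝔄.t)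
    (x : 𝔄.R ⊗[k] 𝔄.R) (hx : ((1 : 𝔄.R) ⊗ₜ[k] 𝔄.idem (𝔄.cls p)) * x = x) (m : M) :
    P.β (act2 M x m) (M'.l (𝔄.idem (𝔄.cls p)) e) = act2 Z x (P.β m e) := by
  rw [← P.bal, ← act2_inr, hx, P.act2_left e he]

/-- The product of the formal matrices is the formal matrix of the product. -/
theorem formal_mul (e : M) (v : Fin 𝔄.m → M) (e' : M') (v' : Fin 𝔄.m → M')
    (he : ∀ a, M.l a e = M.r a e) (he' : ∀ a, M'.l a e' = M'.r a e') (p q : Fin 𝔄.t) :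
    ∑ r, P.β (𝔄.formal M e v p r) (𝔄.formal M' e' v' r q) =
      𝔄.formal Z (P.β e e') (P.tupMul 𝔄.γ e v e' v') p q := by
  have h1 : ∑ r, P.β (if p = r then M.l (𝔄.idem (𝔄.cls p)) e else 0)
      (if r = q then M'.l (𝔄.idem (𝔄.cls r)) e' else 0) =
      if p = q then Z.l (𝔄.idem (𝔄.cls p)) (P.β e e') else 0 := by
    rw [Finset.sum_eq_single p]
    · rw [if_pos rfl]
      split_ifs with h
      · rw [he, P.bal, ← M'.l_mul, idem_mul_self, ← P.bal, ← he, P.left]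
      · rw [map_zero]
    · intro r _ hr
      rw [if_neg (Ne.symm hr), map_zero, LinearMap.zero_apply]
    · simp
  have h2 : ∑ r, P.β (if p = r then M.l (𝔄.idem (𝔄.cls p)) e else 0)
      (∑ j, act2 M' (𝔄.V j r q) (v' j)) = ∑ j, act2 Z (𝔄.V j p q) (P.β e (v' j)) := by
    rw [Finset.sum_eq_single p]
    · rw [if_pos rfl, map_sum]
      exact Finset.sum_congr rfl fun j _ => 𝔄.beta_idem_act2 P e he p _ (𝔄.idem_V j p q) _
    · intro r _ hr
      rw [if_neg (Ne.symm hr), map_zero, LinearMap.zero_apply]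
    · simp
  have h3 : ∑ r, P.β (∑ j, act2 M (𝔄.V j p r) (v j))
      (if r = q then M'.l (𝔄.idem (𝔄.cls r)) e' else 0) =
      ∑ j, act2 Z (𝔄.V j p q) (P.β (v j) e') := by
    rw [Finset.sum_eq_single q]
    · rw [if_pos rfl, map_sum, LinearMap.sum_apply]
      exact Finset.sum_congr rfl fun j _ => 𝔄.beta_act2_idem P e' he' q _ (𝔄.V_idem' j p q) _
    · intro r _ hr
      rw [if_neg hr, map_zero]
    · simp
  have h4 : ∑ r, P.β (∑ j, act2 M (𝔄.V j p r) (v j)) (∑ j, act2 M' (𝔄.V j r q) (v' j)) =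
      ∑ l, act2 Z (𝔄.V l p q) (∑ i, ∑ j, P.act3 (𝔄.γ i j l) (v i) (v' j)) := by
    have e1 : ∀ r, P.β (∑ j, act2 M (𝔄.V j p r) (v j)) (∑ j, act2 M' (𝔄.V j r q) (v' j)) =
        ∑ i, ∑ j, P.act3 (s12 k 𝔄.R (𝔄.V i p r) * s23 k 𝔄.R (𝔄.V j r q)) (v i) (v' j) :=
      fun r => by
        simp only [map_sum, LinearMap.sum_apply, P.act3_s12_mul_s23]
        rw [Finset.sum_comm]
    have e2 : ∀ i j, ∑ r, P.act3 (s12 k 𝔄.R (𝔄.V i p r) * s23 k 𝔄.R (𝔄.V j r q)) (v i) (v' j) =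
        ∑ l, act2 Z (𝔄.V l p q) (P.act3 (𝔄.γ i j l) (v i) (v' j)) := fun i j => by
      simp only [← P.act3_mul_s13, ← LinearMap.sum_apply, ← map_sum, 𝔄.V_mul]
    simp only [e1]
    rw [Finset.sum_comm]
    conv_lhs => enter [2, i]; rw [Finset.sum_comm]
    simp only [e2]
    simp only [map_sum]
    conv_lhs => enter [2, i]; rw [Finset.sum_comm]
    rw [Finset.sum_comm]
  simp only [formal, map_add, LinearMap.add_apply, Finset.sum_add_distrib, h1, h2, h3, h4,
    Pairing.tupMul]
  abel

end product

section commutator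

variable {M N : BiMod k 𝔄.R 𝔄.R} (Pr : Pairing M N M) (Pl : Pairing N M M)

/-- `e a_l - a_l e + ∑ η_ijl (v_i a_j) - ∑ σ_ijl (a_i v_j) + ∑ ζ_il v_i`. -/
def kap (e : M) (v : Fin 𝔄.m → M) (a : Fin 𝔄.n → N) (l : Fin 𝔄.n) : M :=
  (Pr.β e (a l) + ∑ i, ∑ j, Pr.act3 (𝔄.η i j l) (v i) (a j)) -
    (Pl.β (a l) e + ∑ i, ∑ j, Pl.act3 (𝔄.σ i j l) (a i) (v j)) +
    ∑ i, act2 M (𝔄.ζ i l) (v i)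

/-- The matrix `∑ a_l * A_l`. -/
def formalA (a : Fin 𝔄.n → N) (p q : Fin 𝔄.t) : N := ∑ l, act2 N (𝔄.A2 l p q) (a l)

/-- The commutator of the formal matrices. -/
theorem commutator (e : M) (v : Fin 𝔄.m → M) (a : Fin 𝔄.n → N)
    (he : ∀ a, M.l a e = M.r a e) (p q : Fin 𝔄.t) :
    ∑ r, (M.r (𝔄.H r q) (𝔄.formal M e v p r) + Pr.β (𝔄.formal M e v p r) (𝔄.formalA a r q)) -
      ∑ r, (M.l (𝔄.H p r) (𝔄.formal M e v r q) + Pl.β (𝔄.formalA a p r) (𝔄.formal M e v r q)) =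
      ∑ l, act2 M (𝔄.A2 l p q) (𝔄.kap Pr Pl e v a l) := by
  have h1 : ∑ r, M.r (𝔄.H r q) (if p = r then M.l (𝔄.idem (𝔄.cls p)) e else 0) =
      ∑ r, M.l (𝔄.H p r) (if r = q then M.l (𝔄.idem (𝔄.cls r)) e else 0) := by
    rw [Finset.sum_eq_single p, Finset.sum_eq_single q]
    · rw [if_pos rfl, if_pos rfl, ← M.comm, ← he, ← M.l_mul, ← M.l_mul]
      have h : 𝔄.idem (𝔄.cls p) * 𝔄.H p q = 𝔄.H p q := 𝔄.H_idem p q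
      rw [h]
      by_cases hpq : 𝔄.cls p = 𝔄.cls q
      · rw [← hpq, mul_comm, h]
      · rw [𝔄.H_supp p q hpq, zero_mul]
    · intro r _ hr
      rw [if_neg hr, map_zero]
    · simp
    · intro r _ hr
      rw [if_neg (Ne.symm hr), map_zero]
    · simp
  have h2 : ∑ r, M.r (𝔄.H r q) (∑ j, act2 M (𝔄.V j p r) (v j)) -
      ∑ r, M.l (𝔄.H p r) (∑ j, act2 M (𝔄.V j r q) (v j)) =
      ∑ l, act2 M (𝔄.A2 l p q) (∑ i, act2 M (𝔄.ζ i l) (v i)) := by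
    simp only [map_sum, ← act2_inl, ← act2_inr, ← act2_mul]
    rw [Finset.sum_comm]
    conv_lhs => enter [2]; rw [Finset.sum_comm]
    conv_rhs => rw [Finset.sum_comm]
    rw [← Finset.sum_sub_distrib]
    refine Finset.sum_congr rfl fun j _ => ?_
    simp only [← LinearMap.sum_apply, ← map_sum, ← LinearMap.sub_apply, ← map_sub]
    have h := 𝔄.V_der j p q
    simp only [mul_comm (𝔄.V j p _), mul_comm (𝔄.ζ j _)] at h
    rw [h]
  have h3 : ∑ r, Pr.β (if p = r then M.l (𝔄.idem (𝔄.cls p)) e else 0) (𝔄.formalA a r q) =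
      ∑ l, act2 M (𝔄.A2 l p q) (Pr.β e (a l)) := by
    rw [Finset.sum_eq_single p]
    · rw [if_pos rfl, formalA, map_sum]
      exact Finset.sum_congr rfl fun l _ => 𝔄.beta_idem_act2 Pr e he p _ (𝔄.idem_A2 l p q) _
    · intro r _ hr
      rw [if_neg (Ne.symm hr), map_zero, LinearMap.zero_apply]
    · simp
  have h4 : ∑ r, Pl.β (𝔄.formalA a p r) (if r = q then M.l (𝔄.idem (𝔄.cls r)) e else 0) =
      ∑ l, act2 M (𝔄.A2 l p q) (Pl.β (a l) e) := by
    rw [Finset.sum_eq_single q]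
    · rw [if_pos rfl, formalA, map_sum, LinearMap.sum_apply]
      exact Finset.sum_congr rfl fun l _ => 𝔄.beta_act2_idem Pl e he q _ (𝔄.A2_idem l p q) _
    · intro r _ hr
      rw [if_neg hr, map_zero]
    · simp
  have h5 : ∑ r, Pr.β (∑ j, act2 M (𝔄.V j p r) (v j)) (𝔄.formalA a r q) =
      ∑ l, act2 M (𝔄.A2 l p q) (∑ i, ∑ j, Pr.act3 (𝔄.η i j l) (v i) (a j)) := by
    have e1 : ∀ r, Pr.β (∑ j, act2 M (𝔄.V j p r) (v j)) (𝔄.formalA a r q) =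
        ∑ i, ∑ j, Pr.act3 (s12 k 𝔄.R (𝔄.V i p r) * s23 k 𝔄.R (𝔄.A2 j r q)) (v i) (a j) :=
      fun r => by
        simp only [formalA, map_sum, LinearMap.sum_apply, Pr.act3_s12_mul_s23]
        rw [Finset.sum_comm]
    have e2 : ∀ i j, ∑ r, Pr.act3 (s12 k 𝔄.R (𝔄.V i p r) * s23 k 𝔄.R (𝔄.A2 j r q)) (v i) (a j) =
        ∑ l, act2 M (𝔄.A2 l p q) (Pr.act3 (𝔄.η i j l) (v i) (a j)) := fun i j => by
      simp only [← Pr.act3_mul_s13, ← LinearMap.sum_apply, ← map_sum, 𝔄.V_mul_A]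
    simp only [e1]
    rw [Finset.sum_comm]
    conv_lhs => enter [2, i]; rw [Finset.sum_comm]
    simp only [e2]
    simp only [map_sum]
    conv_lhs => enter [2, i]; rw [Finset.sum_comm]
    rw [Finset.sum_comm]
  have h6 : ∑ r, Pl.β (𝔄.formalA a p r) (∑ j, act2 M (𝔄.V j r q) (v j)) =
      ∑ l, act2 M (𝔄.A2 l p q) (∑ i, ∑ j, Pl.act3 (𝔄.σ i j l) (a i) (v j)) := by
    have e1 : ∀ r, Pl.β (𝔄.formalA a p r) (∑ j, act2 M (𝔄.V j r q) (v j)) =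
        ∑ i, ∑ j, Pl.act3 (s12 k 𝔄.R (𝔄.A2 i p r) * s23 k 𝔄.R (𝔄.V j r q)) (a i) (v j) :=
      fun r => by
        simp only [formalA, map_sum, LinearMap.sum_apply, Pl.act3_s12_mul_s23]
        rw [Finset.sum_comm]
    have e2 : ∀ i j, ∑ r, Pl.act3 (s12 k 𝔄.R (𝔄.A2 i p r) * s23 k 𝔄.R (𝔄.V j r q)) (a i) (v j) =
        ∑ l, act2 M (𝔄.A2 l p q) (Pl.act3 (𝔄.σ i j l) (a i) (v j)) := fun i j => by
      simp only [← Pl.act3_mul_s13, ← LinearMap.sum_apply, ← map_sum, 𝔄.A_mul_V]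
    simp only [e1]
    rw [Finset.sum_comm]
    conv_lhs => enter [2, i]; rw [Finset.sum_comm]
    simp only [e2]
    simp only [map_sum]
    conv_lhs => enter [2, i]; rw [Finset.sum_comm]
    rw [Finset.sum_comm]
  have h7 : ∀ r s, M.r r (𝔄.formal M e v p s) =
      M.r r (if p = s then M.l (𝔄.idem (𝔄.cls p)) e else 0) +
      M.r r (∑ j, act2 M (𝔄.V j p s) (v j)) := fun r s => map_add _ _ _
  have h8 : ∀ r s, M.l r (𝔄.formal M e v s q) =
      M.l r (if s = q then M.l (𝔄.idem (𝔄.cls s)) e else 0) +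
      M.l r (∑ j, act2 M (𝔄.V j s q) (v j)) := fun r s => map_add _ _ _
  have h9 : ∀ r s, Pr.β (𝔄.formal M e v p s) r =
      Pr.β (if p = s then M.l (𝔄.idem (𝔄.cls p)) e else 0) r +
      Pr.β (∑ j, act2 M (𝔄.V j p s) (v j)) r := fun r s => by
    rw [formal, map_add, LinearMap.add_apply]
  have h10 : ∀ r s, Pl.β r (𝔄.formal M e v s q) =
      Pl.β r (if s = q then M.l (𝔄.idem (𝔄.cls s)) e else 0) +
      Pl.β r (∑ j, act2 M (𝔄.V j s q) (v j)) := fun r s => map_add _ _ _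
  simp only [h7, h8, h9, h10, Finset.sum_add_distrib, h1, h3, h4, h5, h6]
  simp only [kap, map_add, map_sub, Finset.sum_add_distrib, Finset.sum_sub_distrib]
  rw [← h2]
  abel

/-- The coefficients at the normalized basis are determined by the matrix. -/
theorem eq_zero_of_A2 (M : BiMod k 𝔄.R 𝔄.R) (x : Fin 𝔄.n → M)
    (h : ∀ p q, ∑ l, act2 M (𝔄.A2 l p q) (x l) = 0) (l : Fin 𝔄.n) :
    act2 M (𝔄.aIdem l) (x l) = 0 := by
  obtain ⟨a, -, h1, h2, -⟩ := 𝔄.A_normalized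
  have := h (a l).1 (a l).2
  rw [Finset.sum_eq_single l] at this
  · rwa [A2_apply, h1, one_smul] at this
  · intro j _ hj
    rw [A2_apply, h2 l j hj, zero_smul, map_zero, LinearMap.zero_apply]
  · simp

end commutator

end MatrixBimoduleProblem

namespace MatrixBimoduleProblem

open BiMod Slot

variable {k : Type u} [Field k] (𝔄 : MatrixBimoduleProblem k)

/-- The coalgebra `C = C₀ ⊕ C₁`. -/
def C : BiMod k 𝔄.R 𝔄.R := coMod 𝔄.vIdem

/-- The bimodule `N`. -/
def N : BiMod k 𝔄.R 𝔄.R := quasiFree 𝔄.aIdem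

/-- The generator `e = ∑ e_X` of `C₀`. -/
def e : 𝔄.C := coMod.one 𝔄.vIdem

/-- The basis elements `v_j` of `C₁`. -/
def v (j : Fin 𝔄.m) : 𝔄.C := coMod.gen 𝔄.vIdem 𝔄.vIdem_mul_self j

/-- The basis elements `a_l` of `N`. -/
def a (l : Fin 𝔄.n) : 𝔄.N := quasiFree.gen 𝔄.aIdem 𝔄.aIdem_mul_self l

theorem e_central (a : 𝔄.R) : 𝔄.C.l a 𝔄.e = 𝔄.C.r a 𝔄.e := coMod.one_central _ a

/-- The counit of `C`: `e_X ↦ 1_X`, `v_j ↦ 0`. -/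
def counitC : Hom 𝔄.C (reg k 𝔄.R) := coMod.fst 𝔄.vIdem

/-- The comultiplication of `C`: `e_X ↦ e_X ⊗ e_X`,
`v_l ↦ e ⊗ v_l + v_l ⊗ e + ∑ γ_ijl (v_i ⊗ v_j)`. -/
def comulC : Hom 𝔄.C (tens 𝔄.C 𝔄.C) :=
  coMod.lift 𝔄.vIdem (tmul 𝔄.C 𝔄.C 𝔄.e 𝔄.e)
    (fun a => by rw [tens_l, tens_r, e_central, tmul_bal, e_central])
    ((tensPairing 𝔄.C 𝔄.C).tupMul 𝔄.γ 𝔄.e 𝔄.v 𝔄.e 𝔄.v)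

/-- The left coaction `N → C ⊗ N`, `a_l ↦ e ⊗ a_l + ∑ η_ijl (v_i ⊗ a_j)`. -/
def coactL : Hom 𝔄.N (tens 𝔄.C 𝔄.N) :=
  quasiFree.lift 𝔄.aIdem fun l => tmul 𝔄.C 𝔄.N 𝔄.e (𝔄.a l) +
    ∑ i, ∑ j, (tensPairing 𝔄.C 𝔄.N).act3 (𝔄.η i j l) (𝔄.v i) (𝔄.a j)

/-- The right coaction `N → N ⊗ C`, `a_l ↦ a_l ⊗ e + ∑ σ_ijl (a_i ⊗ v_j)`. -/
def coactR : Hom 𝔄.N (tens 𝔄.N 𝔄.C) :=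
  quasiFree.lift 𝔄.aIdem fun l => tmul 𝔄.N 𝔄.C (𝔄.a l) 𝔄.e +
    ∑ i, ∑ j, (tensPairing 𝔄.N 𝔄.C).act3 (𝔄.σ i j l) (𝔄.a i) (𝔄.v j)

/-- The coderivation `N → C`, `a_l ↦ ∑ ζ_il v_i`. -/
def coder : Hom 𝔄.N 𝔄.C :=
  quasiFree.lift 𝔄.aIdem fun l => ∑ i, act2 𝔄.C (𝔄.ζ i l) (𝔄.v i)

/-- The tensor algebra `Γ` of `N` over `R`. -/
abbrev Γ : Type u := TensAlg 𝔄.N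

/-- The inclusion `R → Γ`. -/
abbrev inc : 𝔄.R →ₐ[k] 𝔄.Γ := TensAlg.incl 𝔄.N

/-- The `Γ`-`Γ`-bimodule `Ξ = Γ ⊗_R C ⊗_R Γ`. -/
def Ξ : BiMod k 𝔄.Γ 𝔄.Γ := ind 𝔄.inc 𝔄.C

/-- `c ↦ 1 ⊗ c ⊗ 1`. -/
def inΞ : Hom 𝔄.C (res 𝔄.inc 𝔄.inc 𝔄.Ξ) := ind.incl 𝔄.inc 𝔄.C

/-- `C ⊗ N → Ξ`, `c ⊗ n ↦ 1 ⊗ c ⊗ n = (1 ⊗ c ⊗ 1) n`. -/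
def inΞR : Hom (tens 𝔄.C 𝔄.N) (res 𝔄.inc 𝔄.inc 𝔄.Ξ) :=
  (rightPairing 𝔄.N 𝔄.Ξ).toHom.comp (tensMap 𝔄.inΞ (Hom.id 𝔄.N))

/-- `N ⊗ C → Ξ`, `n ⊗ c ↦ n ⊗ c ⊗ 1 = n (1 ⊗ c ⊗ 1)`. -/
def inΞL : Hom (tens 𝔄.N 𝔄.C) (res 𝔄.inc 𝔄.inc 𝔄.Ξ) :=
  (leftPairing 𝔄.N 𝔄.Ξ).toHom.comp (tensMap (Hom.id 𝔄.N) 𝔄.inΞ)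

/-- The map `κ₁ - κ₂ + κ₃ : N → Ξ`. -/
def κ : Hom 𝔄.N (res 𝔄.inc 𝔄.inc 𝔄.Ξ) where
  toLin := (𝔄.inΞR.comp 𝔄.coactL).toLin - (𝔄.inΞL.comp 𝔄.coactR).toLin +
    (𝔄.inΞ.comp 𝔄.coder).toLin
  map_l a n := by
    rw [LinearMap.add_apply, LinearMap.sub_apply, Hom.map_l, Hom.map_l, Hom.map_l,
      LinearMap.add_apply, LinearMap.sub_apply]
    simp only [map_add, map_sub]
  map_r a n := by
    rw [LinearMap.add_apply, LinearMap.sub_apply, Hom.map_r, Hom.map_r, Hom.map_r,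
      LinearMap.add_apply, LinearMap.sub_apply]
    simp only [map_add, map_sub]

/-- The `Γ`-`Γ`-bimodule `Ω = Ξ / Im (κ₁ - κ₂ + κ₃)`. -/
def Ω : BiMod k 𝔄.Γ 𝔄.Γ := quot 𝔄.Ξ (Set.range 𝔄.κ.toLin)

/-- The projection `Ξ → Ω`. -/
def prΩ : Hom 𝔄.Ξ 𝔄.Ω := quotMk 𝔄.Ξ (Set.range 𝔄.κ.toLin)

/-- `c ↦ 1 ⊗ c ⊗ 1`, as a map `C → Ω`. -/
def inΩ : Hom 𝔄.C (res 𝔄.inc 𝔄.inc 𝔄.Ω) := (𝔄.prΩ.res 𝔄.inc).comp 𝔄.inΞ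

/-- The map `C ⊗_R C → Ω ⊗_Γ Ω`. -/
def inΩΩ : Hom (tens 𝔄.C 𝔄.C) (res 𝔄.inc 𝔄.inc (tens 𝔄.Ω 𝔄.Ω)) :=
  (resPairing 𝔄.inc 𝔄.Ω 𝔄.Ω).toHom.comp (tensMap 𝔄.inΩ 𝔄.inΩ)

/-- The inclusion `R → Γ` as a map of bimodules. -/
def incReg : Hom (reg k 𝔄.R) (res 𝔄.inc 𝔄.inc (reg k 𝔄.Γ)) where
  toLin := 𝔄.inc.toLinearMap
  map_l a b := map_mul 𝔄.inc a (show 𝔄.R from b)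
  map_r a b := map_mul 𝔄.inc (show 𝔄.R from b) a

/-- The counit of `Ξ`: `g ⊗ c ⊗ g' ↦ g ε(c) g'`. -/
def counitΞ : Hom 𝔄.Ξ (reg k 𝔄.Γ) := ind.lift 𝔄.inc (reg k 𝔄.Γ) (𝔄.incReg.comp 𝔄.counitC)

/-- The comultiplication of `Ξ`, composed with `Ξ ⊗ Ξ → Ω ⊗ Ω`: if `μ c = ∑ c' ⊗ c''`, then
`g ⊗ c ⊗ g' ↦ ∑ (g ⊗ c' ⊗ 1) ⊗ (1 ⊗ c'' ⊗ g')`. -/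
def comulΞ : Hom 𝔄.Ξ (tens 𝔄.Ω 𝔄.Ω) :=
  ind.lift 𝔄.inc (tens 𝔄.Ω 𝔄.Ω) (𝔄.inΩΩ.comp 𝔄.comulC)

/-- The restriction of a map of `Ξ` to `C`. -/
def restr {M : BiMod k 𝔄.Γ 𝔄.Γ} (f : Hom 𝔄.Ξ M) : Hom 𝔄.C (res 𝔄.inc 𝔄.inc M) :=
  (f.res 𝔄.inc).comp 𝔄.inΞ

theorem hom_κ {M : BiMod k 𝔄.Γ 𝔄.Γ} (f : Hom 𝔄.Ξ M) (l : Fin 𝔄.n) :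
    f.toLin (𝔄.κ.toLin (𝔄.a l)) = act2 (res 𝔄.inc 𝔄.inc M) (𝔄.aIdem l)
      (𝔄.kap (rightPairing 𝔄.N M) (leftPairing 𝔄.N M) ((𝔄.restr f).toLin 𝔄.e)
        (fun j => (𝔄.restr f).toLin (𝔄.v j)) 𝔄.a l) := by
  have h1 : (f.res 𝔄.inc).toLin ((𝔄.inΞR.comp 𝔄.coactL).toLin (𝔄.a l)) =
      act2 (res 𝔄.inc 𝔄.inc M) (𝔄.aIdem l)
        ((rightPairing 𝔄.N M).β ((𝔄.restr f).toLin 𝔄.e) (𝔄.a l) + ∑ i, ∑ j,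
          (rightPairing 𝔄.N M).act3 (𝔄.η i j l) ((𝔄.restr f).toLin (𝔄.v i)) (𝔄.a j)) := by
    have h : ∀ c n, ((f.res 𝔄.inc).comp 𝔄.inΞR).toLin (tmul 𝔄.C 𝔄.N c n) =
        (rightPairing 𝔄.N M).β ((𝔄.restr f).toLin c) n := fun c n =>
      (congrArg f.toLin ((congrArg (rightPairing 𝔄.N 𝔄.Ξ).toHom.toLin
        (tensMap_tmul 𝔄.inΞ (Hom.id 𝔄.N) c n)).trans (Pairing.toHom_tmul _ _ _))).trans
        (f.map_r (TensAlg.inclN 𝔄.N n) (𝔄.inΞ.toLin c))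
    have h' := (tensPairing 𝔄.C 𝔄.N).act3_map (rightPairing 𝔄.N M) (𝔄.restr f) (Hom.id 𝔄.N)
      ((f.res 𝔄.inc).comp 𝔄.inΞR) h
    have h0 : 𝔄.coactL.toLin (𝔄.a l) = _ := quasiFree.lift_gen 𝔄.aIdem_mul_self _ l
    change ((f.res 𝔄.inc).comp 𝔄.inΞR).toLin (𝔄.coactL.toLin (𝔄.a l)) = _
    rw [h0, Hom.map_act2]
    simp only [map_add, map_sum, h, h']
    rfl
  have h2 : (f.res 𝔄.inc).toLin ((𝔄.inΞL.comp 𝔄.coactR).toLin (𝔄.a l)) =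
      act2 (res 𝔄.inc 𝔄.inc M) (𝔄.aIdem l)
        ((leftPairing 𝔄.N M).β (𝔄.a l) ((𝔄.restr f).toLin 𝔄.e) + ∑ i, ∑ j,
          (leftPairing 𝔄.N M).act3 (𝔄.σ i j l) (𝔄.a i) ((𝔄.restr f).toLin (𝔄.v j))) := by
    have h : ∀ n c, ((f.res 𝔄.inc).comp 𝔄.inΞL).toLin (tmul 𝔄.N 𝔄.C n c) =
        (leftPairing 𝔄.N M).β n ((𝔄.restr f).toLin c) := fun n c =>
      (congrArg f.toLin ((congrArg (leftPairing 𝔄.N 𝔄.Ξ).toHom.toLin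
        (tensMap_tmul (Hom.id 𝔄.N) 𝔄.inΞ n c)).trans (Pairing.toHom_tmul _ _ _))).trans
        (f.map_l (TensAlg.inclN 𝔄.N n) (𝔄.inΞ.toLin c))
    have h' := (tensPairing 𝔄.N 𝔄.C).act3_map (leftPairing 𝔄.N M) (Hom.id 𝔄.N) (𝔄.restr f)
      ((f.res 𝔄.inc).comp 𝔄.inΞL) h
    have h0 : 𝔄.coactR.toLin (𝔄.a l) = _ := quasiFree.lift_gen 𝔄.aIdem_mul_self _ l
    change ((f.res 𝔄.inc).comp 𝔄.inΞL).toLin (𝔄.coactR.toLin (𝔄.a l)) = _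
    rw [h0, Hom.map_act2]
    simp only [map_add, map_sum, h, h']
    rfl
  have h3 : (f.res 𝔄.inc).toLin ((𝔄.inΞ.comp 𝔄.coder).toLin (𝔄.a l)) =
      act2 (res 𝔄.inc 𝔄.inc M) (𝔄.aIdem l)
        (∑ i, act2 (res 𝔄.inc 𝔄.inc M) (𝔄.ζ i l) ((𝔄.restr f).toLin (𝔄.v i))) := by
    have h0 : 𝔄.coder.toLin (𝔄.a l) = _ := quasiFree.lift_gen 𝔄.aIdem_mul_self _ l
    change (𝔄.restr f).toLin (𝔄.coder.toLin (𝔄.a l)) = _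
    rw [h0, Hom.map_act2]
    simp only [map_sum, Hom.map_act2]
  have h4 : f.toLin (𝔄.κ.toLin (𝔄.a l)) =
      (f.res 𝔄.inc).toLin ((𝔄.inΞR.comp 𝔄.coactL).toLin (𝔄.a l)) -
      (f.res 𝔄.inc).toLin ((𝔄.inΞL.comp 𝔄.coactR).toLin (𝔄.a l)) +
      (f.res 𝔄.inc).toLin ((𝔄.inΞ.comp 𝔄.coder).toLin (𝔄.a l)) := by
    rw [← map_sub, ← map_add]; rfl
  rw [h4, h1, h2, h3, kap]
  simp only [map_add, map_sub]

theorem hom_κ_eq_zero {M : BiMod k 𝔄.Γ 𝔄.Γ} (f : Hom 𝔄.Ξ M)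
    (h : ∀ l, act2 (res 𝔄.inc 𝔄.inc M) (𝔄.aIdem l)
      (𝔄.kap (rightPairing 𝔄.N M) (leftPairing 𝔄.N M) ((𝔄.restr f).toLin 𝔄.e)
        (fun j => (𝔄.restr f).toLin (𝔄.v j)) 𝔄.a l) = 0) :
    ∀ s ∈ Set.range 𝔄.κ.toLin, f.toLin s = 0 := by
  rintro _ ⟨n, rfl⟩
  have hn : ∑ j, act2 𝔄.N (quasiFree.coeff 𝔄.aIdem j n) (𝔄.a j) = n :=
    quasiFree.sum_gen 𝔄.aIdem_mul_self n
  change ((f.res 𝔄.inc).comp 𝔄.κ).toLin n = 0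
  rw [← hn, map_sum]
  refine Finset.sum_eq_zero fun l _ => ?_
  rw [Hom.map_act2]
  exact (congrArg _ ((𝔄.hom_κ f l).trans (h l))).trans (map_zero _)

/-- The element `Θ_pq` of `Γ`. -/
def Θ (p q : Fin 𝔄.t) : 𝔄.Γ :=
  𝔄.inc (𝔄.H p q) + TensAlg.inclN 𝔄.N (𝔄.formalA 𝔄.a p q)

theorem commutator_Θ (M : BiMod k 𝔄.Γ 𝔄.Γ) (e : M) (v : Fin 𝔄.m → M)
    (he : ∀ a, M.l (𝔄.inc a) e = M.r (𝔄.inc a) e) (p q : Fin 𝔄.t) :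
    ∑ r, M.r (𝔄.Θ r q) (𝔄.formal (res 𝔄.inc 𝔄.inc M) e v p r) -
      ∑ r, M.l (𝔄.Θ p r) (𝔄.formal (res 𝔄.inc 𝔄.inc M) e v r q) =
      ∑ l, act2 (res 𝔄.inc 𝔄.inc M) (𝔄.A2 l p q)
        (𝔄.kap (rightPairing 𝔄.N M) (leftPairing 𝔄.N M) e v 𝔄.a l) := by
  rw [← 𝔄.commutator (rightPairing 𝔄.N M) (leftPairing 𝔄.N M) e v 𝔄.a he p q]
  simp only [Θ, map_add, LinearMap.add_apply]
  rfl

/-- The element `e` of `Ω`. -/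
def eΩ : 𝔄.Ω := 𝔄.inΩ.toLin 𝔄.e

/-- The elements `v_j` of `Ω`. -/
def vΩ (j : Fin 𝔄.m) : 𝔄.Ω := 𝔄.inΩ.toLin (𝔄.v j)

theorem eΩ_central (a : 𝔄.R) : 𝔄.Ω.l (𝔄.inc a) 𝔄.eΩ = 𝔄.Ω.r (𝔄.inc a) 𝔄.eΩ :=
  (𝔄.inΩ.map_l a 𝔄.e).symm.trans ((congrArg 𝔄.inΩ.toLin (𝔄.e_central a)).trans
    (𝔄.inΩ.map_r a 𝔄.e))

theorem kap_Ω (l : Fin 𝔄.n) : act2 (res 𝔄.inc 𝔄.inc 𝔄.Ω) (𝔄.aIdem l)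
    (𝔄.kap (rightPairing 𝔄.N 𝔄.Ω) (leftPairing 𝔄.N 𝔄.Ω) 𝔄.eΩ 𝔄.vΩ 𝔄.a l) = 0 :=
  (𝔄.hom_κ 𝔄.prΩ l).symm.trans (quotMk_eq_zero _ _ ⟨_, rfl⟩)

/-- The formal matrix in `Ω`. -/
def F (p q : Fin 𝔄.t) : 𝔄.Ω := 𝔄.formal (res 𝔄.inc 𝔄.inc 𝔄.Ω) 𝔄.eΩ 𝔄.vΩ p q

theorem F_Θ (p q : Fin 𝔄.t) :
    ∑ r, 𝔄.Ω.r (𝔄.Θ r q) (𝔄.F p r) = ∑ r, 𝔄.Ω.l (𝔄.Θ p r) (𝔄.F r q) := by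
  rw [← sub_eq_zero]
  refine (𝔄.commutator_Θ 𝔄.Ω 𝔄.eΩ 𝔄.vΩ 𝔄.eΩ_central p q).trans ?_
  refine Finset.sum_eq_zero fun l _ => ?_
  rw [← aIdem_A2, mul_comm, act2_mul, kap_Ω, map_zero]

theorem act2_tupMul {M M' Z : BiMod k 𝔄.R 𝔄.R} (P : Pairing M M' Z) (e : M) (v : Fin 𝔄.m → M)
    (e' : M') (v' : Fin 𝔄.m → M') (he : ∀ a, M.l a e = M.r a e)
    (he' : ∀ a, M'.l a e' = M'.r a e') (hv : ∀ j, act2 M (𝔄.vIdem j) (v j) = v j)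
    (hv' : ∀ j, act2 M' (𝔄.vIdem j) (v' j) = v' j) (l : Fin 𝔄.m) :
    act2 Z (𝔄.vIdem l) (P.tupMul 𝔄.γ e v e' v' l) = P.tupMul 𝔄.γ e v e' v' l := by
  simp only [Pairing.tupMul, map_add, map_sum, ← P.act2_right e he, ← P.act2_left e' he', hv, hv',
    ← P.act3_mul_s13, gamma_idem]

theorem act2_v (j : Fin 𝔄.m) : act2 𝔄.C (𝔄.vIdem j) (𝔄.v j) = 𝔄.v j :=
  coMod.act2_gen 𝔄.vIdem_mul_self j

theorem act2_vΩ (j : Fin 𝔄.m) : act2 (res 𝔄.inc 𝔄.inc 𝔄.Ω) (𝔄.vIdem j) (𝔄.vΩ j) = 𝔄.vΩ j :=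
  (𝔄.inΩ.map_act2 _ _).symm.trans (congrArg 𝔄.inΩ.toLin (𝔄.act2_v j))

/-- The pairing `Ω × Ω → Ω ⊗_Γ Ω`, over `R`. -/
abbrev pairΩ : Pairing (res 𝔄.inc 𝔄.inc 𝔄.Ω) (res 𝔄.inc 𝔄.inc 𝔄.Ω)
    (res 𝔄.inc 𝔄.inc (tens 𝔄.Ω 𝔄.Ω)) := resPairing 𝔄.inc 𝔄.Ω 𝔄.Ω

theorem inΩΩ_tmul (c d : 𝔄.C) :
    𝔄.inΩΩ.toLin (tmul 𝔄.C 𝔄.C c d) = tmul 𝔄.Ω 𝔄.Ω (𝔄.inΩ.toLin c) (𝔄.inΩ.toLin d) :=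
  (congrArg (resPairing 𝔄.inc 𝔄.Ω 𝔄.Ω).toHom.toLin (tensMap_tmul 𝔄.inΩ 𝔄.inΩ c d)).trans
    (Pairing.toHom_tmul _ _ _)

theorem comulC_e : 𝔄.comulC.toLin 𝔄.e = tmul 𝔄.C 𝔄.C 𝔄.e 𝔄.e := coMod.lift_one _ _ _ _

theorem comulC_v (l : Fin 𝔄.m) :
    𝔄.comulC.toLin (𝔄.v l) = (tensPairing 𝔄.C 𝔄.C).tupMul 𝔄.γ 𝔄.e 𝔄.v 𝔄.e 𝔄.v l :=
  (coMod.lift_gen _ 𝔄.vIdem_mul_self _ _ _ _).trans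
    (𝔄.act2_tupMul (tensPairing 𝔄.C 𝔄.C) 𝔄.e 𝔄.v 𝔄.e 𝔄.v 𝔄.e_central 𝔄.e_central 𝔄.act2_v
      𝔄.act2_v l)

theorem restr_comulΞ (c : 𝔄.C) :
    (𝔄.restr 𝔄.comulΞ).toLin c = 𝔄.inΩΩ.toLin (𝔄.comulC.toLin c) :=
  ind.lift_incl 𝔄.inc (tens 𝔄.Ω 𝔄.Ω) (𝔄.inΩΩ.comp 𝔄.comulC) c

theorem restr_comulΞ_e : (𝔄.restr 𝔄.comulΞ).toLin 𝔄.e = tmul 𝔄.Ω 𝔄.Ω 𝔄.eΩ 𝔄.eΩ :=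
  (𝔄.restr_comulΞ 𝔄.e).trans ((congrArg 𝔄.inΩΩ.toLin 𝔄.comulC_e).trans (𝔄.inΩΩ_tmul _ _))

theorem restr_comulΞ_v (l : Fin 𝔄.m) :
    (𝔄.restr 𝔄.comulΞ).toLin (𝔄.v l) = 𝔄.pairΩ.tupMul 𝔄.γ 𝔄.eΩ 𝔄.vΩ 𝔄.eΩ 𝔄.vΩ l :=
  (𝔄.restr_comulΞ (𝔄.v l)).trans ((congrArg 𝔄.inΩΩ.toLin (𝔄.comulC_v l)).trans
    ((tensPairing 𝔄.C 𝔄.C).tupMul_map 𝔄.pairΩ 𝔄.inΩ 𝔄.inΩ 𝔄.inΩΩ 𝔄.inΩΩ_tmul 𝔄.γ 𝔄.e 𝔄.v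
      𝔄.e 𝔄.v l))

theorem comulΞ_κ : ∀ s ∈ Set.range 𝔄.κ.toLin, 𝔄.comulΞ.toLin s = 0 := by
  refine 𝔄.hom_κ_eq_zero _ (𝔄.eq_zero_of_A2 _ _ fun p q => ?_)
  rw [restr_comulΞ_e, funext 𝔄.restr_comulΞ_v]
  have he : ∀ a, (tens 𝔄.Ω 𝔄.Ω).l (𝔄.inc a) (tmul 𝔄.Ω 𝔄.Ω 𝔄.eΩ 𝔄.eΩ) =
      (tens 𝔄.Ω 𝔄.Ω).r (𝔄.inc a) (tmul 𝔄.Ω 𝔄.Ω 𝔄.eΩ 𝔄.eΩ) := fun a => by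
    rw [tens_l, tens_r, eΩ_central, tmul_bal, eΩ_central]
  refine (𝔄.commutator_Θ (tens 𝔄.Ω 𝔄.Ω) _ _ he p q).symm.trans ?_
  have hF : ∀ p q, 𝔄.formal (res 𝔄.inc 𝔄.inc (tens 𝔄.Ω 𝔄.Ω)) (tmul 𝔄.Ω 𝔄.Ω 𝔄.eΩ 𝔄.eΩ)
      (𝔄.pairΩ.tupMul 𝔄.γ 𝔄.eΩ 𝔄.vΩ 𝔄.eΩ 𝔄.vΩ) p q =
      ∑ s, tmul 𝔄.Ω 𝔄.Ω (𝔄.F p s) (𝔄.F s q) := fun p q =>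
    (𝔄.formal_mul 𝔄.pairΩ 𝔄.eΩ 𝔄.vΩ 𝔄.eΩ 𝔄.vΩ 𝔄.eΩ_central 𝔄.eΩ_central p q).symm
  rw [sub_eq_zero]
  simp only [hF, map_sum, tens_l, tens_r]
  rw [Finset.sum_comm]
  simp only [← map_sum, F_Θ]
  simp only [map_sum, ← tmul_bal]
  rw [Finset.sum_comm]
  simp only [← map_sum, ← LinearMap.sum_apply, F_Θ]
  simp only [map_sum, LinearMap.sum_apply]
  rw [Finset.sum_comm]

theorem restr_counitΞ (c : 𝔄.C) :
    (𝔄.restr 𝔄.counitΞ).toLin c = 𝔄.incReg.toLin (𝔄.counitC.toLin c) :=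
  ind.lift_incl 𝔄.inc (reg k 𝔄.Γ) (𝔄.incReg.comp 𝔄.counitC) c

theorem restr_counitΞ_e : (𝔄.restr 𝔄.counitΞ).toLin 𝔄.e = regOne k 𝔄.Γ :=
  (𝔄.restr_counitΞ 𝔄.e).trans (map_one 𝔄.inc)

theorem restr_counitΞ_v (j : Fin 𝔄.m) : (𝔄.restr 𝔄.counitΞ).toLin (𝔄.v j) = 0 :=
  (𝔄.restr_counitΞ (𝔄.v j)).trans (map_zero 𝔄.inc)

theorem counitΞ_κ : ∀ s ∈ Set.range 𝔄.κ.toLin, 𝔄.counitΞ.toLin s = 0 := by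
  refine 𝔄.hom_κ_eq_zero _ fun l => ?_
  rw [restr_counitΞ_e, funext 𝔄.restr_counitΞ_v, kap]
  have h : (rightPairing 𝔄.N (reg k 𝔄.Γ)).β (regOne k 𝔄.Γ) (𝔄.a l) =
    (leftPairing 𝔄.N (reg k 𝔄.Γ)).β (𝔄.a l) (regOne k 𝔄.Γ) := (reg_comm _).symm
  simp only [h, map_zero, LinearMap.zero_apply, Finset.sum_const_zero, add_zero, sub_self]

/-- The counit of `Ω`. -/
def counitΩ : Hom 𝔄.Ω (reg k 𝔄.Γ) := quotLift 𝔄.counitΞ 𝔄.counitΞ_κ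

/-- The comultiplication of `Ω`. -/
def comulΩ : Hom 𝔄.Ω (tens 𝔄.Ω 𝔄.Ω) := quotLift 𝔄.comulΞ 𝔄.comulΞ_κ

theorem counitΩ_e : 𝔄.counitΩ.toLin 𝔄.eΩ = regOne k 𝔄.Γ := 𝔄.restr_counitΞ_e

theorem counitΩ_v (j : Fin 𝔄.m) : 𝔄.counitΩ.toLin (𝔄.vΩ j) = 0 := 𝔄.restr_counitΞ_v j

theorem comulΩ_e : 𝔄.comulΩ.toLin 𝔄.eΩ = tmul 𝔄.Ω 𝔄.Ω 𝔄.eΩ 𝔄.eΩ := 𝔄.restr_comulΞ_e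

theorem comulΩ_v (l : Fin 𝔄.m) :
    𝔄.comulΩ.toLin (𝔄.vΩ l) = 𝔄.pairΩ.tupMul 𝔄.γ 𝔄.eΩ 𝔄.vΩ 𝔄.eΩ 𝔄.vΩ l := 𝔄.restr_comulΞ_v l

theorem Ω_ext {M : BiMod k 𝔄.Γ 𝔄.Γ} {f g : Hom 𝔄.Ω M} (he : f.toLin 𝔄.eΩ = g.toLin 𝔄.eΩ)
    (hv : ∀ j, f.toLin (𝔄.vΩ j) = g.toLin (𝔄.vΩ j)) : f = g := by
  refine quot_ext fun m => ?_
  have h1 : (f.res 𝔄.inc).comp 𝔄.inΩ = (g.res 𝔄.inc).comp 𝔄.inΩ :=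
    coMod.hom_ext 𝔄.vIdem_mul_self he hv
  have h2 : f.comp 𝔄.prΩ = g.comp 𝔄.prΩ :=
    ind.hom_ext 𝔄.inc fun c => congrArg (fun h => h.toLin c) h1
  exact congrArg (fun h => h.toLin m) h2

end MatrixBimoduleProblem

/-- A pairing followed by a bimodule map. -/
def BiMod.Pairing.push {k : Type u} [Field k] {R : Type u} [CommRing R] [Algebra k R]
    {M N Z Z' : BiMod k R R} (P : BiMod.Pairing M N Z) (h : BiMod.Hom Z Z') :
    BiMod.Pairing M N Z' where
  β := P.β.compr₂ h.toLin
  bal m a n := congrArg h.toLin (P.bal m a n)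
  left a m n := (congrArg h.toLin (P.left a m n)).trans (h.map_l a _)
  right a m n := (congrArg h.toLin (P.right a m n)).trans (h.map_r a _)

theorem BiMod.Hom.comp_apply {k : Type u} [Field k] {A B : Type u} [Ring A] [Ring B]
    [Algebra k A] [Algebra k B] {M N P : BiMod k A B} (g : BiMod.Hom N P) (f : BiMod.Hom M N)
    (m : M) : (g.comp f).toLin m = g.toLin (f.toLin m) := rfl

theorem BiMod.Hom.id_apply {k : Type u} [Field k] {A B : Type u} [Ring A] [Ring B]
    [Algebra k A] [Algebra k B] {M : BiMod k A B} (m : M) : (BiMod.Hom.id M).toLin m = m := rfl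

namespace BiMod

open Slot

variable {k : Type u} [Field k] {R : Type u} [CommRing R] [Algebra k R]
  {Γ : Type u} [Ring Γ] [Algebra k Γ] (i : R →ₐ[k] Γ) {ι : Type} [Fintype ι]

theorem resPairing_tupMul_map {M N M' N' : BiMod k Γ Γ} (f : Hom M M') (g : Hom N N')
    (γ : ι → ι → ι → R3 k R) (e : M) (v : ι → M) (e' : N) (v' : ι → N) (l : ι) :
    (tensMap f g).toLin ((resPairing i M N).tupMul γ e v e' v' l) =
      (resPairing i M' N').tupMul γ (f.toLin e) (fun j => f.toLin (v j)) (g.toLin e')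
        (fun j => g.toLin (v' j)) l :=
  (resPairing i M N).tupMul_map (resPairing i M' N') (f.res i) (g.res i) ((tensMap f g).res i)
    (fun m n => tensMap_tmul f g m n) γ e v e' v' l

theorem resPairing_tupMul_left {M N : BiMod k Γ Γ} (γ : ι → ι → ι → R3 k R) (e : M) (e' : N)
    (v' : ι → N) (l : ι) :
    (resPairing i M N).tupMul γ e (fun _ => 0) e' v' l = tmul M N e (v' l) := by
  simp only [Pairing.tupMul, map_zero, LinearMap.zero_apply, Finset.sum_const_zero, add_zero]
  rfl

theorem resPairing_tupMul_right {M N : BiMod k Γ Γ} (γ : ι → ι → ι → R3 k R) (e : M) (v : ι → M)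
    (e' : N) (l : ι) :
    (resPairing i M N).tupMul γ e v e' (fun _ => 0) l = tmul M N (v l) e' := by
  simp only [Pairing.tupMul, map_zero, Finset.sum_const_zero, add_zero, zero_add]
  rfl

theorem resPairing_tupMul_assoc {M N P : BiMod k Γ Γ} (γ : ι → ι → ι → R3 k R)
    (hγ : ∀ i j h l, ∑ m, s123 k R (γ i j m) * s134 k R (γ m h l) =
      ∑ m, s234 k R (γ j h m) * s124 k R (γ i m l))
    (e : M) (v : ι → M) (e' : N) (v' : ι → N) (e'' : P) (v'' : ι → P)
    (he : ∀ a, M.l (i a) e = M.r (i a) e) (he' : ∀ a, N.l (i a) e' = N.r (i a) e')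
    (he'' : ∀ a, P.l (i a) e'' = P.r (i a) e'') (l : ι) :
    (tensAssoc M N P).toLin ((resPairing i M (tens N P)).tupMul γ e v (tmul N P e' e'')
      ((resPairing i N P).tupMul γ e' v' e'' v'') l) =
    (resPairing i (tens M N) P).tupMul γ (tmul M N e e')
      ((resPairing i M N).tupMul γ e v e' v') e'' v'' l := by
  refine ((resPairing i M (tens N P)).tupMul_map
    ((resPairing i M (tens N P)).push ((tensAssoc M N P).res i))
    (Hom.id (res i i M)) (Hom.id (res i i (tens N P)))
    ((tensAssoc M N P).res i) (fun _ _ => rfl) γ e v (tmul N P e' e'')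
      ((resPairing i N P).tupMul γ e' v' e'' v'') l).trans ?_
  symm
  exact tupMul_assoc (resPairing i M N) (resPairing i (tens M N) P) (resPairing i N P)
    ((resPairing i M (tens N P)).push ((tensAssoc M N P).res i)) γ hγ
    (fun u v w => ((tensAssoc_tmul (M := M) (N := N) (P := P) u (tmul N P v w)).trans
      (assocAux_tmul (M := M) (N := N) (P := P) u v w)).symm)
    e v e' v' e'' v'' he he' he'' l

end BiMod

namespace MatrixBimoduleProblem

open BiMod Slot

variable {k : Type u} [Field k] (𝔄 : MatrixBimoduleProblem k)

theorem counitΩ_left (w : 𝔄.Ω) :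
    lUnit 𝔄.Ω (tensMap 𝔄.counitΩ (Hom.id 𝔄.Ω) (𝔄.comulΩ w)) = w := by
  have h : (lUnit 𝔄.Ω).comp ((tensMap 𝔄.counitΩ (Hom.id 𝔄.Ω)).comp 𝔄.comulΩ) = Hom.id 𝔄.Ω := by
    have hv : ∀ x, (lUnit 𝔄.Ω).toLin (tmul (reg k 𝔄.Γ) 𝔄.Ω (regOne k 𝔄.Γ) x) = x := fun x =>
      (lUnit_tmul 𝔄.Ω (regOne k 𝔄.Γ) x).trans (𝔄.Ω.l_one x)
    refine 𝔄.Ω_ext ?_ fun l => ?_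
    · rw [Hom.comp_apply, Hom.comp_apply, comulΩ_e, tensMap_tmul, counitΩ_e, Hom.id_apply, hv]
    · rw [Hom.comp_apply, Hom.comp_apply, comulΩ_v, resPairing_tupMul_map]
      simp only [counitΩ_v, counitΩ_e, Hom.id_apply]
      rw [resPairing_tupMul_left, hv]
  exact congrArg (fun f => f.toLin w) h

theorem counitΩ_right (w : 𝔄.Ω) :
    rUnit 𝔄.Ω (tensMap (Hom.id 𝔄.Ω) 𝔄.counitΩ (𝔄.comulΩ w)) = w := by
  have h : (rUnit 𝔄.Ω).comp ((tensMap (Hom.id 𝔄.Ω) 𝔄.counitΩ).comp 𝔄.comulΩ) = Hom.id 𝔄.Ω := by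
    have hv : ∀ x, (rUnit 𝔄.Ω).toLin (tmul 𝔄.Ω (reg k 𝔄.Γ) x (regOne k 𝔄.Γ)) = x := fun x =>
      (rUnit_tmul 𝔄.Ω x (regOne k 𝔄.Γ)).trans (𝔄.Ω.r_one x)
    refine 𝔄.Ω_ext ?_ fun l => ?_
    · rw [Hom.comp_apply, Hom.comp_apply, comulΩ_e, tensMap_tmul, counitΩ_e, Hom.id_apply, hv]
    · rw [Hom.comp_apply, Hom.comp_apply, comulΩ_v, resPairing_tupMul_map]
      simp only [counitΩ_v, counitΩ_e, Hom.id_apply]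
      rw [resPairing_tupMul_right, hv]
  exact congrArg (fun f => f.toLin w) h

theorem comulΩ_assoc (w : 𝔄.Ω) :
    tensAssoc 𝔄.Ω 𝔄.Ω 𝔄.Ω (tensMap (Hom.id 𝔄.Ω) 𝔄.comulΩ (𝔄.comulΩ w)) =
      tensMap 𝔄.comulΩ (Hom.id 𝔄.Ω) (𝔄.comulΩ w) := by
  have h : (tensAssoc 𝔄.Ω 𝔄.Ω 𝔄.Ω).comp ((tensMap (Hom.id 𝔄.Ω) 𝔄.comulΩ).comp 𝔄.comulΩ) =
      (tensMap 𝔄.comulΩ (Hom.id 𝔄.Ω)).comp 𝔄.comulΩ := by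
    refine 𝔄.Ω_ext ?_ fun l => ?_
    · simp only [Hom.comp_apply, comulΩ_e, tensMap_tmul, Hom.id_apply, tensAssoc_tmul,
        assocAux_tmul]
    · simp only [Hom.comp_apply]
      rw [comulΩ_v, resPairing_tupMul_map, resPairing_tupMul_map]
      simp only [comulΩ_v, comulΩ_e, Hom.id_apply]
      exact resPairing_tupMul_assoc 𝔄.inc 𝔄.γ 𝔄.gamma_assoc 𝔄.eΩ 𝔄.vΩ 𝔄.eΩ 𝔄.vΩ 𝔄.eΩ 𝔄.vΩ
        𝔄.eΩ_central 𝔄.eΩ_central 𝔄.eΩ_central l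
  exact congrArg (fun f => f.toLin w) h

/-- The bocs associated to a matrix bimodule problem. -/
def bocs : Bocs k where
  Γ := 𝔄.Γ
  Ω := 𝔄.Ω
  ε := 𝔄.counitΩ
  μ := 𝔄.comulΩ
  counit_left := 𝔄.counitΩ_left
  counit_right := 𝔄.counitΩ_right
  coassoc := 𝔄.comulΩ_assoc

end MatrixBimoduleProblem

/-! ### Weyr matrices -/

/-- The Weyr matrix `W(λ)` of eigenvalue `c`, partitioned into blocks of sizes
`μ 0 ≥ μ 1 ≥ ⋯`: the diagonal blocks are `c I`, the blocks next to the diagonal are `(I 0)ᵀ`. -/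
def weyrBlock {k : Type u} [Field k] (c : k) {d : ℕ} (μ : Fin d → ℕ) :
    Matrix (Fin (∑ j, μ j)) (Fin (∑ j, μ j)) k :=
  Matrix.reindex finSigmaFinEquiv finSigmaFinEquiv
    (Matrix.of fun x y : Σ j, Fin (μ j) => if x = y then c else
      if x.1.val + 1 = y.1.val ∧ x.2.val = y.2.val then 1 else 0)

/-- `W` is a Weyr matrix: a direct sum `W(λ₁) ⊕ ⋯ ⊕ W(λₛ)` with distinct eigenvalues. -/
def IsWeyr {k : Type u} [Field k] {n : ℕ} (W : Matrix (Fin n) (Fin n) k) : Prop :=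
  ∃ (s : ℕ) (c : Fin s → k) (d : Fin s → ℕ) (μ : ∀ i, Fin (d i) → ℕ) (h : n = ∑ i, ∑ j, μ i j),
    Function.Injective c ∧ (∀ i, Antitone (μ i)) ∧
    W = (Matrix.reindex finSigmaFinEquiv finSigmaFinEquiv
      (Matrix.blockDiagonal' fun i => weyrBlock (c i) (μ i))).submatrix (finCongr h) (finCongr h)

namespace VertexKind

variable {k : Type u} [Field k]

/-- `R_X`-regular matrices: identity matrices if `X` is trivial; Weyr matrices such that
`φ_X` does not vanish at the eigenvalues if `X` is non-trivial. -/
def Regular {n : ℕ} : VertexKind k → Matrix (Fin n) (Fin n) k → Prop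
  | trivial, W => W = 1
  | nontrivial φ _, W => IsWeyr W ∧ ∀ c ∈ spectrum k W, φ.eval c ≠ 0

theorem isUnit_aeval [IsAlgClosed k] {n : ℕ} (φ : k[X]) (_hφ : φ ≠ 0)
    (W : Matrix (Fin n) (Fin n) k) (h : ∀ c ∈ spectrum k W, φ.eval c ≠ 0) :
    IsUnit (Polynomial.aeval W φ) := by
  rcases isEmpty_or_nonempty (Fin n) with hn | hn
  · exact isUnit_of_subsingleton _
  · by_contra hu
    have h0 : (0 : k) ∈ spectrum k (Polynomial.aeval W φ) := spectrum.zero_mem k hu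
    rw [spectrum.map_polynomial_aeval_of_nonempty W φ
      (spectrum.nonempty_of_isAlgClosed_of_finiteDimensional k W)] at h0
    obtain ⟨c, hc, hc'⟩ := h0
    exact h c hc hc'

theorem isUnit_aeval_powers [IsAlgClosed k] {n : ℕ} (φ : k[X]) (hφ : φ ≠ 0)
    (W : Matrix (Fin n) (Fin n) k) (h : ∀ c ∈ spectrum k W, φ.eval c ≠ 0)
    (s : Submonoid.powers φ) :
    IsUnit (((Polynomial.aeval W).toRingHom.toMonoidHom.comp (Submonoid.powers φ).subtype) s) := by
  obtain ⟨_, j, rfl⟩ := s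
  have := (isUnit_aeval φ hφ W h).pow j
  rw [← map_pow] at this
  exact this

/-- The powers of `φ(W)`, as units. -/
def unitsHom [IsAlgClosed k] {n : ℕ} (φ : k[X]) (hφ : φ ≠ 0) (W : Matrix (Fin n) (Fin n) k)
    (h : ∀ c ∈ spectrum k W, φ.eval c ≠ 0) :
    Submonoid.powers φ →* (Matrix (Fin n) (Fin n) k)ˣ :=
  IsUnit.liftRight ((Polynomial.aeval W).toRingHom.toMonoidHom.comp
    (Submonoid.powers φ).subtype) (isUnit_aeval_powers φ hφ W h)

theorem unitsHom_coe [IsAlgClosed k] {n : ℕ} (φ : k[X]) (hφ : φ ≠ 0)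
    (W : Matrix (Fin n) (Fin n) k) (h : ∀ c ∈ spectrum k W, φ.eval c ≠ 0)
    (s : Submonoid.powers φ) :
    (Polynomial.aeval W).toRingHom (s : k[X]) = (unitsHom φ hφ W h s : Matrix (Fin n) (Fin n) k) :=
  (IsUnit.coe_liftRight _ (isUnit_aeval_powers φ hφ W h) s).symm

/-- Substitution of a matrix for the indeterminate, on `k[x, φ(x)⁻¹]`. -/
def evalAway [IsAlgClosed k] {n : ℕ} (φ : k[X]) (hφ : φ ≠ 0) (W : Matrix (Fin n) (Fin n) k)
    (h : ∀ c ∈ spectrum k W, φ.eval c ≠ 0) :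
    Localization.Away φ →ₐ[k] Matrix (Fin n) (Fin n) k :=
  { OreLocalization.universalHom (Polynomial.aeval W).toRingHom (unitsHom φ hφ W h)
      (unitsHom_coe φ hφ W h) with
    commutes' := fun c =>
      (OreLocalization.universalHom_commutes (Polynomial.aeval W).toRingHom (unitsHom φ hφ W h)
        (unitsHom_coe φ hφ W h) (r := algebraMap k k[X] c)).trans
        ((Polynomial.aeval W).commutes c) }

theorem aeval_mul_evalAway [IsAlgClosed k] {n : ℕ} (φ : k[X]) (hφ : φ ≠ 0)
    (W : Matrix (Fin n) (Fin n) k) (h : ∀ c ∈ spectrum k W, φ.eval c ≠ 0) (p : k[X])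
    (s : Submonoid.powers φ) :
    Polynomial.aeval W (s : k[X]) * evalAway φ hφ W h (OreLocalization.oreDiv p s) =
      Polynomial.aeval W p := by
  have h1 : evalAway φ hφ W h (OreLocalization.oreDiv p s) =
    ((unitsHom φ hφ W h s)⁻¹ : (Matrix (Fin n) (Fin n) k)ˣ) * Polynomial.aeval W p := rfl
  have h2 : Polynomial.aeval W (s : k[X]) = (unitsHom φ hφ W h s : Matrix (Fin n) (Fin n) k) :=
    unitsHom_coe φ hφ W h s
  rw [h1, h2, ← mul_assoc, Units.mul_inv, one_mul]

/-- Substitution of a regular matrix for the parameter: the homomorphism `R_X → M_n(k)`. -/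
def eval [IsAlgClosed k] {n : ℕ} (W : Matrix (Fin n) (Fin n) k) :
    (v : VertexKind k) → v.Regular W → (v.Coeff →ₐ[k] Matrix (Fin n) (Fin n) k)
  | trivial, _ => Algebra.ofId k (Matrix (Fin n) (Fin n) k)
  | nontrivial φ hφ, h => evalAway φ hφ W h.2

theorem aeval_comm {n n' : ℕ} {W : Matrix (Fin n) (Fin n) k} {W' : Matrix (Fin n') (Fin n') k}
    (f : Matrix (Fin n) (Fin n') k) (hf : W * f = f * W') (p : k[X]) :
    Polynomial.aeval W p * f = f * Polynomial.aeval W' p := by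
  induction p using Polynomial.induction_on' with
  | add p q hp hq => rw [map_add, map_add, Matrix.add_mul, Matrix.mul_add, hp, hq]
  | monomial j c =>
    have hj : ∀ j, W ^ j * f = f * W' ^ j := fun j => by
      induction j with
      | zero => simp
      | succ j ih => rw [pow_succ, pow_succ, Matrix.mul_assoc, hf, ← Matrix.mul_assoc, ih,
          Matrix.mul_assoc]
    rw [Polynomial.aeval_monomial, Polynomial.aeval_monomial,
      Algebra.algebraMap_eq_smul_one, Algebra.algebraMap_eq_smul_one]
    simp [hj]

theorem evalAway_comm [IsAlgClosed k] {n n' : ℕ} (φ : k[X]) (hφ : φ ≠ 0)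
    {W : Matrix (Fin n) (Fin n) k} {W' : Matrix (Fin n') (Fin n') k}
    (h : ∀ c ∈ spectrum k W, φ.eval c ≠ 0) (h' : ∀ c ∈ spectrum k W', φ.eval c ≠ 0)
    (f : Matrix (Fin n) (Fin n') k) (hf : W * f = f * W') (r : Localization.Away φ) :
    evalAway φ hφ W h r * f = f * evalAway φ hφ W' h' r := by
  induction r using OreLocalization.ind with | _ p s
  have hu : IsUnit (Polynomial.aeval W (s : k[X])) := isUnit_aeval_powers φ hφ W h s
  obtain ⟨x, hx⟩ := hu.exists_left_inv
  have key : Polynomial.aeval W (s : k[X]) *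
      (evalAway φ hφ W h (OreLocalization.oreDiv p s) * f) =
      Polynomial.aeval W (s : k[X]) * (f * evalAway φ hφ W' h' (OreLocalization.oreDiv p s)) := by
    rw [← Matrix.mul_assoc, aeval_mul_evalAway, ← Matrix.mul_assoc, aeval_comm f hf s,
      Matrix.mul_assoc, aeval_mul_evalAway, aeval_comm f hf]
  have := congrArg (x * ·) key
  simpa only [← Matrix.mul_assoc, hx, Matrix.one_mul] using this

theorem eval_comm [IsAlgClosed k] {n n' : ℕ} {W : Matrix (Fin n) (Fin n) k}
    {W' : Matrix (Fin n') (Fin n') k} {v : VertexKind k} (h : v.Regular W) (h' : v.Regular W')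
    (f : Matrix (Fin n) (Fin n') k) (hf : W * f = f * W') (r : v.Coeff) :
    v.eval W h r * f = f * v.eval W' h' r := by
  cases v with
  | trivial =>
    have H : ∀ c : k, algebraMap k (Matrix (Fin n) (Fin n) k) c * f =
        f * algebraMap k (Matrix (Fin n') (Fin n') k) c := fun c => by
      rw [Algebra.algebraMap_eq_smul_one, Algebra.algebraMap_eq_smul_one]
      simp
    exact H r
  | nontrivial φ hφ => exact evalAway_comm φ hφ h.2 h'.2 f hf r

end VertexKind

/-! ### The representation category of a matrix bimodule problem -/

namespace MatrixBimoduleProblem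

open BiMod Slot

variable {k : Type u} [Field k]

/-- A representation of a matrix bimodule problem: a dimension `d X` and a regular matrix `W X`
for each vertex `X`, and a matrix `P l` for each basis element `a_l : X → Y` of `N`. -/
structure Rep (𝔄 : MatrixBimoduleProblem k) : Type u where
  d : 𝔄.Vert → ℕ
  W : ∀ X, Matrix (Fin (d X)) (Fin (d X)) k
  regular : ∀ X, (𝔄.kind X).Regular (W X)
  P : ∀ l, Matrix (Fin (d (𝔄.asrc l))) (Fin (d (𝔄.atgt l))) k

namespace Rep

variable {𝔄 : MatrixBimoduleProblem k}

/-- The index set of the direct sum of the spaces attached to the vertices. -/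
abbrev Idx (P : 𝔄.Rep) : Type := Σ X, Fin (P.d X)

/-- The index set of the rows of the partitioned matrices: the row block at `p` has
`d (cls p)` rows. -/
abbrev Pos (P : 𝔄.Rep) : Type := Σ p, Fin (P.d (𝔄.cls p))

/-- The row of the direct sum to which a row of a partitioned matrix belongs. -/
def Pos.idx {P : 𝔄.Rep} (x : P.Pos) : P.Idx := ⟨𝔄.cls x.1, x.2⟩

variable [IsAlgClosed k]

/-- `r = (r_X)` acts by the block diagonal matrix with the blocks `r_X(W_X)`. -/
def ρ (P : 𝔄.Rep) : 𝔄.R →ₗ[k] Matrix P.Idx P.Idx k where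
  toFun r := Matrix.blockDiagonal' fun X => (𝔄.kind X).eval (P.W X) (P.regular X) (r X)
  map_add' r s := by
    rw [← Matrix.blockDiagonal'_add]
    exact congrArg _ (funext fun X => map_add _ (r X) (s X))
  map_smul' c r := by
    rw [RingHom.id_apply, ← Matrix.blockDiagonal'_smul]
    exact congrArg _ (funext fun X => map_smul _ c (r X))

theorem ρ_apply (P : 𝔄.Rep) (r : 𝔄.R) :
    P.ρ r = Matrix.blockDiagonal' fun X => (𝔄.kind X).eval (P.W X) (P.regular X) (r X) := rfl

theorem ρ_one (P : 𝔄.Rep) : P.ρ 1 = 1 := by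
  rw [ρ_apply, ← Matrix.blockDiagonal'_one]
  exact congrArg _ (funext fun X => map_one _)

theorem ρ_mul (P : 𝔄.Rep) (r s : 𝔄.R) : P.ρ (r * s) = P.ρ r * P.ρ s := by
  rw [ρ_apply, ρ_apply, ρ_apply, ← Matrix.blockDiagonal'_mul]
  exact congrArg _ (funext fun X => map_mul _ (r X) (s X))

/-- The matrices with rows indexed by `P` and columns indexed by `Q`, with the bimodule structure
`(r ⊗ s) C = r(W) C s(W')`. -/
def matMod (P Q : 𝔄.Rep) : BiMod k 𝔄.R 𝔄.R where
  carrier := Matrix P.Idx Q.Idx k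
  l := LinearMap.mk₂ k (fun a M => P.ρ a * M)
    (by intros; rw [map_add, Matrix.add_mul]) (by intros; rw [map_smul, Matrix.smul_mul])
    (by intros; rw [Matrix.mul_add]) (by intros; rw [Matrix.mul_smul])
  r := LinearMap.mk₂ k (fun a M => M * Q.ρ a)
    (by intros; rw [map_add, Matrix.mul_add]) (by intros; rw [map_smul, Matrix.mul_smul])
    (by intros; rw [Matrix.add_mul]) (by intros; rw [Matrix.smul_mul])
  l_one M := by simp [ρ_one]
  l_mul a b M := by simp [ρ_mul, Matrix.mul_assoc]
  r_one M := by simp [ρ_one]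
  r_mul a b M := by simp [ρ_mul, Matrix.mul_assoc]
  comm a b M := by simp [Matrix.mul_assoc]

/-- An element of `matMod P Q`, as a matrix. -/
def toMat {P Q : 𝔄.Rep} : matMod P Q →ₗ[k] Matrix P.Idx Q.Idx k := LinearMap.id

/-- A matrix, as an element of `matMod P Q`. -/
def ofMat {P Q : 𝔄.Rep} (M : Matrix P.Idx Q.Idx k) : matMod P Q := M

theorem toMat_ofMat {P Q : 𝔄.Rep} (M : Matrix P.Idx Q.Idx k) : toMat (ofMat M) = M := rfl

theorem ofMat_toMat {P Q : 𝔄.Rep} (M : matMod P Q) : ofMat (toMat M) = M := rfl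

theorem toMat_l {P Q : 𝔄.Rep} (a : 𝔄.R) (M : matMod P Q) :
    toMat ((matMod P Q).l a M) = P.ρ a * toMat M := rfl

theorem toMat_r {P Q : 𝔄.Rep} (a : 𝔄.R) (M : matMod P Q) :
    toMat ((matMod P Q).r a M) = toMat M * Q.ρ a := rfl

/-- The matrix whose block at `(X, Y)` is `C` and whose other blocks are zero. -/
def blk {P Q : 𝔄.Rep} {X Y : 𝔄.Vert} (C : Matrix (Fin (P.d X)) (Fin (Q.d Y)) k) : matMod P Q :=
  ofMat (Matrix.of fun a b => if h : a.1 = X ∧ b.1 = Y then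
    C (Fin.cast (congrArg P.d h.1) a.2) (Fin.cast (congrArg Q.d h.2) b.2) else 0)

/-- The block at `(X, Y)`. -/
def unblk {P Q : 𝔄.Rep} (X Y : 𝔄.Vert) (M : matMod P Q) : Matrix (Fin (P.d X)) (Fin (Q.d Y)) k :=
  Matrix.of fun i j => toMat M (⟨X, i⟩ : P.Idx) (⟨Y, j⟩ : Q.Idx)

/-- The partitioned matrix with the blocks `M p q`. -/
def part {P Q : 𝔄.Rep} (M : Fin 𝔄.t → Fin 𝔄.t → matMod P Q) : Matrix P.Pos Q.Pos k :=
  Matrix.of fun x y => toMat (M x.1 y.1) x.idx y.idx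

/-- The star product `C * U` of a matrix `C` and a matrix `U` over `R ⊗ R`: the partitioned matrix
with the blocks `(U p q) C`. -/
def star {P Q : 𝔄.Rep} {X Y : 𝔄.Vert} (C : Matrix (Fin (P.d X)) (Fin (Q.d Y)) k)
    (U : Matrix (Fin 𝔄.t) (Fin 𝔄.t) (𝔄.R ⊗[k] 𝔄.R)) : Matrix P.Pos Q.Pos k :=
  part fun p q => act2 (matMod P Q) (U p q) (blk C)

/-- The partitioned matrix `∑ H_X(W_X)`, with the blocks `h_pq(W_X)` for `p, q ∈ X`. -/
def matH (P : 𝔄.Rep) : Matrix P.Pos P.Pos k :=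
  part fun p q => ofMat (P.ρ (𝔄.H p q))

/-- The partitioned matrix `∑ H_X(W_X) + ∑ P(a_l) * A_l` of a representation. -/
def mat (P : 𝔄.Rep) : Matrix P.Pos P.Pos k :=
  P.matH + ∑ l, star (P.P l) (𝔄.A2 l)

/-- The partitioned matrix `∑ f_X * E_X + ∑ f(v_j) * V_j`. -/
def homMat {P Q : 𝔄.Rep} (f : ∀ X, Matrix (Fin (P.d X)) (Fin (Q.d X)) k)
    (fv : ∀ j, Matrix (Fin (P.d (𝔄.vsrc j))) (Fin (Q.d (𝔄.vtgt j))) k) :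
    Matrix P.Pos Q.Pos k :=
  (Matrix.blockDiagonal' fun p => f (𝔄.cls p)) + ∑ j, star (fv j) (𝔄.V j)

/-- A morphism of representations: matrices `f X` that commute with the actions of the `R_X`, and
matrices `fv j` for the basis elements `v_j`, such that `P f = f Q` for the partitioned
matrices. -/
@[ext]
structure Hom (P Q : 𝔄.Rep) : Type u where
  f : ∀ X, Matrix (Fin (P.d X)) (Fin (Q.d X)) k
  fv : ∀ j, Matrix (Fin (P.d (𝔄.vsrc j))) (Fin (Q.d (𝔄.vtgt j))) k
  comm_W : ∀ X, P.W X * f X = f X * Q.W X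
  comm_mat : P.mat * homMat f fv = homMat f fv * Q.mat

/-- The matrix product. -/
def mulPairing (P Q U : 𝔄.Rep) : Pairing (matMod P Q) (matMod Q U) (matMod P U) where
  β := LinearMap.mk₂ k (fun M N => ofMat (toMat M * toMat N))
    (by intros; rw [map_add, Matrix.add_mul]; rfl) (by intros; rw [map_smul, Matrix.smul_mul]; rfl)
    (by intros; rw [map_add, Matrix.mul_add]; rfl) (by intros; rw [map_smul, Matrix.mul_smul]; rfl)
  bal m a n := congrArg ofMat (Matrix.mul_assoc _ _ _)
  left a m n := congrArg ofMat (Matrix.mul_assoc _ _ _)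
  right a m n := (congrArg ofMat (Matrix.mul_assoc _ _ _)).symm

theorem mulPairing_apply {P Q U : 𝔄.Rep} (M : matMod P Q) (N : matMod Q U) :
    (mulPairing P Q U).β M N = ofMat (toMat M * toMat N) := rfl

/-- The block diagonal matrix with the blocks `f X`. -/
def tot {P Q : 𝔄.Rep} (f : ∀ X, Matrix (Fin (P.d X)) (Fin (Q.d X)) k) : matMod P Q :=
  ofMat (Matrix.blockDiagonal' f)

theorem tot_central {P Q : 𝔄.Rep} (f : ∀ X, Matrix (Fin (P.d X)) (Fin (Q.d X)) k)
    (hf : ∀ X, P.W X * f X = f X * Q.W X) (a : 𝔄.R) :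
    (matMod P Q).l a (tot f) = (matMod P Q).r a (tot f) := by
  change P.ρ a * Matrix.blockDiagonal' f = Matrix.blockDiagonal' f * Q.ρ a
  rw [ρ_apply, ρ_apply, ← Matrix.blockDiagonal'_mul, ← Matrix.blockDiagonal'_mul]
  exact congrArg _ (funext fun X =>
    VertexKind.eval_comm (P.regular X) (Q.regular X) (f X) (hf X) (a X))

theorem tot_mul {P Q U : 𝔄.Rep} (f : ∀ X, Matrix (Fin (P.d X)) (Fin (Q.d X)) k)
    (g : ∀ X, Matrix (Fin (Q.d X)) (Fin (U.d X)) k) :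
    (mulPairing P Q U).β (tot f) (tot g) = tot fun X => f X * g X :=
  (Matrix.blockDiagonal'_mul f g).symm

theorem ρ_idem (P : 𝔄.Rep) (X : 𝔄.Vert) :
    P.ρ (𝔄.idem X) = Matrix.diagonal fun a => if a.1 = X then 1 else 0 := by
  have h : ∀ Y, (𝔄.kind Y).eval (P.W Y) (P.regular Y) (𝔄.idem X Y) =
      if Y = X then 1 else 0 := fun Y => by
    change (𝔄.kind Y).eval (P.W Y) (P.regular Y) (if Y = X then 1 else 0) = _
    split_ifs
    · exact map_one _
    · exact map_zero _
  rw [ρ_apply, funext h]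
  ext ⟨Y, i⟩ ⟨Z, j⟩
  rw [Matrix.blockDiagonal'_apply, Matrix.diagonal_apply]
  by_cases hYZ : Y = Z
  · subst hYZ
    by_cases hX : Y = X
    · simp [hX, Matrix.one_apply]
    · simp [hX]
  · simp [hYZ]

theorem toMat_idem {P Q : 𝔄.Rep} (X Y : 𝔄.Vert) (M : matMod P Q) (a : P.Idx) (b : Q.Idx) :
    toMat (act2 (matMod P Q) (𝔄.idem X ⊗ₜ 𝔄.idem Y) M) a b =
      if a.1 = X ∧ b.1 = Y then toMat M a b else 0 := by
  rw [act2_tmul, toMat_l, toMat_r, ρ_idem, ρ_idem, Matrix.diagonal_mul, Matrix.mul_diagonal]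
  split_ifs <;> simp_all

theorem toMat_ext {P Q : 𝔄.Rep} {M N : matMod P Q} (h : ∀ a b, toMat M a b = toMat N a b) :
    M = N := Matrix.ext h

theorem toMat_blk {P Q : 𝔄.Rep} {X Y : 𝔄.Vert} (C : Matrix (Fin (P.d X)) (Fin (Q.d Y)) k)
    (a : P.Idx) (b : Q.Idx) : toMat (blk C) a b = if h : a.1 = X ∧ b.1 = Y then
    C (Fin.cast (congrArg P.d h.1) a.2) (Fin.cast (congrArg Q.d h.2) b.2) else 0 := rfl

theorem act2_blk {P Q : 𝔄.Rep} {X Y : 𝔄.Vert} (C : Matrix (Fin (P.d X)) (Fin (Q.d Y)) k) :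
    act2 (matMod P Q) (𝔄.idem X ⊗ₜ 𝔄.idem Y) (blk C) = blk C :=
  toMat_ext fun a b => by
    rw [toMat_idem, toMat_blk]
    split_ifs <;> rfl

theorem unblk_blk {P Q : 𝔄.Rep} {X Y : 𝔄.Vert} (C : Matrix (Fin (P.d X)) (Fin (Q.d Y)) k) :
    unblk X Y (blk C) = C := by
  ext i j
  rw [unblk, Matrix.of_apply, toMat_blk, dif_pos ⟨rfl, rfl⟩]
  rfl

theorem blk_unblk {P Q : 𝔄.Rep} (X Y : 𝔄.Vert) (M : matMod P Q) :
    blk (unblk X Y M) = act2 (matMod P Q) (𝔄.idem X ⊗ₜ 𝔄.idem Y) M :=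
  toMat_ext fun a b => by
    rw [toMat_idem, toMat_blk]
    split_ifs with h
    · obtain ⟨X', i⟩ := a
      obtain ⟨Y', j⟩ := b
      obtain ⟨h1, h2⟩ := h
      dsimp only at h1 h2
      subst h1 h2
      rfl
    · rfl

theorem part_add {P Q : 𝔄.Rep} (M N : Fin 𝔄.t → Fin 𝔄.t → matMod P Q) :
    part (fun p q => M p q + N p q) = part M + part N := by
  ext x y
  simp [part]

theorem part_sum {P Q : 𝔄.Rep} {ι : Type} [Fintype ι]
    (M : ι → Fin 𝔄.t → Fin 𝔄.t → matMod P Q) :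
    part (fun p q => ∑ j, M j p q) = ∑ j, part (M j) := by
  ext x y
  simp [part, Matrix.sum_apply]

theorem part_mul {P Q U : 𝔄.Rep} (M : Fin 𝔄.t → Fin 𝔄.t → matMod P Q)
    (N : Fin 𝔄.t → Fin 𝔄.t → matMod Q U)
    (hM : ∀ p q, (matMod P Q).r (𝔄.idem (𝔄.cls q)) (M p q) = M p q) :
    part M * part N = part fun p q => ∑ r, (mulPairing P Q U).β (M p r) (N r q) := by
  ext x y
  have h1 : (part M * part N) x y = ∑ r, ∑ j : Fin (Q.d (𝔄.cls r)),
      toMat (M x.1 r) x.idx ⟨𝔄.cls r, j⟩ * toMat (N r y.1) ⟨𝔄.cls r, j⟩ y.idx := by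
    rw [Matrix.mul_apply, Fintype.sum_sigma]
    rfl
  have h2 : part (fun p q => ∑ r, (mulPairing P Q U).β (M p r) (N r q)) x y =
      ∑ r, ∑ b, toMat (M x.1 r) x.idx b * toMat (N r y.1) b y.idx := by
    rw [part, Matrix.of_apply, map_sum, Matrix.sum_apply]
    refine Finset.sum_congr rfl fun r _ => ?_
    rw [mulPairing_apply, toMat_ofMat, Matrix.mul_apply]
  rw [h1, h2]
  refine Finset.sum_congr rfl fun r _ => ?_
  rw [Fintype.sum_sigma, Finset.sum_eq_single (𝔄.cls r)]
  · intro X _ hX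
    refine Finset.sum_eq_zero fun j _ => ?_
    rw [← hM x.1 r, toMat_r, ρ_idem, Matrix.mul_diagonal, if_neg hX, mul_zero, zero_mul]
  · simp

theorem homMat_eq {P Q : 𝔄.Rep} (f : ∀ X, Matrix (Fin (P.d X)) (Fin (Q.d X)) k)
    (fv : ∀ j, Matrix (Fin (P.d (𝔄.vsrc j))) (Fin (Q.d (𝔄.vtgt j))) k) :
    homMat f fv = part (𝔄.formal (matMod P Q) (tot f) fun j => blk (fv j)) := by
  have h1 : (Matrix.blockDiagonal' fun p => f (𝔄.cls p)) = part fun p q =>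
      if p = q then (matMod P Q).l (𝔄.idem (𝔄.cls p)) (tot f) else 0 := by
    ext ⟨p, i⟩ ⟨q, j⟩
    rw [Matrix.blockDiagonal'_apply, part, Matrix.of_apply]
    by_cases h : p = q
    · subst h
      rw [dif_pos rfl, if_pos rfl, toMat_l, ρ_idem, Matrix.diagonal_mul]
      refine Eq.trans ?_ (congrArg (· * _) (if_pos rfl).symm)
      refine Eq.trans ?_ (one_mul _).symm
      exact (Matrix.blockDiagonal'_apply_eq f (𝔄.cls p) i j).symm
    · rw [dif_neg h, if_neg h, map_zero]
      rfl
  unfold homMat star MatrixBimoduleProblem.formal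
  rw [h1, part_add, part_sum]

theorem formal_idem {P Q : 𝔄.Rep} (f : ∀ X, Matrix (Fin (P.d X)) (Fin (Q.d X)) k)
    (hf : ∀ X, P.W X * f X = f X * Q.W X) (v : Fin 𝔄.m → matMod P Q) (p q : Fin 𝔄.t) :
    (matMod P Q).r (𝔄.idem (𝔄.cls q)) (𝔄.formal (matMod P Q) (tot f) v p q) =
      𝔄.formal (matMod P Q) (tot f) v p q := by
  rw [formal, map_add, map_sum]
  congr 1
  · split_ifs with h
    · subst h
      rw [← (matMod P Q).comm, ← tot_central f hf, ← (matMod P Q).l_mul, idem_mul_self]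
    · rw [map_zero]
  · exact Finset.sum_congr rfl fun j _ => by rw [← act2_inr, 𝔄.V_idem']

/-- The blocks of the product of two morphisms at the `v_l`:
`(f g)(v_l) = f_X g(v_l) + f(v_l) g_Y + ∑ γ_ijl (f(v_i) g(v_j))`. -/
def compV {P Q U : 𝔄.Rep} (f : ∀ X, Matrix (Fin (P.d X)) (Fin (Q.d X)) k)
    (fv : ∀ j, Matrix (Fin (P.d (𝔄.vsrc j))) (Fin (Q.d (𝔄.vtgt j))) k)
    (g : ∀ X, Matrix (Fin (Q.d X)) (Fin (U.d X)) k)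
    (gv : ∀ j, Matrix (Fin (Q.d (𝔄.vsrc j))) (Fin (U.d (𝔄.vtgt j))) k) (l : Fin 𝔄.m) :
    Matrix (Fin (P.d (𝔄.vsrc l))) (Fin (U.d (𝔄.vtgt l))) k :=
  unblk (𝔄.vsrc l) (𝔄.vtgt l) ((mulPairing P Q U).tupMul 𝔄.γ (tot f) (fun j => blk (fv j))
    (tot g) (fun j => blk (gv j)) l)

theorem blk_compV {P Q U : 𝔄.Rep} (f : ∀ X, Matrix (Fin (P.d X)) (Fin (Q.d X)) k)
    (fv : ∀ j, Matrix (Fin (P.d (𝔄.vsrc j))) (Fin (Q.d (𝔄.vtgt j))) k)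
    (g : ∀ X, Matrix (Fin (Q.d X)) (Fin (U.d X)) k)
    (gv : ∀ j, Matrix (Fin (Q.d (𝔄.vsrc j))) (Fin (U.d (𝔄.vtgt j))) k)
    (hf : ∀ X, P.W X * f X = f X * Q.W X) (hg : ∀ X, Q.W X * g X = g X * U.W X) (l : Fin 𝔄.m) :
    blk (compV f fv g gv l) = (mulPairing P Q U).tupMul 𝔄.γ (tot f) (fun j => blk (fv j))
      (tot g) (fun j => blk (gv j)) l := by
  rw [compV, blk_unblk]
  exact 𝔄.act2_tupMul (mulPairing P Q U) _ _ _ _ (tot_central f hf) (tot_central g hg)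
    (fun j => act2_blk (fv j)) (fun j => act2_blk (gv j)) l

theorem homMat_comp {P Q U : 𝔄.Rep} (f : ∀ X, Matrix (Fin (P.d X)) (Fin (Q.d X)) k)
    (fv : ∀ j, Matrix (Fin (P.d (𝔄.vsrc j))) (Fin (Q.d (𝔄.vtgt j))) k)
    (g : ∀ X, Matrix (Fin (Q.d X)) (Fin (U.d X)) k)
    (gv : ∀ j, Matrix (Fin (Q.d (𝔄.vsrc j))) (Fin (U.d (𝔄.vtgt j))) k)
    (hf : ∀ X, P.W X * f X = f X * Q.W X) (hg : ∀ X, Q.W X * g X = g X * U.W X) :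
    homMat (fun X => f X * g X) (compV f fv g gv) = homMat f fv * homMat g gv := by
  rw [homMat_eq, homMat_eq, homMat_eq, part_mul _ _ (formal_idem f hf _)]
  congr 1
  funext p q
  rw [𝔄.formal_mul (mulPairing P Q U) _ _ _ _ (tot_central f hf) (tot_central g hg), tot_mul]
  congr 1
  funext l
  exact blk_compV f fv g gv hf hg l

theorem blk_zero {P Q : 𝔄.Rep} {X Y : 𝔄.Vert} :
    blk (0 : Matrix (Fin (P.d X)) (Fin (Q.d Y)) k) = 0 := by
  refine toMat_ext fun a b => ?_
  rw [toMat_blk]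
  split_ifs <;> rfl

/-- The identity morphism. -/
def Hom.one (P : 𝔄.Rep) : Hom P P where
  f _ := 1
  fv _ := 0
  comm_W X := by rw [Matrix.mul_one, Matrix.one_mul]
  comm_mat := by
    have h : homMat (fun X => (1 : Matrix (Fin (P.d X)) (Fin (P.d X)) k))
        (fun j => (0 : Matrix (Fin (P.d (𝔄.vsrc j))) (Fin (P.d (𝔄.vtgt j))) k)) = 1 := by
      have h0 : ∀ j, star (0 : Matrix (Fin (P.d (𝔄.vsrc j))) (Fin (P.d (𝔄.vtgt j))) k)
          (𝔄.V j) = 0 := fun j => by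
        ext x y
        rw [star, part, Matrix.of_apply, blk_zero, map_zero, map_zero]
        rfl
      simp only [homMat, h0, Finset.sum_const_zero, add_zero]
      exact Matrix.blockDiagonal'_one
    rw [h, Matrix.mul_one, Matrix.one_mul]

/-- The composite of `f` and `g` (in this order) is the product of the matrices. -/
def Hom.mul {P Q U : 𝔄.Rep} (f : Hom P Q) (g : Hom Q U) : Hom P U where
  f X := f.f X * g.f X
  fv := compV f.f f.fv g.f g.fv
  comm_W X := by
    rw [← Matrix.mul_assoc, f.comm_W, Matrix.mul_assoc, g.comm_W, Matrix.mul_assoc]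
  comm_mat := by
    rw [homMat_comp _ _ _ _ f.comm_W g.comm_W, ← Matrix.mul_assoc, f.comm_mat, Matrix.mul_assoc,
      g.comm_mat, Matrix.mul_assoc]

theorem mulPairing_one_left {P Q : 𝔄.Rep} (M : matMod P Q) :
    (mulPairing P P Q).β (tot fun _ => 1) M = M :=
  (congrArg (fun N => ofMat (N * toMat M)) Matrix.blockDiagonal'_one).trans
    (congrArg ofMat (Matrix.one_mul _))

theorem mulPairing_one_right {P Q : 𝔄.Rep} (M : matMod P Q) :
    (mulPairing P Q Q).β M (tot fun _ => 1) = M :=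
  (congrArg (fun N => ofMat (toMat M * N)) Matrix.blockDiagonal'_one).trans
    (congrArg ofMat (Matrix.mul_one _))

/-- The representation category `R(𝔄)` of a matrix bimodule problem. -/
instance : Category.{u} 𝔄.Rep where
  Hom := Hom
  id := Hom.one
  comp := Hom.mul
  id_comp {P Q} f := by
    refine Hom.ext (funext fun X => Matrix.one_mul _) (funext fun l => ?_)
    change compV (fun _ => 1) (fun _ => 0) f.f f.fv l = f.fv l
    simp only [compV, Pairing.tupMul, blk_zero, map_zero, LinearMap.zero_apply,
      Finset.sum_const_zero, add_zero, mulPairing_one_left, unblk_blk]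
  comp_id {P Q} f := by
    refine Hom.ext (funext fun X => Matrix.mul_one _) (funext fun l => ?_)
    change compV f.f f.fv (fun _ => 1) (fun _ => 0) l = f.fv l
    simp only [compV, Pairing.tupMul, blk_zero, map_zero,
      Finset.sum_const_zero, add_zero, zero_add, mulPairing_one_right, unblk_blk]
  assoc {P Q U V} f g h := by
    refine Hom.ext (funext fun X => Matrix.mul_assoc _ _ _) (funext fun l => ?_)
    change compV (fun X => f.f X * g.f X) (compV f.f f.fv g.f g.fv) h.f h.fv l =
      compV f.f f.fv (fun X => g.f X * h.f X) (compV g.f g.fv h.f h.fv) l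
    rw [compV, compV]
    simp only [blk_compV _ _ _ _ f.comm_W g.comm_W, blk_compV _ _ _ _ g.comm_W h.comm_W,
      ← tot_mul]
    congr 1
    exact tupMul_assoc (mulPairing P Q U) (mulPairing P U V) (mulPairing Q U V)
      (mulPairing P Q V) 𝔄.γ 𝔄.gamma_assoc (fun u v w => congrArg ofMat (Matrix.mul_assoc _ _ _))
      _ _ _ _ _ _ (tot_central _ f.comm_W) (tot_central _ g.comm_W) (tot_central _ h.comm_W) l

end Rep

end MatrixBimoduleProblem

end

/-! Morphisms on both sides turn out to be the same thing, namely bimodule maps from `Ω` to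
matrices. A representation `P` of the problem defines a `Γ`-module of row vectors: `R` acts through
the regular matrices, and `a_l` through the block `P(a_l)`. For two such modules, a `Γ`-linear map
`P ⊗ Ω → Q` is the same as a `Γ`-`Γ`-bimodule map from `Ω` to `Hom_k(P, Q)`, that is, to `matΓ P Q`
(`ofΩ_injective`, `ofΩ_surjective`). Since `Ω` is a quotient of `Γ ⊗_R C ⊗_R Γ`, this is an
`R`-`R`-bimodule map `C → matΓ P Q` whose extension kills the image of `κ`. A bimodule map out of
`C` is determined by the image of `e`, a matrix that commutes with `R`, and by the images of the
`v_j`, each concentrated in a single block. A matrix commutes with `R` exactly if it is block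
diagonal with blocks `f_X` that satisfy `W_X f_X = f_X W'_X` (`eq_tot`, `ρ_mul_tot`, `tot_central`).
So the data `f_X`, `f(v_j)` of a morphism of `R(𝔄)` appear.

The remaining condition is `P f = f Q`. Let `F` be the formal matrix `∑ e_X * E_X + ∑ v_j * V_j`,
and let `Θ = H + ∑ a_l * A_l`, a matrix over `Γ`. By `commutator_Θ` the matrix `F Θ - Θ F` is the
combination of the `A_l` with coefficients `kap l`, and by `hom_κ` these coefficients, cut down by
the idempotents, are the images of `κ(a_l)`. The `A_l` form a normalized basis, so that each
coefficient can be read off at a leading position. Hence `κ` is killed if and only if `F Θ = Θ F`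
holds for the matrices. There `Θ` specializes to the partitioned matrices of `P` and `Q` (`mat_eq`),
and `F` to that of `f` (`homMat_eq`). This proves that `Hom.onΩ` is bijective. Composites and
identities correspond, because the comultiplication and the composition of `R(𝔄)` have the same
structure constants `γ` (`onΩ_mul`, `onΩ_one`). The resulting functor is therefore fully faithful.

It is essentially surjective by linear algebra. A finite-dimensional `Γ`-module is a
finite-dimensional `R`-module with an action of `N`. The idempotents of `R` split it into modules
over the `R_X` (`exists_linearEquiv_pi`). At a non-trivial vertex the variable acts by an
endomorphism on which `φ_X` is invertible. The endomorphism has a Weyr matrix in a suitable basis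
(`exists_isWeyr_basis`), and `φ_X` does not vanish at the eigenvalues. The Weyr form comes from the
Jordan form by reordering the basis: first by the depth in a chain, then by the chain, with longer
chains first. Finally `a_l` acts by a single block, because it is fixed by its idempotents. -/

noncomputable section

/-! ### Homomorphisms from tensor algebras of bimodules -/

namespace BiMod

variable {k : Type u} [Field k] {R : Type u} [CommRing R] [Algebra k R]

/-- The universal property of the tensor algebra of a bimodule. -/
def TensAlg.lift {N : BiMod k R R} {S : Type u} [Ring S] [Algebra k S] (f : R →ₐ[k] S)
    (g : N →ₗ[k] S) (hl : ∀ a x, g (N.l a x) = f a * g x) (hr : ∀ a x, g (N.r a x) = g x * f a) :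
    TensAlg N →ₐ[k] S :=
  RingQuot.liftAlgHom k ⟨FreeAlgebra.lift k (Sum.elim f g), fun x y h => by
    induction h with
    | algebraMap c => simp
    | add a b => simp
    | mul a b => simp
    | addN x y => simp
    | smulN c x => simp
    | lN a x => simp [hl]
    | rN a x => simp [hr]⟩

theorem TensAlg.lift_incl {N : BiMod k R R} {S : Type u} [Ring S] [Algebra k S] (f : R →ₐ[k] S)
    (g : N →ₗ[k] S) (hl : ∀ a x, g (N.l a x) = f a * g x) (hr : ∀ a x, g (N.r a x) = g x * f a)
    (a : R) : TensAlg.lift f g hl hr (TensAlg.incl N a) = f a :=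
  (RingQuot.liftAlgHom_mkAlgHom_apply _ _ _ _).trans (FreeAlgebra.lift_ι_apply _ _)

theorem TensAlg.lift_inclN {N : BiMod k R R} {S : Type u} [Ring S] [Algebra k S] (f : R →ₐ[k] S)
    (g : N →ₗ[k] S) (hl : ∀ a x, g (N.l a x) = f a * g x) (hr : ∀ a x, g (N.r a x) = g x * f a)
    (x : N) : TensAlg.lift f g hl hr (TensAlg.inclN N x) = g x :=
  (RingQuot.liftAlgHom_mkAlgHom_apply _ _ _ _).trans (FreeAlgebra.lift_ι_apply _ _)

/-- The tensor algebra is generated by the images of `R` and `N`. -/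
theorem TensAlg.algHom_ext {N : BiMod k R R} {S : Type u} [Ring S] [Algebra k S]
    {f g : TensAlg N →ₐ[k] S} (h : ∀ a, f (TensAlg.incl N a) = g (TensAlg.incl N a))
    (hN : ∀ x, f (TensAlg.inclN N x) = g (TensAlg.inclN N x)) : f = g := by
  refine RingQuot.ringQuot_ext' k f g (FreeAlgebra.hom_ext (funext fun x => ?_))
  cases x with
  | inl a => exact h a
  | inr x => exact hN x

end BiMod

/-! ### The functor from `R(𝔄)` to `R(𝔅)` -/

namespace MatrixBimoduleProblem

open BiMod Slot

/-- The formal matrix is built from its arguments by bimodule operations only. This allows passing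
between `matΓ P Q`, restricted to `R`, and `matMod P Q`. -/
theorem formal_map {k : Type u} [Field k] (𝔄 : MatrixBimoduleProblem k)
    {M M' : BiMod k 𝔄.R 𝔄.R} (f : BiMod.Hom M M')
    (e : M) (v : Fin 𝔄.m → M) (p q : Fin 𝔄.t) :
    f.toLin (𝔄.formal M e v p q) = 𝔄.formal M' (f.toLin e) (fun j => f.toLin (v j)) p q := by
  simp only [formal, map_add, map_sum, Hom.map_act2]
  split_ifs
  · rw [f.map_l]
  · rw [map_zero]

namespace Rep

variable {k : Type u} [Field k] [IsAlgClosed k] {𝔄 : MatrixBimoduleProblem k}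

/-- The homomorphism `ρ` of algebras. -/
def ρAlg (P : 𝔄.Rep) : 𝔄.R →ₐ[k] Matrix P.Idx P.Idx k :=
  AlgHom.ofLinearMap P.ρ P.ρ_one P.ρ_mul

/-- The action of the bimodule `N`: the basis element `a_l` acts by the matrix `P(a_l)`. -/
def ρN (P : 𝔄.Rep) : BiMod.Hom 𝔄.N (matMod P P) := quasiFree.lift 𝔄.aIdem fun l => blk (P.P l)

theorem ρN_a (P : 𝔄.Rep) (l : Fin 𝔄.n) : P.ρN.toLin (𝔄.a l) = blk (P.P l) :=
  (quasiFree.lift_gen 𝔄.aIdem_mul_self _ l).trans (act2_blk _)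

/-- The action of `Γ` on row vectors. -/
def ρΓ (P : 𝔄.Rep) : 𝔄.Γ →ₐ[k] Matrix P.Idx P.Idx k :=
  TensAlg.lift P.ρAlg (toMat ∘ₗ P.ρN.toLin) (fun a x => P.ρN.map_l a x)
    (fun a x => P.ρN.map_r a x)

theorem ρΓ_inc (P : 𝔄.Rep) (a : 𝔄.R) : P.ρΓ (𝔄.inc a) = P.ρ a := TensAlg.lift_incl _ _ _ _ a

theorem ρΓ_inclN (P : 𝔄.Rep) (x : 𝔄.N) :
    P.ρΓ (TensAlg.inclN 𝔄.N x) = toMat (P.ρN.toLin x) := TensAlg.lift_inclN _ _ _ _ x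

/-- The `Γ`-`Γ`-bimodule of matrices with rows indexed by `P` and columns indexed by `Q`. -/
def matΓ (P Q : 𝔄.Rep) : BiMod k 𝔄.Γ 𝔄.Γ where
  carrier := Matrix P.Idx Q.Idx k
  l := LinearMap.mk₂ k (fun a M => P.ρΓ a * M)
    (by intros; rw [map_add, Matrix.add_mul]) (by intros; rw [map_smul, Matrix.smul_mul])
    (by intros; rw [Matrix.mul_add]) (by intros; rw [Matrix.mul_smul])
  r := LinearMap.mk₂ k (fun a M => M * Q.ρΓ a)
    (by intros; rw [map_add, Matrix.mul_add]) (by intros; rw [map_smul, Matrix.mul_smul])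
    (by intros; rw [Matrix.add_mul]) (by intros; rw [Matrix.smul_mul])
  l_one M := by simp
  l_mul a b M := by simp [Matrix.mul_assoc]
  r_one M := by simp
  r_mul a b M := by simp [Matrix.mul_assoc]
  comm a b M := by simp [Matrix.mul_assoc]

/-- Restriction along `R → Γ` gives the bimodule `matMod P Q`. -/
def toMatMod (P Q : 𝔄.Rep) : BiMod.Hom (res 𝔄.inc 𝔄.inc (matΓ P Q)) (matMod P Q) where
  toLin := LinearMap.id (M := Matrix P.Idx Q.Idx k)
  map_l a M := congrArg (fun A => ofMat (P := P) (Q := Q) (A * toMat (P := P) (Q := Q) M))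
    (P.ρΓ_inc a)
  map_r a M := congrArg (fun A => ofMat (P := P) (Q := Q) (toMat (P := P) (Q := Q) M * A))
    (Q.ρΓ_inc a)

/-- The inverse of `toMatMod`. -/
def ofMatMod (P Q : 𝔄.Rep) : BiMod.Hom (matMod P Q) (res 𝔄.inc 𝔄.inc (matΓ P Q)) where
  toLin := LinearMap.id (M := Matrix P.Idx Q.Idx k)
  map_l a M := ((toMatMod P Q).map_l a M).symm
  map_r a M := ((toMatMod P Q).map_r a M).symm

/-! ### The value of `Θ` at a representation, and the equation `P f = f Q` block by block -/

theorem ρΓ_Θ (P : 𝔄.Rep) (p q : Fin 𝔄.t) :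
    (ofMat (P.ρΓ (𝔄.Θ p q)) : matMod P P) =
      ofMat (P.ρ (𝔄.H p q)) + ∑ l, act2 (matMod P P) (𝔄.A2 l p q) (blk (P.P l)) := by
  have h : P.ρN.toLin (𝔄.formalA 𝔄.a p q) =
      ∑ l, act2 (matMod P P) (𝔄.A2 l p q) (blk (P.P l)) := by
    simp only [formalA, map_sum, Hom.map_act2, ρN_a]
  rw [Θ, map_add, ρΓ_inc, ρΓ_inclN, h]
  rfl

/-- `Θ` is the generic partitioned matrix over `Γ`, of which every representation is a
specialization. This links the relations of `Ω`, which are commutators with `Θ`, to the defining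
equation of the morphisms of `R(𝔄)`. -/
theorem mat_eq (P : 𝔄.Rep) : P.mat = part fun p q => (ofMat (P.ρΓ (𝔄.Θ p q)) : matMod P P) := by
  simp only [ρΓ_Θ]
  rw [part_add, part_sum]
  rfl

/-- The block at `(p, q)` has its columns in the class of `q`. A statement of this kind is what
`part_mul` needs, since a partitioned matrix sums only over those columns. -/
theorem ρΓ_Θ_r (P : 𝔄.Rep) (p q : Fin 𝔄.t) :
    (matMod P P).r (𝔄.idem (𝔄.cls q)) (ofMat (P.ρΓ (𝔄.Θ p q))) = ofMat (P.ρΓ (𝔄.Θ p q)) := by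
  rw [ρΓ_Θ, map_add, map_sum]
  congr 1
  · refine congrArg ofMat ((P.ρ_mul _ _).symm.trans (congrArg P.ρ ?_))
    -- `H_idem` provides only the idempotent of the row. It is also that of the column, unless the
    -- entry vanishes by `H_supp`.
    by_cases h : 𝔄.cls p = 𝔄.cls q
    · rw [mul_comm, ← h]
      exact 𝔄.H_idem p q
    · rw [𝔄.H_supp p q h, zero_mul]
  · exact Finset.sum_congr rfl fun l _ => by rw [← act2_inr, 𝔄.A2_idem]

theorem ρΓ_Θ_l (P : 𝔄.Rep) (p q : Fin 𝔄.t) :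
    (matMod P P).l (𝔄.idem (𝔄.cls p)) (ofMat (P.ρΓ (𝔄.Θ p q))) = ofMat (P.ρΓ (𝔄.Θ p q)) := by
  rw [ρΓ_Θ, map_add, map_sum]
  congr 1
  · exact congrArg ofMat ((P.ρ_mul _ _).symm.trans (congrArg P.ρ (𝔄.H_idem p q)))
  · exact Finset.sum_congr rfl fun l _ => by rw [← act2_inl, 𝔄.idem_A2]

/-- The counterpart of `formal_idem` for the rows. Centrality of `e` is not needed here, as the
idempotent already stands to the left of `e` in the formal matrix. -/
theorem idem_formal {P Q : 𝔄.Rep} (e : matMod P Q)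
    (v : Fin 𝔄.m → matMod P Q) (p q : Fin 𝔄.t) :
    (matMod P Q).l (𝔄.idem (𝔄.cls p)) (𝔄.formal (matMod P Q) e v p q) =
      𝔄.formal (matMod P Q) e v p q := by
  rw [formal, map_add, map_sum]
  congr 1
  · split_ifs with h
    · rw [← (matMod P Q).l_mul, idem_mul_self]
    · rw [map_zero]
  · exact Finset.sum_congr rfl fun j _ => by rw [← act2_inl, 𝔄.idem_V]

/-- A partitioned matrix shows only those entries of `M p q` whose row belongs to the class of `p`
and whose column belongs to the class of `q`. The hypotheses on the idempotents say that all other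
entries vanish, so nothing is lost. -/
theorem part_injective {P Q : 𝔄.Rep} {M N : Fin 𝔄.t → Fin 𝔄.t → matMod P Q}
    (hMl : ∀ p q, (matMod P Q).l (𝔄.idem (𝔄.cls p)) (M p q) = M p q)
    (hMr : ∀ p q, (matMod P Q).r (𝔄.idem (𝔄.cls q)) (M p q) = M p q)
    (hNl : ∀ p q, (matMod P Q).l (𝔄.idem (𝔄.cls p)) (N p q) = N p q)
    (hNr : ∀ p q, (matMod P Q).r (𝔄.idem (𝔄.cls q)) (N p q) = N p q)
    (h : part M = part N) (p q : Fin 𝔄.t) : M p q = N p q := by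
  refine toMat_ext fun a b => ?_
  rw [← hMl, ← hMr, ← hNl, ← hNr, ← act2_tmul, ← act2_tmul, toMat_idem, toMat_idem]
  split_ifs with hab
  · obtain ⟨X, i⟩ := a
    obtain ⟨Y, j⟩ := b
    obtain ⟨h1, h2⟩ := hab
    dsimp only at h1 h2
    subst h1 h2
    exact congrFun (congrFun h (⟨p, i⟩ : P.Pos)) (⟨q, j⟩ : Q.Pos)
  · rfl

theorem mat_mul_homMat {P Q : 𝔄.Rep} (f : ∀ X, Matrix (Fin (P.d X)) (Fin (Q.d X)) k)
    (fv : ∀ j, Matrix (Fin (P.d (𝔄.vsrc j))) (Fin (Q.d (𝔄.vtgt j))) k) :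
    P.mat * homMat f fv = part fun p q => ∑ r, (mulPairing P P Q).β (ofMat (P.ρΓ (𝔄.Θ p r)))
      (𝔄.formal (matMod P Q) (tot f) (fun j => blk (fv j)) r q) := by
  rw [mat_eq, homMat_eq, part_mul _ _ P.ρΓ_Θ_r]

theorem homMat_mul_mat {P Q : 𝔄.Rep} (f : ∀ X, Matrix (Fin (P.d X)) (Fin (Q.d X)) k)
    (fv : ∀ j, Matrix (Fin (P.d (𝔄.vsrc j))) (Fin (Q.d (𝔄.vtgt j))) k)
    (hf : ∀ X, P.W X * f X = f X * Q.W X) :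
    homMat f fv * Q.mat = part fun p q => ∑ r, (mulPairing P Q Q).β
      (𝔄.formal (matMod P Q) (tot f) (fun j => blk (fv j)) p r) (ofMat (Q.ρΓ (𝔄.Θ r q))) := by
  rw [mat_eq, homMat_eq, part_mul _ _ (formal_idem f hf _)]

/-- Both products are partitioned matrices whose blocks are fixed by the idempotents of their rows
and columns, so they may be compared block by block. The right-hand side is the form in which the
equation meets `commutator_Θ`. -/
theorem comm_mat_iff {P Q : 𝔄.Rep} (f : ∀ X, Matrix (Fin (P.d X)) (Fin (Q.d X)) k)
    (fv : ∀ j, Matrix (Fin (P.d (𝔄.vsrc j))) (Fin (Q.d (𝔄.vtgt j))) k)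
    (hf : ∀ X, P.W X * f X = f X * Q.W X) :
    P.mat * homMat f fv = homMat f fv * Q.mat ↔
      ∀ p q, ∑ r, (mulPairing P P Q).β (ofMat (P.ρΓ (𝔄.Θ p r)))
        (𝔄.formal (matMod P Q) (tot f) (fun j => blk (fv j)) r q) =
      ∑ r, (mulPairing P Q Q).β
        (𝔄.formal (matMod P Q) (tot f) (fun j => blk (fv j)) p r) (ofMat (Q.ρΓ (𝔄.Θ r q))) := by
  rw [mat_mul_homMat, homMat_mul_mat f fv hf]
  refine ⟨fun h => part_injective ?_ ?_ ?_ ?_ h,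
    fun h => congrArg part (by ext1 p; ext1 q; exact h p q)⟩
  · intro p q
    rw [map_sum]
    exact Finset.sum_congr rfl fun r _ => by rw [← (mulPairing P P Q).left, ρΓ_Θ_l]
  · intro p q
    rw [map_sum]
    exact Finset.sum_congr rfl fun r _ => by rw [← (mulPairing P P Q).right, formal_idem f hf]
  · intro p q
    rw [map_sum]
    exact Finset.sum_congr rfl fun r _ => by rw [← (mulPairing P Q Q).left, idem_formal]
  · intro p q
    rw [map_sum]
    exact Finset.sum_congr rfl fun r _ => by rw [← (mulPairing P Q Q).right, ρΓ_Θ_r]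

end Rep

end MatrixBimoduleProblem

/-! ### Morphisms of `R(𝔄)` as bimodule maps from `Ω` to matrices -/

namespace MatrixBimoduleProblem

open BiMod Slot

namespace Rep

variable {k : Type u} [Field k] [IsAlgClosed k] {𝔄 : MatrixBimoduleProblem k}

/-- The bimodule map `C → matΓ P Q`, `e ↦ ∑ f_X`, `v_j ↦ f(v_j)`. -/
def Hom.onC {P Q : 𝔄.Rep} (f : Hom P Q) : BiMod.Hom 𝔄.C (res 𝔄.inc 𝔄.inc (matΓ P Q)) :=
  (ofMatMod P Q).comp (coMod.lift 𝔄.vIdem (tot f.f) (tot_central f.f f.comm_W)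
    fun j => blk (f.fv j))

theorem Hom.onC_e {P Q : 𝔄.Rep} (f : Hom P Q) :
    f.onC.toLin 𝔄.e = (ofMatMod P Q).toLin (tot f.f) :=
  congrArg (ofMatMod P Q).toLin (coMod.lift_one _ _ (tot_central f.f f.comm_W) _)

theorem Hom.onC_v {P Q : 𝔄.Rep} (f : Hom P Q) (j : Fin 𝔄.m) :
    f.onC.toLin (𝔄.v j) = (ofMatMod P Q).toLin (blk (f.fv j)) :=
  congrArg (ofMatMod P Q).toLin ((coMod.lift_gen _ 𝔄.vIdem_mul_self _
    (tot_central f.f f.comm_W) _ j).trans (act2_blk (f.fv j)))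

/-- The bimodule map `Ξ → matΓ P Q` defined by a morphism. -/
def Hom.onΞ {P Q : 𝔄.Rep} (f : Hom P Q) : BiMod.Hom 𝔄.Ξ (matΓ P Q) :=
  ind.lift 𝔄.inc (matΓ P Q) f.onC

theorem Hom.restr_onΞ {P Q : 𝔄.Rep} (f : Hom P Q) (c : 𝔄.C) :
    (𝔄.restr f.onΞ).toLin c = f.onC.toLin c := ind.lift_incl 𝔄.inc (matΓ P Q) f.onC c

theorem Hom.restr_onΞ_e {P Q : 𝔄.Rep} (f : Hom P Q) :
    (𝔄.restr f.onΞ).toLin 𝔄.e = (ofMatMod P Q).toLin (tot f.f) :=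
  (f.restr_onΞ 𝔄.e).trans f.onC_e

theorem Hom.restr_onΞ_v {P Q : 𝔄.Rep} (f : Hom P Q) (j : Fin 𝔄.m) :
    (𝔄.restr f.onΞ).toLin (𝔄.v j) = (ofMatMod P Q).toLin (blk (f.fv j)) :=
  (f.restr_onΞ (𝔄.v j)).trans (f.onC_v j)

/-- On `matΓ P Q` the algebra `Γ` acts from the left through `P` and from the right through `Q`. The
abstract commutator is thus the difference of the two matrix products, and the sides of the equation
are only swapped. -/
theorem commutator_eq_zero_iff {P Q : 𝔄.Rep} (e : matMod P Q) (v : Fin 𝔄.m → matMod P Q)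
    (p q : Fin 𝔄.t) :
    (∑ r, (matΓ P Q).r (𝔄.Θ r q) (𝔄.formal (res 𝔄.inc 𝔄.inc (matΓ P Q))
        ((ofMatMod P Q).toLin e) (fun j => (ofMatMod P Q).toLin (v j)) p r) -
      ∑ r, (matΓ P Q).l (𝔄.Θ p r) (𝔄.formal (res 𝔄.inc 𝔄.inc (matΓ P Q))
        ((ofMatMod P Q).toLin e) (fun j => (ofMatMod P Q).toLin (v j)) r q) = 0) ↔
    ∑ r, (mulPairing P P Q).β (ofMat (P.ρΓ (𝔄.Θ p r))) (𝔄.formal (matMod P Q) e v r q) =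
      ∑ r, (mulPairing P Q Q).β (𝔄.formal (matMod P Q) e v p r) (ofMat (Q.ρΓ (𝔄.Θ r q))) := by
  simp only [← formal_map]
  rw [sub_eq_zero, eq_comm]
  rfl

/-- The coefficients `kap l` attached to `f` combine with the `A_l` to the commutator with `Θ`,
which vanishes because `P f = f Q`. As the `A_l` are a normalized basis, each coefficient vanishes
after multiplication by its idempotent (`eq_zero_of_A2`), and this is the value at `κ(a_l)`. -/
theorem Hom.onΞ_κ {P Q : 𝔄.Rep} (f : Hom P Q) :
    ∀ s ∈ Set.range 𝔄.κ.toLin, f.onΞ.toLin s = 0 := by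
  refine 𝔄.hom_κ_eq_zero _ (𝔄.eq_zero_of_A2 _ _ fun p q => ?_)
  rw [Hom.restr_onΞ_e, funext f.restr_onΞ_v]
  refine (𝔄.commutator_Θ (matΓ P Q) _ _ (fun a => ?_) p q).symm.trans ?_
  · have h := congrArg (ofMatMod P Q).toLin (tot_central f.f f.comm_W a)
    rw [(ofMatMod P Q).map_l, (ofMatMod P Q).map_r] at h
    exact h
  · rw [commutator_eq_zero_iff]
    exact (comm_mat_iff f.f f.fv f.comm_W).1 f.comm_mat p q

/-- The bimodule map `Ω → matΓ P Q` defined by a morphism. -/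
def Hom.onΩ {P Q : 𝔄.Rep} (f : Hom P Q) : BiMod.Hom 𝔄.Ω (matΓ P Q) := quotLift f.onΞ f.onΞ_κ

theorem Hom.onΩ_e {P Q : 𝔄.Rep} (f : Hom P Q) :
    f.onΩ.toLin 𝔄.eΩ = (ofMatMod P Q).toLin (tot f.f) := f.restr_onΞ_e

theorem Hom.onΩ_v {P Q : 𝔄.Rep} (f : Hom P Q) (j : Fin 𝔄.m) :
    f.onΩ.toLin (𝔄.vΩ j) = (ofMatMod P Q).toLin (blk (f.fv j)) := f.restr_onΞ_v j

theorem tot_injective {P Q : 𝔄.Rep} :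
    Function.Injective (tot : (∀ X, Matrix (Fin (P.d X)) (Fin (Q.d X)) k) → matMod P Q) :=
  Matrix.blockDiagonal'_injective

theorem blk_injective {P Q : 𝔄.Rep} {X Y : 𝔄.Vert} :
    Function.Injective (blk : Matrix (Fin (P.d X)) (Fin (Q.d Y)) k → matMod P Q) :=
  Function.LeftInverse.injective (g := unblk X Y) unblk_blk

/-- The values at `e` and at the `v_j` are the block diagonal matrix of the `f_X` and the blocks
`f(v_j)`, from which `f` is recovered. -/
theorem Hom.onΩ_injective {P Q : 𝔄.Rep} :
    Function.Injective (Hom.onΩ : Hom P Q → BiMod.Hom 𝔄.Ω (matΓ P Q)) := fun f g h => by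
  refine Hom.ext (tot_injective ?_) (funext fun j => blk_injective ?_)
  · have := congrArg (fun φ => φ.toLin 𝔄.eΩ) h
    simp only [Hom.onΩ_e] at this
    exact this
  · have := congrArg (fun φ => φ.toLin (𝔄.vΩ j)) h
    simp only [Hom.onΩ_v] at this
    exact this

/-- The variable of `R_X`, as an element of `R`, if `X` is non-trivial. -/
def _root_.VertexKind.param : (v : VertexKind k) → v.Coeff
  | .trivial => (1 : k)
  | .nontrivial φ _ => algebraMap k[X] (Localization.Away φ) Polynomial.X

theorem _root_.VertexKind.evalAway_algebraMap {n : ℕ} (φ : k[X]) (hφ : φ ≠ 0)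
    (W : Matrix (Fin n) (Fin n) k) (h : ∀ c ∈ spectrum k W, φ.eval c ≠ 0) (p : k[X]) :
    VertexKind.evalAway φ hφ W h (algebraMap k[X] (Localization.Away φ) p) =
      Polynomial.aeval W p :=
  OreLocalization.universalHom_commutes (Polynomial.aeval W).toRingHom _
    (VertexKind.unitsHom_coe φ hφ W h)

/-- Putting the parameter equal to `1` at a trivial vertex makes the statement uniform, because the
regular matrix there is the identity. -/
theorem _root_.VertexKind.eval_param {n : ℕ} (W : Matrix (Fin n) (Fin n) k) (v : VertexKind k)
    (h : v.Regular W) : v.eval W h v.param = W := by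
  cases v with
  | trivial => exact (map_one (Algebra.ofId k (Matrix (Fin n) (Fin n) k))).trans h.symm
  | nontrivial φ hφ =>
    exact (VertexKind.evalAway_algebraMap φ hφ W h.2 _).trans (Polynomial.aeval_X W)

/-- A central matrix is block diagonal. -/
theorem eq_tot {P Q : 𝔄.Rep} (M : matMod P Q)
    (hM : ∀ a, (matMod P Q).l a M = (matMod P Q).r a M) : M = tot fun X => unblk X X M := by
  refine toMat_ext fun a b => ?_
  -- For a central `M` one has `1_X M = 1_X M 1_X`. Taking the vertex of the row `a` for `X`, the
  -- entry at `(a, b)` vanishes unless `b` belongs to the same vertex.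
  have h : ∀ X, (matMod P Q).l (𝔄.idem X) M =
      act2 (matMod P Q) (𝔄.idem X ⊗ₜ 𝔄.idem X) M := fun X => by
    rw [act2_tmul, ← hM, ← (matMod P Q).l_mul, idem_mul_self]
  have h' := congrArg (fun N => toMat N a b) (h a.1)
  beta_reduce at h'
  rw [toMat_idem, toMat_l, ρ_idem, Matrix.diagonal_mul, if_pos rfl, one_mul] at h'
  rw [h']
  obtain ⟨X, i⟩ := a
  obtain ⟨Y, j⟩ := b
  change _ = Matrix.blockDiagonal' (fun X => unblk X X M) ⟨X, i⟩ ⟨Y, j⟩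
  by_cases hXY : X = Y
  · subst hXY
    rw [Matrix.blockDiagonal'_apply_eq, if_pos ⟨rfl, rfl⟩]
    rfl
  · rw [Matrix.blockDiagonal'_apply_ne _ _ _ hXY, if_neg fun H => hXY H.2.symm]

/-- A converse of `tot_central`. It suffices to test centrality on the single element of `R` whose
components are the parameters, since it acts by the regular matrices themselves. -/
theorem ρ_mul_tot {P Q : 𝔄.Rep} (f : ∀ X, Matrix (Fin (P.d X)) (Fin (Q.d X)) k)
    (hf : ∀ a, (matMod P Q).l a (tot f) = (matMod P Q).r a (tot f)) (X : 𝔄.Vert) :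
    P.W X * f X = f X * Q.W X := by
  let x : 𝔄.R := fun X => (𝔄.kind X).param
  have h : P.ρ x * Matrix.blockDiagonal' f = Matrix.blockDiagonal' f * Q.ρ x := hf x
  rw [ρ_apply, ρ_apply, ← Matrix.blockDiagonal'_mul, ← Matrix.blockDiagonal'_mul] at h
  have := congrFun (Matrix.blockDiagonal'_injective h) X
  dsimp only [x] at this
  rwa [VertexKind.eval_param, VertexKind.eval_param] at this

/-- The argument for `Hom.onΞ_κ` read backwards. Centrality of `e` in `Ω` makes its image block
diagonal and compatible with the regular matrices. The idempotents of `v_j` confine its image to one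
block. As `κ` vanishes in `Ω`, the commutator with `Θ` vanishes, which is the equation `P f = f Q`.
-/
theorem Hom.onΩ_surjective {P Q : 𝔄.Rep} :
    Function.Surjective (Hom.onΩ : Hom P Q → BiMod.Hom 𝔄.Ω (matΓ P Q)) := fun φ => by
  have he : ∀ a, (matΓ P Q).l (𝔄.inc a) (φ.toLin 𝔄.eΩ) =
      (matΓ P Q).r (𝔄.inc a) (φ.toLin 𝔄.eΩ) := fun a => by
    rw [← φ.map_l, ← φ.map_r, eΩ_central]
  -- The images of the generators, kept opaque so that the two bimodule structures on the same
  -- matrices are exchanged only where this is intended.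
  obtain ⟨e, e_def⟩ : ∃ e, e = (toMatMod P Q).toLin (φ.toLin 𝔄.eΩ) := ⟨_, rfl⟩
  obtain ⟨v, v_def⟩ : ∃ v, v = fun j => (toMatMod P Q).toLin (φ.toLin (𝔄.vΩ j)) := ⟨_, rfl⟩
  have he' : ∀ a, (matMod P Q).l a e = (matMod P Q).r a e := fun a => by
    have h := congrArg (toMatMod P Q).toLin (he a)
    rw [e_def]
    exact ((toMatMod P Q).map_l a _).symm.trans (h.trans ((toMatMod P Q).map_r a _))
  have hv' : ∀ j, blk (unblk (𝔄.vsrc j) (𝔄.vtgt j) (v j)) = v j := fun j => by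
    rw [blk_unblk, v_def]
    have h := congrArg φ.toLin (𝔄.act2_vΩ j)
    exact (((toMatMod P Q).comp (φ.res 𝔄.inc)).map_act2 (𝔄.vIdem j) (𝔄.vΩ j)).symm.trans
      (congrArg (toMatMod P Q).toLin h)
  have htot := eq_tot e he'
  have hW : ∀ X, P.W X * unblk X X e = unblk X X e * Q.W X :=
    ρ_mul_tot _ (by rwa [← htot])
  have eq_e : (ofMatMod P Q).toLin e = φ.toLin 𝔄.eΩ := by rw [e_def]; rfl
  have eq_v : (fun j => (ofMatMod P Q).toLin (v j)) = fun j => φ.toLin (𝔄.vΩ j) := by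
    rw [v_def]; rfl
  refine ⟨⟨fun X => unblk X X e, fun j => unblk (𝔄.vsrc j) (𝔄.vtgt j) (v j), hW, ?_⟩, ?_⟩
  · rw [comm_mat_iff _ _ hW]
    intro p q
    rw [← htot, funext hv', ← commutator_eq_zero_iff, eq_e, eq_v]
    refine (𝔄.commutator_Θ (matΓ P Q) _ _ he p q).trans (Finset.sum_eq_zero fun l _ => ?_)
    have h : act2 (res 𝔄.inc 𝔄.inc (matΓ P Q)) (𝔄.aIdem l)
        (𝔄.kap (rightPairing 𝔄.N (matΓ P Q)) (leftPairing 𝔄.N (matΓ P Q)) (φ.toLin 𝔄.eΩ)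
          (fun j => φ.toLin (𝔄.vΩ j)) 𝔄.a l) = 0 := by
      refine (𝔄.hom_κ (φ.comp 𝔄.prΩ) l).symm.trans ?_
      exact (congrArg φ.toLin (quotMk_eq_zero _ _ ⟨_, rfl⟩)).trans (map_zero _)
    -- Only the product of the coefficient with its idempotent is known to vanish. The missing
    -- idempotent is split off from the entry of `A_l`.
    rw [← aIdem_A2, mul_comm, act2_mul, h, map_zero]
  · refine 𝔄.Ω_ext ?_ fun j => ?_
    · rw [Hom.onΩ_e]
      exact (congrArg _ htot.symm).trans eq_e
    · rw [Hom.onΩ_v]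
      exact (congrArg _ (hv' j)).trans (congrFun eq_v j)

/-- The product of matrices, as a bimodule map. -/
def mulΓ (P Q U : 𝔄.Rep) : BiMod.Hom (tens (matΓ P Q) (matΓ Q U)) (matΓ P U) :=
  tensLift (mulPairing P Q U).β (fun _ _ _ => Matrix.mul_assoc _ _ _)
    (fun _ _ _ => Matrix.mul_assoc _ _ _) (fun _ _ _ => (Matrix.mul_assoc _ _ _).symm)

theorem mulΓ_tmul {P Q U : 𝔄.Rep} (M : matΓ P Q) (N : matΓ Q U) :
    (mulΓ P Q U).toLin (tmul (matΓ P Q) (matΓ Q U) M N) = (mulPairing P Q U).β M N :=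
  tensLift_tmul _ _ _ _ _ _

/-- It suffices to compare values at `e` and at the `v_l`. There the comultiplication gives `e ⊗ e`
and the product of families with structure constants `γ`. The composite of morphisms is defined by
the same formula, with the matrix product in place of the tensor product. -/
theorem onΩ_mul {P Q U : 𝔄.Rep} (f : Hom P Q) (g : Hom Q U) :
    (f.mul g).onΩ = ((mulΓ P Q U).comp (tensMap f.onΩ g.onΩ)).comp 𝔄.comulΩ := by
  refine 𝔄.Ω_ext ?_ fun l => ?_
  · rw [Hom.comp_apply, Hom.comp_apply, comulΩ_e, tensMap_tmul, mulΓ_tmul]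
    simp only [Hom.onΩ_e]
    exact congrArg (ofMatMod P U).toLin (tot_mul f.f g.f).symm
  · rw [Hom.comp_apply, Hom.comp_apply, comulΩ_v, resPairing_tupMul_map]
    simp only [Hom.onΩ_e, Hom.onΩ_v]
    refine (congrArg (ofMatMod P U).toLin (blk_compV f.f f.fv g.f g.fv f.comm_W g.comm_W l)).trans
      ?_
    symm
    -- Matrix multiplication carries the tensor pairing to `mulPairing`, and so it carries products
    -- of families to products of families.
    exact (resPairing 𝔄.inc (matΓ P Q) (matΓ Q U)).tupMul_map (mulPairing P Q U) (toMatMod P Q)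
      (toMatMod Q U) ((toMatMod P U).comp ((mulΓ P Q U).res 𝔄.inc)) (fun m n => mulΓ_tmul m n)
      𝔄.γ _ _ _ _ l

/-- Both the identity morphism and the counit followed by `ρΓ` take `e` to `1` and every `v_j` to
`0`. -/
theorem onΩ_one (P : 𝔄.Rep) (w : 𝔄.Ω) :
    toMat ((toMatMod P P).toLin ((Hom.one P).onΩ.toLin w)) = P.ρΓ (𝔄.counitΩ.toLin w) := by
  -- The representation, as a bimodule map, so that `Ω_ext` applies to its composite with the
  -- counit.
  let r : BiMod.Hom (reg k 𝔄.Γ) (matΓ P P) := ⟨P.ρΓ.toLinearMap,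
    fun a b => map_mul P.ρΓ a (show 𝔄.Γ from b), fun a b => map_mul P.ρΓ (show 𝔄.Γ from b) a⟩
  have h : (Hom.one P).onΩ = r.comp 𝔄.counitΩ := by
    refine 𝔄.Ω_ext ?_ fun l => ?_
    · rw [Hom.comp_apply, counitΩ_e, Hom.onΩ_e]
      exact Matrix.blockDiagonal'_one.trans (map_one P.ρΓ).symm
    · rw [Hom.comp_apply, counitΩ_v, Hom.onΩ_v, map_zero]
      exact (congrArg (ofMatMod P P).toLin blk_zero).trans (map_zero _)
  rw [h]
  rfl

end Rep

end MatrixBimoduleProblem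

namespace MatrixBimoduleProblem

open BiMod Slot

namespace Rep

variable {k : Type u} [Field k] [IsAlgClosed k] {𝔄 : MatrixBimoduleProblem k}

/-! #### Row vectors -/

/-- The `Γ`-module of row vectors. -/
def vecMod (P : 𝔄.Rep) : BiMod k k 𝔄.Γ where
  carrier := P.Idx → k
  l := (LinearMap.lsmul k (P.Idx → k) : k →ₗ[k] (P.Idx → k) →ₗ[k] P.Idx → k)
  r := LinearMap.mk₂ k (fun a x => Matrix.vecMul x (P.ρΓ a))
    (by intros; rw [map_add, Matrix.vecMul_add]) (by intros; rw [map_smul, Matrix.vecMul_smul])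
    (by intros; rw [Matrix.add_vecMul]) (by intros; rw [Matrix.smul_vecMul])
  l_one x := by simp
  l_mul a b x := mul_smul a b x
  r_one x := by simp
  r_mul a b x := by simp
  comm a b x := by simp

/-- A row vector, as an element of `vecMod P`. -/
def ofVec {P : 𝔄.Rep} (x : P.Idx → k) : vecMod P := x

/-- An element of `vecMod P`, as a row vector. -/
def toVec {P : 𝔄.Rep} : vecMod P →ₗ[k] P.Idx → k := LinearMap.id

theorem vecMod_r (P : 𝔄.Rep) (a : 𝔄.Γ) (x : vecMod P) :
    (vecMod P).r a x = ofVec (Matrix.vecMul (toVec x) (P.ρΓ a)) := rfl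

/-- An element of `matΓ P Q`, as a matrix. -/
def toMatΓ {P Q : 𝔄.Rep} : matΓ P Q →ₗ[k] Matrix P.Idx Q.Idx k := LinearMap.id

/-- The action of matrices on row vectors. -/
def vecMulLin (P Q : 𝔄.Rep) : vecMod P →ₗ[k] matΓ P Q →ₗ[k] vecMod Q :=
  LinearMap.mk₂ k (fun x M => ofVec (Matrix.vecMul (toVec x) (toMatΓ M)))
    (fun x y M => congrArg ofVec (Matrix.add_vecMul (toMatΓ M) (toVec x) (toVec y)))
    (fun c x M => congrArg ofVec (Matrix.smul_vecMul c (toVec x) (toMatΓ M)))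
    (fun x M N => congrArg ofVec (Matrix.vecMul_add (toMatΓ M) (toMatΓ N) (toVec x)))
    (fun c x M => congrArg ofVec (Matrix.vecMul_smul (toVec x) c (toMatΓ M)))

theorem toVec_vecMulLin {P Q : 𝔄.Rep} (x : vecMod P) (M : matΓ P Q) :
    toVec (vecMulLin P Q x M) = Matrix.vecMul (toVec x) (toMatΓ M) := rfl

theorem vecMulLin_r_left {P Q : 𝔄.Rep} (a : 𝔄.Γ) (x : vecMod P) (M : matΓ P Q) :
    vecMulLin P Q ((vecMod P).r a x) M = vecMulLin P Q x ((matΓ P Q).l a M) :=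
  congrArg ofVec (Matrix.vecMul_vecMul (toVec x) (P.ρΓ a) (toMatΓ M))

theorem vecMulLin_r_right {P Q : 𝔄.Rep} (a : 𝔄.Γ) (x : vecMod P) (M : matΓ P Q) :
    vecMulLin P Q x ((matΓ P Q).r a M) = (vecMod Q).r a (vecMulLin P Q x M) :=
  congrArg ofVec (Matrix.vecMul_vecMul (toVec x) (toMatΓ M) (Q.ρΓ a)).symm

/-- The unit row vectors pick out the rows of the matrix. -/
theorem vecMulLin_injective {P Q : 𝔄.Rep} {M N : matΓ P Q}
    (h : ∀ x, vecMulLin P Q x M = vecMulLin P Q x N) : M = N :=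
  Matrix.ext fun a b => by
    have := congrFun (congrArg toVec (h (ofVec (Pi.single a 1)))) b
    rw [toVec_vecMulLin, toVec_vecMulLin] at this
    change Matrix.vecMul (Pi.single a 1) _ b = Matrix.vecMul (Pi.single a 1) _ b at this
    rw [Matrix.single_one_vecMul, Matrix.single_one_vecMul] at this
    exact this

/-- The matrix of a linear map. -/
def matOfLin (P Q : 𝔄.Rep) : (vecMod P →ₗ[k] vecMod Q) →ₗ[k] matΓ P Q :=
  (Matrix.transposeLinearEquiv Q.Idx P.Idx k k).toLinearMap ∘ₗ
    (LinearMap.toMatrix' : ((P.Idx → k) →ₗ[k] (Q.Idx → k)) ≃ₗ[k] _).toLinearMap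

theorem vecMulLin_matOfLin {P Q : 𝔄.Rep} (F : vecMod P →ₗ[k] vecMod Q) (x : vecMod P) :
    vecMulLin P Q x (matOfLin P Q F) = F x :=
  congrArg ofVec ((Matrix.vecMul_transpose _ _).trans (LinearMap.toMatrix'_mulVec _ _))

/-- The linear map `P ⊗ Ω → Q` defined by a bimodule map from `Ω` to the matrices. -/
def ofΩ {P Q : 𝔄.Rep} (φ : BiMod.Hom 𝔄.Ω (matΓ P Q)) :
    BiMod.Hom (tens (vecMod P) 𝔄.Ω) (vecMod Q) :=
  tensLift ((vecMulLin P Q).compl₂ φ.toLin)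
    (fun x a w => (vecMulLin_r_left a x _).trans
      (congrArg (vecMulLin P Q x) (φ.map_l a w).symm))
    (fun c x w => congrArg ofVec (Matrix.smul_vecMul c (toVec x) (toMatΓ (φ.toLin w))))
    (fun a x w => (congrArg (vecMulLin P Q x) (φ.map_r a w)).trans (vecMulLin_r_right a x _))

theorem ofΩ_tmul {P Q : 𝔄.Rep} (φ : BiMod.Hom 𝔄.Ω (matΓ P Q)) (x : vecMod P) (w : 𝔄.Ω) :
    (ofΩ φ).toLin (tmul (vecMod P) 𝔄.Ω x w) = vecMulLin P Q x (φ.toLin w) :=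
  tensLift_tmul _ _ _ _ _ _

theorem ofΩ_injective {P Q : 𝔄.Rep} :
    Function.Injective (ofΩ : BiMod.Hom 𝔄.Ω (matΓ P Q) → _) := fun φ ψ h => by
  refine BiMod.Hom.ext (LinearMap.ext fun w => vecMulLin_injective fun x => ?_)
  rw [← ofΩ_tmul, ← ofΩ_tmul, h]

/-- For a fixed `w` in `Ω`, the linear map `x ↦ f(x ⊗ w)` is given by a matrix. That this matrix is
left `Γ`-linear in `w` is the balance of the tensor product, and that it is right `Γ`-linear is the
`Γ`-linearity of `f`. -/
theorem ofΩ_surjective {P Q : 𝔄.Rep} :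
    Function.Surjective (ofΩ : BiMod.Hom 𝔄.Ω (matΓ P Q) → _) := fun f => by
  obtain ⟨F, hF⟩ : ∃ F : 𝔄.Ω →ₗ[k] vecMod P →ₗ[k] vecMod Q,
      ∀ w x, F w x = f.toLin (tmul (vecMod P) 𝔄.Ω x w) :=
    ⟨((tmul (vecMod P) 𝔄.Ω).compr₂ f.toLin).flip, fun _ _ => rfl⟩
  obtain ⟨G, hG⟩ : ∃ G : 𝔄.Ω →ₗ[k] matΓ P Q,
      ∀ w x, vecMulLin P Q x (G w) = f.toLin (tmul (vecMod P) 𝔄.Ω x w) :=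
    ⟨matOfLin P Q ∘ₗ F, fun w x => (vecMulLin_matOfLin (F w) x).trans (hF w x)⟩
  refine ⟨⟨G, fun a w => vecMulLin_injective fun x => ?_,
    fun a w => vecMulLin_injective fun x => ?_⟩,
    BiMod.Hom.ext (tens_ext fun x w => (ofΩ_tmul _ _ _).trans (hG w x))⟩
  · rw [hG, ← vecMulLin_r_left, hG]
    exact congrArg f.toLin (tmul_bal (M := vecMod P) (N := 𝔄.Ω) x a w).symm
  · rw [hG, vecMulLin_r_right, hG, ← f.map_r]
    exact congrArg f.toLin (tens_r (M := vecMod P) (N := 𝔄.Ω) a x w).symm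

theorem ofΩ_one (P : 𝔄.Rep) (x : vecMod P) (w : 𝔄.Ω) :
    (ofΩ (Hom.one P).onΩ).toLin (tmul (vecMod P) 𝔄.Ω x w) =
      (vecMod P).r (𝔄.counitΩ.toLin w) x := by
  have h : toMatΓ ((Hom.one P).onΩ.toLin w) = P.ρΓ (𝔄.counitΩ.toLin w) := onΩ_one P w
  rw [ofΩ_tmul]
  exact (congrArg (fun M => ofVec (Matrix.vecMul (toVec x) M)) h).trans
    (vecMod_r P (𝔄.counitΩ.toLin w) x).symm

/-- On a pure tensor `w₁ ⊗ w₂`, the left side multiplies `x` by the product of two matrices and the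
right side multiplies by one after the other. The general case follows by linearity in the
comultiplication of `w`. -/
theorem ofΩ_mul {P Q U : 𝔄.Rep} (f : Hom P Q) (g : Hom Q U) (x : vecMod P) (w : 𝔄.Ω) :
    (ofΩ (f.mul g).onΩ).toLin (tmul (vecMod P) 𝔄.Ω x w) = (ofΩ g.onΩ).toLin
      ((tensMap (ofΩ f.onΩ) (BiMod.Hom.id 𝔄.Ω)).toLin
        (assocAux (vecMod P) 𝔄.Ω 𝔄.Ω x (𝔄.comulΩ.toLin w))) := by
  rw [ofΩ_tmul, onΩ_mul]
  refine tens_ext_apply (M := 𝔄.Ω) (N := 𝔄.Ω)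
    (f := vecMulLin P U x ∘ₗ (mulΓ P Q U).toLin ∘ₗ (tensMap f.onΩ g.onΩ).toLin)
    (g := (ofΩ g.onΩ).toLin ∘ₗ (tensMap (ofΩ f.onΩ) (BiMod.Hom.id 𝔄.Ω)).toLin ∘ₗ
      assocAux (vecMod P) 𝔄.Ω 𝔄.Ω x) (fun w₁ w₂ => ?_) (𝔄.comulΩ.toLin w)
  rw [LinearMap.comp_apply, LinearMap.comp_apply, LinearMap.comp_apply, LinearMap.comp_apply,
    tensMap_tmul, mulΓ_tmul, assocAux_tmul, tensMap_tmul, ofΩ_tmul, ofΩ_tmul]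
  exact congrArg ofVec (Matrix.vecMul_vecMul _ _ _).symm

/-- The representation of the bocs defined by a representation of the problem. -/
def toBocs (P : 𝔄.Rep) : 𝔄.bocs.Rep := ⟨vecMod P, inferInstanceAs (Module.Finite k (P.Idx → k))⟩

variable (𝔄) in
/-- The functor `R(𝔄) → R(𝔅)`. -/
def toBocsFunctor : 𝔄.Rep ⥤ 𝔄.bocs.Rep where
  obj := toBocs
  map {P Q} f := (ofΩ (Hom.onΩ f) : Bocs.Rep.Hom (toBocs P) (toBocs Q))
  map_id P := Bocs.Rep.hom_ext (P := toBocs P) (Q := toBocs P) fun x w =>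
    (ofΩ_one P x w).trans (Bocs.Rep.idHom_tmul (toBocs P) x w).symm
  map_comp {P Q U} f g := Bocs.Rep.hom_ext (P := toBocs P) (Q := toBocs U) fun x w =>
    (ofΩ_mul f g x w).trans (Bocs.Rep.compHom_tmul (𝔅 := 𝔄.bocs) (P := toBocs P)
      (Q := toBocs Q) (U := toBocs U) (ofΩ (Hom.onΩ f)) (ofΩ (Hom.onΩ g)) x w).symm

/-- On morphisms the functor is `Hom.onΩ` followed by `ofΩ`, and both of these are bijective. -/
instance : (toBocsFunctor 𝔄).Faithful where
  map_injective {P Q} _ _ h := Hom.onΩ_injective (P := P) (Q := Q) (ofΩ_injective h)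

instance : (toBocsFunctor 𝔄).Full where
  map_surjective {P Q} := (ofΩ_surjective (P := P) (Q := Q)).comp Hom.onΩ_surjective

end Rep

end MatrixBimoduleProblem

/-! ### The Weyr normal form -/

section Weyr

open Polynomial

variable {k : Type u} [Field k]

/-- The classes of the powers `(X - c) ^ j` with `j < e` form the basis: they span by Taylor
expansion at `c`, and their number is the dimension. Multiplication by `X = c + (X - c)` shifts them
along a Jordan chain. The ideal is a variable because the structure theorem presents it by a power
of an irreducible polynomial that is only associated to `X - c`. -/
theorem exists_basis_quotient_X_sub_C_pow (c : k) (e : ℕ) (I : Submodule k[X] k[X])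
    (hI : I = Ideal.span {(X - C c) ^ e}) :
    ∃ b : Module.Basis (Fin e) k (k[X] ⧸ I), ∀ j : Fin e, (X : k[X]) • b j =
      c • b j + if h : j.1 + 1 < e then b ⟨j.1 + 1, h⟩ else 0 := by
  subst hI
  have hmon : ((X - C c) ^ e).Monic := (monic_X_sub_C c).pow e
  obtain ⟨q, hq, hq0⟩ : ∃ q : k[X] →ₗ[k[X]] k[X] ⧸ Ideal.span {(X - C c) ^ e},
      Function.Surjective q ∧ q ((X - C c) ^ e) = 0 :=
    ⟨Submodule.mkQ _, Submodule.mkQ_surjective _,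
      (Submodule.Quotient.mk_eq_zero _).2 (Ideal.mem_span_singleton_self _)⟩
  -- Indexing by all natural numbers, with value zero from `e` on, treats the last vector of the
  -- chain like the others.
  obtain ⟨v, hv⟩ : ∃ v : ℕ → k[X] ⧸ Ideal.span {(X - C c) ^ e}, ∀ j, v j = q ((X - C c) ^ j) :=
    ⟨_, fun _ => rfl⟩
  have hv0 : ∀ j, e ≤ j → v j = 0 := fun j hj => by
    rw [hv, ← Nat.sub_add_cancel hj, pow_add, ← smul_eq_mul, map_smul, hq0, smul_zero]
  have hqs : ∀ (a : k) p, q (a • p) = a • q p := fun a p => q.map_smul_of_tower a p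
  have hspan : ⊤ ≤ Submodule.span k (Set.range fun j : Fin e => v j) := by
    rintro z -
    obtain ⟨p, rfl⟩ := hq z
    have hp : q p = ∑ i ∈ (taylor c p).support, (taylor c p).coeff i • v i := by
      conv_lhs => rw [← sum_taylor_eq p c, Polynomial.sum]
      rw [map_sum]
      refine Finset.sum_congr rfl fun i _ => ?_
      rw [← smul_eq_C_mul, hqs, hv]
    rw [hp]
    refine Submodule.sum_mem _ fun i _ => Submodule.smul_mem _ _ ?_
    by_cases hi : i < e
    · exact Submodule.subset_span ⟨⟨i, hi⟩, rfl⟩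
    · rw [hv0 i (not_lt.1 hi)]
      exact Submodule.zero_mem _
  have hrank : Module.finrank k (k[X] ⧸ Ideal.span {(X - C c) ^ e}) = e := by
    rw [finrank_quotient_span_eq_natDegree, natDegree_pow, natDegree_X_sub_C, mul_one]
  have hcard : Fintype.card (Fin e) = Module.finrank k (k[X] ⧸ Ideal.span {(X - C c) ^ e}) := by
    rw [hrank, Fintype.card_fin]
  refine ⟨basisOfTopLeSpanOfCardEqFinrank (fun j : Fin e => v j) hspan hcard, fun j => ?_⟩
  have hb : ∀ i : Fin e, basisOfTopLeSpanOfCardEqFinrank (fun j : Fin e => v j) hspan hcard i =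
      v i := fun i => by simp
  have hstep : (X : k[X]) • v j = c • v j + v (j + 1) := by
    rw [hv, hv, ← map_smul, ← hqs, ← map_add, smul_eq_C_mul, smul_eq_mul]
    congr 1
    ring
  simp only [hb]
  rw [hstep]
  split_ifs with h
  · rfl
  · rw [hv0 _ (not_lt.1 h)]

/-- A basis consisting of Jordan chains. -/
theorem exists_basis_jordan_chains [IsAlgClosed k] {V : Type u} [AddCommGroup V] [Module k V]
    [Module.Finite k V] (T : Module.End k V) :
    ∃ (ι : Type u) (_ : Fintype ι) (c : ι → k) (e : ι → ℕ)
      (b : Module.Basis (Σ x, Fin (e x)) k V), ∀ x (j : Fin (e x)), T (b ⟨x, j⟩) =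
        c x • b ⟨x, j⟩ + if h : j.1 + 1 < e x then b ⟨x, ⟨j.1 + 1, h⟩⟩ else 0 := by
  classical
  -- The structure theorem over the principal ideal domain `k[X]`, applied to `V` with `X` acting as
  -- `T`.
  obtain ⟨ι, hι, p, hp, e, ⟨φ⟩⟩ := Module.equiv_directSum_of_isTorsion
    (Module.AEval.isTorsion_of_finiteDimensional k V T)
  -- Over an algebraically closed field an irreducible polynomial has a root `c`, and is therefore
  -- associated to `X - c`.
  have hroot : ∀ i, ∃ c : k, Submodule.span k[X] {p i ^ e i} = Ideal.span {(X - C c) ^ e i} :=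
    fun i => by
      obtain ⟨c, hc⟩ := IsAlgClosed.exists_root (p i) (degree_pos_of_irreducible (hp i)).ne'
      refine ⟨c, Ideal.span_singleton_eq_span_singleton.2 (Associated.pow_pow ?_)⟩
      exact ((irreducible_X_sub_C c).associated_of_dvd (hp i) (dvd_iff_isRoot.2 hc)).symm
  choose c hc using hroot
  choose b hb using fun i => exists_basis_quotient_X_sub_C_pow (c i) (e i) _ (hc i)
  let ψ := φ.trans (DirectSum.linearEquivFunOnFintype k[X] ι
    fun i => k[X] ⧸ Submodule.span k[X] {p i ^ e i})
  let B := (Pi.basis b).map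
    ((ψ.restrictScalars k).symm.trans (Module.AEval.of k V T).symm)
  have hB : ∀ y, B y = (Module.AEval.of k V T).symm (ψ.symm (Pi.single y.1 (b y.1 y.2))) :=
    fun y => by
      simp only [B, Module.Basis.map_apply, Pi.basis_apply]
      rfl
  refine ⟨ι, hι, c, e, B, fun x j => ?_⟩
  have hT : ∀ y, T ((Module.AEval.of k V T).symm y) = (Module.AEval.of k V T).symm (X • y) :=
    fun y => (Module.AEval.of_symm_X_smul T y).symm
  have hX : (X : k[X]) • (Pi.single x (b x j) : ∀ i, k[X] ⧸ Submodule.span k[X] {p i ^ e i}) =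
      Pi.single x (X • b x j) := 
    ((LinearMap.single k[X] (fun i => k[X] ⧸ Submodule.span k[X] {p i ^ e i}) x).map_smul X
      (b x j)).symm
  rw [hB, hT, ← map_smul, hX, hb, Pi.single_add, map_add, map_add]
  congr 1
  -- The inclusion of a summand followed by the isomorphism with `V`, as one `k`-linear map through
  -- which the scalar `c x` is pulled out.
  · let L : (k[X] ⧸ Submodule.span k[X] {p x ^ e x}) →ₗ[k] V :=
      ((ψ.restrictScalars k).symm.trans (Module.AEval.of k V T).symm).toLinearMap ∘ₗ
        LinearMap.single k (fun i => k[X] ⧸ Submodule.span k[X] {p i ^ e i}) x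
    exact L.map_smul (c x) (b x j)
  · split_ifs
    · rw [hB]
    · simp

theorem exists_equiv_fin_antitone {α : Type u} [Fintype α] (f : α → ℕ) :
    ∃ σ : Fin (Fintype.card α) ≃ α, Antitone (f ∘ σ) := by
  let g : Fin (Fintype.card α) → ℕᵒᵈ := fun i => OrderDual.toDual (f ((Fintype.equivFin α).symm i))
  refine ⟨(Tuple.sort g).trans (Fintype.equivFin α).symm, fun a b h => ?_⟩
  exact Tuple.monotone_sort g h

/-- For an antitone `f` the indices with `j < f i` form an initial segment, so membership means
having an index below the cardinality. This is the conjugation of a partition, from chain lengths to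
the block sizes of a Weyr matrix. -/
theorem lt_card_filter_iff_of_antitone {m : ℕ} {f : Fin m → ℕ} (hf : Antitone f) (j : ℕ)
    (a : Fin m) : a.1 < (Finset.univ.filter fun i => j < f i).card ↔ j < f a := by
  constructor
  · intro h
    by_contra hj
    have hs : (Finset.univ.filter fun i => j < f i) ⊆ Finset.Iio a := fun i hi => by
      rw [Finset.mem_Iio]
      by_contra hai
      exact hj ((Finset.mem_filter.1 hi).2.trans_le (hf (not_lt.1 hai)))
    have := Finset.card_le_card hs
    rw [Fin.card_Iio] at this
    omega
  · intro h
    have hs : Finset.Iic a ⊆ (Finset.univ.filter fun i => j < f i) := fun i hi =>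
      Finset.mem_filter.2 ⟨Finset.mem_univ _, h.trans_le (hf (Finset.mem_Iic.1 hi))⟩
    have := Finset.card_le_card hs
    rw [Fin.card_Iic] at this
    omega

/-- A basis indexed by the rows of a Weyr matrix, on which an endomorphism acts as the matrix. -/
theorem exists_isWeyr_of_basis {V : Type u} [AddCommGroup V] [Module k V] (T : Module.End k V)
    {s : ℕ} (c : Fin s → k) (hc : Function.Injective c) (d : Fin s → ℕ) (μ : ∀ i, Fin (d i) → ℕ)
    (hμ : ∀ i, Antitone (μ i)) (b : Module.Basis (Σ i, Σ j, Fin (μ i j)) k V)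
    (hb : ∀ i (x : Σ j, Fin (μ i j)), T (b ⟨i, x⟩) = c i • b ⟨i, x⟩ +
      ∑ y : Σ j, Fin (μ i j), if x.1.val + 1 = y.1.val ∧ x.2.val = y.2.val then b ⟨i, y⟩ else 0) :
    ∃ (n : ℕ) (W : Matrix (Fin n) (Fin n) k) (b : Module.Basis (Fin n) k V), IsWeyr W ∧
      ∀ x, T (b x) = ∑ y, W x y • b y := by
  -- The enumeration of rows that results from the nested reindexings in `weyrBlock` and `IsWeyr`.
  let ψ : (Σ i, Σ j, Fin (μ i j)) ≃ Fin (∑ i, ∑ j, μ i j) :=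
    (Equiv.sigmaCongrRight fun i => finSigmaFinEquiv).trans finSigmaFinEquiv
  let W := Matrix.reindex finSigmaFinEquiv finSigmaFinEquiv
      (Matrix.blockDiagonal' fun i => weyrBlock (c i) (μ i))
  have hW : ∀ i x i' x', W (ψ ⟨i, x⟩) (ψ ⟨i', x'⟩) = Matrix.blockDiagonal'
      (fun i => weyrBlock (c i) (μ i)) ⟨i, finSigmaFinEquiv x⟩ ⟨i', finSigmaFinEquiv x'⟩ :=
    fun i x i' x' => by simp [W, ψ]
  refine ⟨_, W, b.reindex ψ, ⟨s, c, d, μ, rfl, hc, hμ, by ext; rfl⟩, fun z => ?_⟩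
  obtain ⟨⟨i, x⟩, rfl⟩ := ψ.surjective z
  rw [← ψ.sum_comp]
  simp only [Module.Basis.reindex_apply, Equiv.symm_apply_apply]
  rw [Fintype.sum_sigma, Finset.sum_eq_single i, hb]
  -- The two cases in the definition of `weyrBlock` exclude each other, since `x.1 + 1` differs from
  -- `x.1`. The entry is thus the sum of a diagonal and a shift contribution.
  · have h : ∀ y : Σ j, Fin (μ i j), W (ψ ⟨i, x⟩) (ψ ⟨i, y⟩) • b ⟨i, y⟩ =
        (if x = y then c i • b ⟨i, y⟩ else 0) +
        if x.1.val + 1 = y.1.val ∧ x.2.val = y.2.val then b ⟨i, y⟩ else 0 := fun y => by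
      rw [hW, Matrix.blockDiagonal'_apply_eq]
      simp only [weyrBlock, Matrix.reindex_apply, Matrix.submatrix_apply, Equiv.symm_apply_apply,
        Matrix.of_apply]
      by_cases hxy : x = y
      · subst hxy
        simp
      · simp only [if_neg hxy, zero_add]
        split_ifs <;> simp
    simp only [h]
    rw [Finset.sum_add_distrib, Finset.sum_ite_eq, if_pos (Finset.mem_univ _)]
  · intro i' _ hi'
    refine Finset.sum_eq_zero fun y _ => ?_
    rw [hW, Matrix.blockDiagonal'_apply_ne _ _ _ (Ne.symm hi'), zero_smul]
  · simp

/-- The Weyr normal form of an endomorphism, which acts on row vectors. -/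
theorem exists_isWeyr_basis [IsAlgClosed k] {V : Type u} [AddCommGroup V] [Module k V]
    [Module.Finite k V] (T : Module.End k V) :
    ∃ (n : ℕ) (W : Matrix (Fin n) (Fin n) k) (b : Module.Basis (Fin n) k V), IsWeyr W ∧
      ∀ x, T (b x) = ∑ y, W x y • b y := by
  classical
  obtain ⟨ι, hι, c, e, B, hB⟩ := exists_basis_jordan_chains T
  -- Several chains may share an eigenvalue, whereas a Weyr matrix has distinct ones. Each value of
  -- `c` is therefore enumerated once.
  let S := Finset.univ.image c
  let c' : Fin S.card → k := fun i => S.equivFin.symm i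
  have hc' : Function.Injective c' := Subtype.val_injective.comp S.equivFin.symm.injective
  have hcs : ∀ x, ∃ i, c x = c' i := fun x =>
    ⟨S.equivFin ⟨c x, Finset.mem_image_of_mem c (Finset.mem_univ x)⟩, by simp [c']⟩
  choose σ hσ using fun i => exists_equiv_fin_antitone fun x : {x // c x = c' i} => e x
  -- A common bound for the chain lengths serves as the number of blocks for every eigenvalue.
  -- Blocks beyond the longest chain have size zero, which the definition of a Weyr matrix permits.
  obtain ⟨D, hD⟩ : ∃ D, ∀ x, e x ≤ D :=
    ⟨∑ x, e x, fun x => Finset.single_le_sum (fun _ _ => Nat.zero_le _) (Finset.mem_univ x)⟩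
  -- The number of chains of the `i`-th eigenvalue that are longer than `j`: the partition conjugate
  -- to that of the chain lengths.
  let ν : Fin S.card → ℕ → ℕ := fun i j => (Finset.univ.filter fun a => j < e (σ i a)).card
  have hν : ∀ i j (a : Fin (Fintype.card {x // c x = c' i})), a.1 < ν i j ↔ j < e (σ i a) :=
    fun i j a => lt_card_filter_iff_of_antitone (hσ i) j a
  have hνle : ∀ i j, ν i j ≤ Fintype.card {x // c x = c' i} := fun i j =>
    (Finset.card_le_univ _).trans (Fintype.card_fin _).le
  let μ : ∀ i : Fin S.card, Fin D → ℕ := fun i j => ν i j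
  -- The `a`-th row of the `j`-th block corresponds to the vector at depth `j` in the `a`-th chain,
  -- the chains being sorted by decreasing length. By `hν` this chain reaches the depth `j`.
  let row : ∀ i (j : Fin D), Fin (μ i j) → {x // c x = c' i} := fun i j a =>
    σ i ⟨a.1, a.2.trans_le (hνle i j)⟩
  have hrow : ∀ i j a, j.1 < e (row i j a) := fun i j a => (hν i j _).1 a.2
  let E : (Σ i, Σ j, Fin (μ i j)) → Σ x, Fin (e x) := fun y =>
    ⟨(row y.1 y.2.1 y.2.2).1, ⟨y.2.1.1, hrow y.1 y.2.1 y.2.2⟩⟩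
  -- The depths are compared as natural numbers because their types depend on the chain.
  have hval : ∀ {z z' : Σ x, Fin (e x)}, z = z' → z.2.1 = z'.2.1 := fun h => by rw [h]
  have hE : Function.Bijective E := by
    constructor
    · rintro ⟨i, j, a⟩ ⟨i', j', a'⟩ h
      have h1 : (row i j a).1 = (row i' j' a').1 := congrArg Sigma.fst h
      have h2 : j = j' := Fin.ext (hval h)
      have h3 : i = i' := hc' ((row i j a).2.symm.trans ((congrArg c h1).trans (row i' j' a').2))
      subst h2 h3
      have h4 := congrArg Fin.val ((σ i).injective (Subtype.ext h1))
      have h5 : a = a' := Fin.ext h4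
      rw [h5]
    · rintro ⟨x, j⟩
      obtain ⟨i, hi⟩ := hcs x
      have ha : j.1 < e (σ i ((σ i).symm ⟨x, hi⟩)) := by
        rw [Equiv.apply_symm_apply]
        exact j.2
      refine ⟨⟨i, ⟨j.1, j.2.trans_le (hD x)⟩, ⟨((σ i).symm ⟨x, hi⟩).1, (hν i j _).2 ha⟩⟩, ?_⟩
      have hx : (row i ⟨j.1, j.2.trans_le (hD x)⟩
          ⟨((σ i).symm ⟨x, hi⟩).1, (hν i j _).2 ha⟩).1 = x := by
        simp [row]
      refine Sigma.ext hx ?_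
      rw [Fin.heq_ext_iff (congrArg e hx)]
  let b := B.reindex (Equiv.ofBijective E hE).symm
  have hbE : ∀ y, b y = B (E y) := fun y => by simp [b]
  refine exists_isWeyr_of_basis T c' hc' (fun _ => D) μ (fun i j j' h => ?_) b ?_
  · exact Finset.card_le_card (Finset.monotone_filter_right _ fun a ha =>
      lt_of_le_of_lt (show j.1 ≤ j'.1 from h))
  · rintro i ⟨j, a⟩
    rw [hbE, hB, (row i j a).2]
    congr 1
    split_ifs with h
    -- The next vector of the chain has the same index `a` in the next block. This is the position
    -- of the `1` in the identity part of the block above the diagonal, and it exists exactly if the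
    -- chain is longer than `j + 1`.
    · have ha : a.1 < ν i (j.1 + 1) := (hν i (j.1 + 1) ⟨a.1, a.2.trans_le (hνle i j)⟩).2 h
      rw [Finset.sum_eq_single ⟨⟨j.1 + 1, h.trans_le (hD _)⟩, ⟨a.1, ha⟩⟩]
      · rw [if_pos ⟨rfl, rfl⟩, hbE]
      · rintro ⟨j', a'⟩ _ hne
        refine if_neg fun hh => hne ?_
        obtain ⟨h1, h2⟩ := hh
        have h3 : j' = ⟨j.1 + 1, h.trans_le (hD _)⟩ := Fin.ext h1.symm
        subst h3
        exact congrArg _ (Fin.ext h2.symm)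
      · simp
    · symm
      refine Finset.sum_eq_zero fun y _ => if_neg fun hh => h ?_
      obtain ⟨h1, h2⟩ := hh
      have ha : a.1 < ν i (j.1 + 1) := by
        dsimp only at h1 h2
        rw [h1, h2]
        exact y.2.2
      exact (hν i (j.1 + 1) ⟨a.1, a.2.trans_le (hνle i j)⟩).1 ha

end Weyr

/-! ### Matrices of endomorphisms with respect to row vectors -/

section rowMatrix

variable {k : Type u} [Field k] {V : Type u} [AddCommGroup V] [Module k V] {ι : Type} [Fintype ι]
  [DecidableEq ι] (b : Module.Basis ι k V)

/-- The matrix whose rows are the coordinates of the images of the basis vectors. -/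
def rowMatrix : Module.End k V →ₗ[k] Matrix ι ι k :=
  (Matrix.transposeLinearEquiv ι ι k k).toLinearMap ∘ₗ (LinearMap.toMatrix b b).toLinearMap

theorem rowMatrix_apply (f : Module.End k V) (i j : ι) : rowMatrix b f i j = b.repr (f (b i)) j :=
  LinearMap.toMatrix_apply b b f j i

/-- Endomorphisms compose as left operators, while row matrices act from the right, so the order is
reversed. A right module reverses the order as well, and the two reversals cancel in `rowAction`. -/
theorem rowMatrix_mul (f g : Module.End k V) :
    rowMatrix b (f * g) = rowMatrix b g * rowMatrix b f :=
  (congrArg Matrix.transpose (LinearMap.toMatrix_mul b f g)).trans (Matrix.transpose_mul _ _)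

theorem rowMatrix_one : rowMatrix b 1 = 1 :=
  (congrArg Matrix.transpose (LinearMap.toMatrix_one b)).trans Matrix.transpose_one

theorem rowMatrix_algebraMap (c : k) :
    rowMatrix b (algebraMap k (Module.End k V) c) = algebraMap k _ c := by
  rw [Algebra.algebraMap_eq_smul_one, Algebra.algebraMap_eq_smul_one, map_smul, rowMatrix_one]

theorem sum_rowMatrix (f : Module.End k V) (i : ι) : ∑ j, rowMatrix b f i j • b j = f (b i) := by
  simp only [rowMatrix_apply]
  exact b.sum_repr _

theorem rowMatrix_eq {f : Module.End k V} {M : Matrix ι ι k}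
    (h : ∀ i, f (b i) = ∑ j, M i j • b j) : rowMatrix b f = M := by
  ext i j
  rw [rowMatrix_apply, h, b.repr_sum_self]

theorem rowMatrix_pow (f : Module.End k V) (n : ℕ) : rowMatrix b (f ^ n) = rowMatrix b f ^ n := by
  induction n with
  | zero => rw [pow_zero, pow_zero, rowMatrix_one]
  | succ n ih => rw [pow_succ, rowMatrix_mul, ih, pow_succ']

/-- Powers of a single endomorphism commute, so the reversal of products does no harm. -/
theorem rowMatrix_aeval (f : Module.End k V) (p : k[X]) :
    rowMatrix b (Polynomial.aeval f p) = Polynomial.aeval (rowMatrix b f) p := by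
  induction p using Polynomial.induction_on' with
  | add p q hp hq => rw [map_add, map_add, map_add, hp, hq]
  | monomial n c =>
    rw [Polynomial.aeval_monomial, Polynomial.aeval_monomial, ← Algebra.smul_def,
      ← Algebra.smul_def, map_smul, rowMatrix_pow]

/-- The action on row coordinates. -/
theorem equivFun_symm_vecMul (f : Module.End k V) (x : ι → k) :
    b.equivFun.symm (Matrix.vecMul x (rowMatrix b f)) = f (b.equivFun.symm x) := by
  rw [b.equivFun_symm_apply, b.equivFun_symm_apply, map_sum]
  simp only [Matrix.vecMul, dotProduct, Finset.sum_smul, map_smul, mul_smul]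
  rw [Finset.sum_comm]
  simp only [← Finset.smul_sum, sum_rowMatrix]

end rowMatrix

/-! ### Modules over `R_X` and regular matrices -/

namespace VertexKind

variable {k : Type u} [Field k] [IsAlgClosed k]

/-- A module over `k[x, φ⁻¹]` is a vector space with an endomorphism `T` for which `φ(T)` is
invertible. The basis is the one in which `T` has Weyr form, and the action of fractions is
determined by that of polynomials. -/
theorem exists_regular_basis_nontrivial (φ : k[X]) (hφ : φ ≠ 0) {V : Type u} [AddCommGroup V]
    [Module k V] [Module.Finite k V] (α : Localization.Away φ →ₐ[k] Module.End k V) :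
    ∃ (n : ℕ) (W : Matrix (Fin n) (Fin n) k) (_ : IsWeyr W)
      (h : ∀ c ∈ spectrum k W, φ.eval c ≠ 0) (b : Module.Basis (Fin n) k V),
      ∀ r, rowMatrix b (α r) = evalAway φ hφ W h r := by
  let T := α (algebraMap k[X] (Localization.Away φ) Polynomial.X)
  obtain ⟨n, W, b, hW, hb⟩ := exists_isWeyr_basis T
  have hT : rowMatrix b T = W := rowMatrix_eq b hb
  have hp : ∀ p, rowMatrix b (α (algebraMap k[X] (Localization.Away φ) p)) =
      Polynomial.aeval W p := fun p => by
    rw [← hT, ← rowMatrix_aeval]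
    congr 1
    have : (α.comp (IsScalarTower.toAlgHom k k[X] (Localization.Away φ))) =
        Polynomial.aeval T := Polynomial.algHom_ext (by simp [T])
    exact congrArg (fun f => f p) this
  have hunit : IsUnit (Polynomial.aeval W φ) := by
    have h1 : algebraMap k[X] (Localization.Away φ) φ * IsLocalization.Away.invSelf φ = 1 :=
      IsLocalization.Away.mul_invSelf φ
    have h2 := congrArg (fun r => rowMatrix b (α r)) h1
    simp only [map_mul, map_one, rowMatrix_mul, rowMatrix_one, hp] at h2
    exact IsUnit.of_mul_eq_one_right _ h2
  -- By spectral mapping `φ(c)` lies in the spectrum of `φ(W)`, which does not contain `0` because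
  -- `φ` is a unit in the localization.
  have hs : ∀ c ∈ spectrum k W, φ.eval c ≠ 0 := fun c hc h0 => by
    have h := spectrum.subset_polynomial_aeval W φ ⟨c, hc, rfl⟩
    dsimp only at h
    rw [h0] at h
    exact spectrum.zero_notMem k hunit h
  refine ⟨n, W, hW, hs, b, fun r => ?_⟩
  obtain ⟨⟨p, s⟩, h⟩ := IsLocalization.surj (Submonoid.powers φ) r
  have hsu : IsUnit (evalAway φ hφ W hs (algebraMap k[X] (Localization.Away φ) s)) :=
    (IsLocalization.map_units (Localization.Away φ) s).map _
  refine hsu.mul_right_cancel ?_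
  rw [← map_mul]
  -- The factors are exchanged beforehand, so that after the reversal by `rowMatrix_mul` the
  -- denominator stands on the right, where it is cancelled.
  have h2 := congrArg (fun r => rowMatrix b (α r)) ((mul_comm _ r).trans h)
  dsimp only at h2
  rw [map_mul, rowMatrix_mul, hp, hp] at h2
  dsimp only at h
  rw [h, evalAway_algebraMap, evalAway_algebraMap, h2]

/-- Every finite-dimensional `R_X`-module is defined by a regular matrix. -/
theorem exists_regular_basis (v : VertexKind k) {V : Type u} [AddCommGroup V] [Module k V]
    [Module.Finite k V] (α : v.Coeff →ₐ[k] Module.End k V) :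
    ∃ (n : ℕ) (W : Matrix (Fin n) (Fin n) k) (h : v.Regular W) (b : Module.Basis (Fin n) k V),
      ∀ r, rowMatrix b (α r) = v.eval W h r := by
  cases v with
  | trivial =>
    refine ⟨_, 1, rfl, Module.finBasis k V, fun r => ?_⟩
    have h : α r = algebraMap k (Module.End k V) r := α.commutes r
    have h' : VertexKind.trivial.eval (1 : Matrix (Fin (Module.finrank k V)) _ k) rfl r =
      algebraMap k _ r := rfl
    exact (congrArg (rowMatrix _) h).trans ((rowMatrix_algebraMap (k := k) _ r).trans h'.symm)
  | nontrivial φ hφ =>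
    obtain ⟨n, W, hW, h, b, H⟩ := exists_regular_basis_nontrivial φ hφ α
    exact ⟨n, W, ⟨hW, h⟩, b, H⟩

end VertexKind

/-! ### Isomorphisms of representations of a bocs -/

namespace Bocs.Rep

variable {k : Type u} [Field k] {𝔅 : Bocs k}

/-- The morphism of representations defined by a `Γ`-linear map. -/
def ofHom {P Q : 𝔅.Rep} (θ : BiMod.Hom P.P Q.P) : Rep.Hom P Q := θ.comp (idHom P)

theorem ofHom_tmul {P Q : 𝔅.Rep} (θ : BiMod.Hom P.P Q.P) (p : P.P) (w : 𝔅.Ω) :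
    (ofHom θ).toLin (BiMod.tmul P.P 𝔅.Ω p w) = θ.toLin (P.P.r (𝔅.ε w) p) :=
  congrArg θ.toLin (idHom_tmul P p w)

/-- A strict morphism uses the first factor of the comultiplication only through the counit. By the
left counit law, composing with it amounts to applying `θ` to the module element. -/
theorem compHom_ofHom_tmul {P Q U : 𝔅.Rep} (θ : BiMod.Hom P.P Q.P) (g : Rep.Hom Q U) (p : P.P)
    (w : 𝔅.Ω) : (compHom (ofHom θ) g).toLin (BiMod.tmul P.P 𝔅.Ω p w) =
      g.toLin (BiMod.tmul Q.P 𝔅.Ω (θ.toLin p) w) := by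
  rw [compHom_tmul]
  conv_rhs => rw [← 𝔅.counit_left w]
  refine BiMod.tens_ext_apply
    (f := g.toLin ∘ₗ (BiMod.tensMap (ofHom θ) (BiMod.Hom.id 𝔅.Ω)).toLin ∘ₗ
      BiMod.assocAux P.P 𝔅.Ω 𝔅.Ω p)
    (g := g.toLin ∘ₗ BiMod.tmul Q.P 𝔅.Ω (θ.toLin p) ∘ₗ (BiMod.lUnit 𝔅.Ω).toLin ∘ₗ
      (BiMod.tensMap 𝔅.ε (BiMod.Hom.id 𝔅.Ω)).toLin) (fun w₁ w₂ => ?_) (𝔅.μ w)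
  simp only [LinearMap.comp_apply, BiMod.assocAux_tmul, BiMod.tensMap_tmul, ofHom_tmul,
    BiMod.lUnit_tmul]
  refine congrArg g.toLin (Eq.trans ?_ (BiMod.tmul_bal (θ.toLin p) (B := 𝔅.Γ) (𝔅.ε.toLin w₁) w₂))
  exact congrArg (fun x => BiMod.tmul Q.P 𝔅.Ω x w₂) (θ.map_r _ p)

/-- A `Γ`-linear isomorphism is an isomorphism of representations. -/
def isoOfHom {P Q : 𝔅.Rep} (θ : BiMod.Hom P.P Q.P) (θ' : BiMod.Hom Q.P P.P)
    (h : ∀ p, θ'.toLin (θ.toLin p) = p) (h' : ∀ q, θ.toLin (θ'.toLin q) = q) : P ≅ Q where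
  hom := (ofHom θ : Rep.Hom P Q)
  inv := (ofHom θ' : Rep.Hom Q P)
  hom_inv_id := hom_ext fun p w => by
    refine (compHom_ofHom_tmul θ (ofHom θ') p w).trans ?_
    exact (ofHom_tmul θ' (θ.toLin p) w).trans
      ((congrArg θ'.toLin (θ.map_r (𝔅.ε.toLin w : 𝔅.Γ) p).symm).trans
        ((h _).trans (idHom_tmul P p w).symm))
  inv_hom_id := hom_ext fun p w => by
    refine (compHom_ofHom_tmul θ' (ofHom θ) p w).trans ?_
    exact (ofHom_tmul θ (θ'.toLin p) w).trans
      ((congrArg θ.toLin (θ'.map_r (𝔅.ε.toLin w : 𝔅.Γ) p).symm).trans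
        ((h' _).trans (idHom_tmul Q p w).symm))

end Bocs.Rep

/-! ### Modules over products of algebras -/

section pi

variable {k : Type u} [Field k] {V : Type u} [AddCommGroup V] [Module k V]

/-- A module over a product of algebras is a direct sum of modules over the factors. -/
theorem exists_linearEquiv_pi {T : Type} [Fintype T] [DecidableEq T] {A : T → Type u}
    [∀ X, CommRing (A X)] [∀ X, Algebra k (A X)] (α : (∀ X, A X) →ₐ[k] Module.End k V) :
    ∃ (U : T → Submodule k V) (β : ∀ X, A X →ₐ[k] Module.End k (U X))
      (e : (∀ X, U X) ≃ₗ[k] V), ∀ r w, α r (e w) = e fun X => β X (r X) (w X) := by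
  have hmul : ∀ X (a b : A X) (v : V), α (Pi.single X (a * b)) v =
      α (Pi.single X a) (α (Pi.single X b) v) := fun X a b v => by
    rw [Pi.single_mul, map_mul, Module.End.mul_apply]
  -- The components are the images of the idempotents. These are orthogonal (`hne`) and add up to
  -- `1`.
  let U : T → Submodule k V := fun X => LinearMap.range (α (Pi.single X 1))
  have hU : ∀ X (v : U X), α (Pi.single X 1) v = v := fun X v => by
    obtain ⟨w, hw⟩ := v.2
    rw [← hw, ← hmul, one_mul]
  have hmem : ∀ X (a : A X) (v : V), α (Pi.single X a) v ∈ U X := fun X a v =>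
    ⟨α (Pi.single X a) v, by rw [← hmul, one_mul]⟩
  have hne : ∀ X Y (_ : X ≠ Y) (a : A X) (v : U Y), α (Pi.single X a) (v : V) = 0 :=
    fun X Y h a v => by
      rw [← hU, ← Module.End.mul_apply, ← map_mul]
      have : (Pi.single X a : ∀ X, A X) * Pi.single Y 1 = 0 := by
        ext Z
        by_cases hZ : Z = X
        · subst hZ
          rw [Pi.mul_apply, Pi.single_eq_of_ne h, mul_zero, Pi.zero_apply]
        · rw [Pi.mul_apply, Pi.single_eq_of_ne hZ, zero_mul, Pi.zero_apply]
      rw [this, map_zero, LinearMap.zero_apply]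
  have hsum : ∀ r v, α r v = ∑ X, α (Pi.single X (r X)) v := fun r v => by
    rw [← LinearMap.sum_apply, ← map_sum, Finset.univ_sum_single]
  let β : ∀ X, A X →ₐ[k] Module.End k (U X) := fun X => AlgHom.ofLinearMap
    { toFun := fun a => (α (Pi.single X a)).restrict fun v _ => hmem X a v
      map_add' := fun a b => LinearMap.ext fun v => Subtype.ext (by
        simp [Pi.single_add])
      map_smul' := fun c a => LinearMap.ext fun v => Subtype.ext (by
        simp [Pi.single_smul]) }
    (LinearMap.ext fun v => Subtype.ext (hU X v))
    (fun a b => LinearMap.ext fun v => Subtype.ext (hmul X a b v))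
  -- The summation map, with the family of idempotents as its inverse.
  let e : (∀ X, U X) ≃ₗ[k] V := LinearEquiv.ofLinearMap
    (LinearMap.lsum k (fun X => U X) k fun X => (U X).subtype)
    (LinearMap.pi fun X => (α (Pi.single X 1)).rangeRestrict)
    (LinearMap.ext fun v => by
      simp only [LinearMap.comp_apply, LinearMap.lsum_apply, LinearMap.sum_apply,
        LinearMap.proj_apply, LinearMap.pi_apply, Submodule.subtype_apply, LinearMap.id_apply,
        LinearMap.codRestrict_apply]
      exact (hsum 1 v).symm.trans (by rw [map_one, Module.End.one_apply]))
    (LinearMap.ext fun w => funext fun X => Subtype.ext (by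
      simp only [LinearMap.comp_apply, LinearMap.lsum_apply, LinearMap.sum_apply,
        LinearMap.proj_apply, LinearMap.pi_apply, Submodule.subtype_apply, LinearMap.id_apply,
        map_sum, AddSubmonoidClass.coe_finsetSum]
      exact (Finset.sum_eq_single X (fun Y _ hY => hne X Y hY.symm 1 (w Y)) (by simp)).trans
        (hU X (w X))))
  have he : ∀ w, e w = ∑ X, (w X : V) := fun w => by
    simp [e, LinearMap.lsum_apply]
  refine ⟨U, β, e, fun r w => ?_⟩
  rw [hsum, he, he]
  refine Finset.sum_congr rfl fun X _ => ?_
  rw [map_sum, Finset.sum_eq_single X (fun Y _ hY => hne X Y hY.symm _ (w Y)) (by simp)]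
  rfl

/-- Every finite-dimensional module over a minimal algebra is defined by regular matrices. -/
theorem MinAlg.exists_regular_basis [IsAlgClosed k] [Module.Finite k V] {T : Type} [Fintype T]
    [DecidableEq T] (kind : T → VertexKind k) (α : MinAlg kind →ₐ[k] Module.End k V) :
    ∃ (d : T → ℕ) (W : ∀ X, Matrix (Fin (d X)) (Fin (d X)) k) (h : ∀ X, (kind X).Regular (W X))
      (b : Module.Basis (Σ X, Fin (d X)) k V), ∀ r : MinAlg kind,
      rowMatrix b (α r) = Matrix.blockDiagonal' fun X => (kind X).eval (W X) (h X) (r X) := by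
  obtain ⟨U, β, e, he⟩ := exists_linearEquiv_pi (A := fun X => (kind X).Coeff) α
  choose d W h b hb using fun X => (kind X).exists_regular_basis (β X)
  refine ⟨d, W, h, (Pi.basis b).map e, fun r => rowMatrix_eq _ fun x => ?_⟩
  obtain ⟨X, i⟩ := x
  have h1 : ∀ X i, ((Pi.basis b).map e) ⟨X, i⟩ = e (Pi.single X (b X i)) := fun X i => by
    rw [Module.Basis.map_apply, Pi.basis_apply]
  have h2 : (fun Y => β Y (r Y) ((Pi.single X (b X i) : ∀ X, U X) Y)) =
      Pi.single X (β X (r X) (b X i)) := by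
    funext Y
    by_cases hY : Y = X
    · subst hY
      rw [Pi.single_eq_same, Pi.single_eq_same]
    · rw [Pi.single_eq_of_ne hY, Pi.single_eq_of_ne hY, map_zero]
  rw [h1, Fintype.sum_sigma, Finset.sum_eq_single X]
  · refine (he r _).trans ((congrArg e h2).trans ?_)
    rw [← sum_rowMatrix, hb]
    simp only [h1, Matrix.blockDiagonal'_apply_eq, ← map_smul, ← map_sum, ← Pi.single_smul]
    congr 1
    exact map_sum (LinearMap.single k (fun X => U X) X) _ _
  · intro Y _ hY
    refine Finset.sum_eq_zero fun j _ => ?_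
    rw [Matrix.blockDiagonal'_apply_ne _ _ _ hY.symm, zero_smul]
  · simp

end pi

/-! ### Essential surjectivity -/

/-- The left action of `k` and the vector space structure are separate data of a bimodule. They
agree since the action is linear in the scalar and `1` acts as the identity. -/
theorem BiMod.l_apply_eq_smul {k : Type u} [Field k] {A : Type u} [Ring A] [Algebra k A]
    (M : BiMod k k A) (c : k) (x : M.carrier) : M.l c x = c • x := by
  have h : M.l c = c • M.l 1 := by rw [← map_smul, smul_eq_mul, mul_one]
  rw [h, LinearMap.smul_apply, M.l_one]

namespace MatrixBimoduleProblem.Rep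

open BiMod Slot

variable {k : Type u} [Field k] [IsAlgClosed k] {𝔄 : MatrixBimoduleProblem k}

/-- The action of `Γ` on a module, by matrices with respect to a basis. -/
def rowAction {ι : Type} [Fintype ι] [DecidableEq ι] (M : BiMod k k 𝔄.Γ)
    (b : Module.Basis ι k M.carrier) : 𝔄.Γ →ₐ[k] Matrix ι ι k :=
  AlgHom.ofLinearMap (rowMatrix b ∘ₗ M.r)
    ((congrArg (rowMatrix b) (LinearMap.ext M.r_one)).trans (rowMatrix_one b))
    (fun x y => (congrArg (rowMatrix b) (LinearMap.ext (M.r_mul x y))).trans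
      (rowMatrix_mul b (M.r y) (M.r x)))

/-- Every finite-dimensional `Γ`-module is given by a representation of the problem. -/
theorem exists_basis_rowMatrix (M : BiMod k k 𝔄.Γ) [Module.Finite k M.carrier] :
    ∃ (P : 𝔄.Rep) (b : Module.Basis P.Idx k M.carrier), ∀ x, rowMatrix b (M.r x) = P.ρΓ x := by
  -- A right action is an antihomomorphism into the endomorphisms. On `R` it is a homomorphism,
  -- because `R` is commutative.
  obtain ⟨d, W, h, b, hb⟩ := MinAlg.exists_regular_basis 𝔄.kind
    (AlgHom.ofLinearMap (M.r ∘ₗ 𝔄.inc.toLinearMap)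
      (LinearMap.ext fun x => (congrArg (M.r · x) (map_one 𝔄.inc)).trans (M.r_one x))
      fun r s => LinearMap.ext fun x =>
        (congrArg (M.r · x) ((congrArg 𝔄.inc (mul_comm r s)).trans (map_mul 𝔄.inc s r))).trans
          (M.r_mul _ _ x))
  -- The bimodule `matMod` depends only on the dimensions and the regular matrices. A provisional
  -- representation with zero matrices thus provides it before the matrices `P(a_l)` are read off.
  let P₀ : 𝔄.Rep := ⟨d, W, h, fun _ => 0⟩
  let G : 𝔄.N →ₗ[k] matMod P₀ P₀ := (rowAction M b).toLinearMap ∘ₗ TensAlg.inclN 𝔄.N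
  let P : 𝔄.Rep := ⟨d, W, h, fun l =>
    unblk (P := P₀) (Q := P₀) (𝔄.asrc l) (𝔄.atgt l) (G (𝔄.a l))⟩
  have hinc : ∀ r, rowAction M b (𝔄.inc r) = P.ρ r := hb
  let g : BiMod.Hom 𝔄.N (matMod P P) :=
    { toLin := G
      map_l := fun r x => (congrArg (rowAction M b) (TensAlg.inclN_l 𝔄.N r x)).trans
        ((map_mul (rowAction M b) _ _).trans
          (congrArg (· * rowAction M b (TensAlg.inclN 𝔄.N x)) (hinc r)))
      map_r := fun r x => (congrArg (rowAction M b) (TensAlg.inclN_r 𝔄.N r x)).trans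
        ((map_mul (rowAction M b) _ _).trans
          (congrArg (rowAction M b (TensAlg.inclN 𝔄.N x) * ·) (hinc r))) }
  -- The generator `a_l` is fixed by its idempotents, so it acts by a single block. No entries are
  -- lost when that block alone is recorded.
  have hg : g = P.ρN := quasiFree.hom_ext 𝔄.aIdem_mul_self fun l => by
    have h1 : g.toLin (𝔄.a l) = blk (unblk (𝔄.asrc l) (𝔄.atgt l) (g.toLin (𝔄.a l))) := by
      rw [blk_unblk]
      exact (congrArg g.toLin (quasiFree.act2_gen 𝔄.aIdem_mul_self l).symm).trans
        (g.map_act2 _ _)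
    exact h1.trans (P.ρN_a l).symm
  have key : rowAction M b = P.ρΓ := TensAlg.algHom_ext
    (fun r => (hinc r).trans (P.ρΓ_inc r).symm) fun x =>
      (congrArg (fun f : BiMod.Hom 𝔄.N (matMod P P) => toMat (f.toLin x)) hg).trans
        (P.ρΓ_inclN x).symm
  exact ⟨P, b, fun x => congrArg (fun f => f x) key⟩

/-- Taking coordinates in the basis of `exists_basis_rowMatrix` is a `Γ`-linear isomorphism onto row
vectors, and it induces an isomorphism in `R(𝔅)`. -/
instance : (toBocsFunctor 𝔄).EssSurj where
  mem_essImage Y := by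
    obtain ⟨M, hM⟩ := Y
    let M' : BiMod k k 𝔄.Γ := M
    have : Module.Finite k M'.carrier := hM
    obtain ⟨P, b, hb⟩ := exists_basis_rowMatrix M'
    have hr : ∀ (a : 𝔄.Γ) (x : P.Idx → k), b.equivFun.symm (Matrix.vecMul x (P.ρΓ a)) =
        M'.r a (b.equivFun.symm x) := fun a x => by rw [← hb, equivFun_symm_vecMul]
    let θ : BiMod.Hom (vecMod P) M' :=
      { toLin := b.equivFun.symm.toLinearMap
        map_l := fun c x => (map_smul b.equivFun.symm c (toVec x)).trans
          (l_apply_eq_smul M' c _).symm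
        map_r := fun a x => hr a (toVec x) }
    let θ' : BiMod.Hom M' (vecMod P) :=
      { toLin := b.equivFun.toLinearMap
        map_l := fun c x => (congrArg b.equivFun (l_apply_eq_smul M' c x)).trans
          (map_smul b.equivFun c x)
        map_r := fun a x => b.equivFun.symm.injective
          ((b.equivFun.symm_apply_apply _).trans (((hr a (b.equivFun x)).trans
            (congrArg (M'.r a) (b.equivFun.symm_apply_apply x))).symm)) }
    exact ⟨P, ⟨Bocs.Rep.isoOfHom (P := toBocs P) (Q := ⟨M, hM⟩) θ θ'
      (fun x => b.equivFun.apply_symm_apply (toVec x)) fun x => b.equivFun.symm_apply_apply x⟩⟩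

end MatrixBimoduleProblem.Rep

end

theorem theorem1p3p6 {k : Type u} [Field k] [IsAlgClosed k] (𝔄 : MatrixBimoduleProblem k) :
    Nonempty (𝔄.Rep ≌ 𝔄.bocs.Rep) := by
  -- The fields are filled by the instances for full, faithful and essentially surjective.
  have : (MatrixBimoduleProblem.Rep.toBocsFunctor 𝔄).IsEquivalence := {}
  exact ⟨(MatrixBimoduleProblem.Rep.toBocsFunctor 𝔄).asEquivalence⟩
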